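/- Let $a,b>0$, $p\in[1,2]$, $\alpha,\beta\in\mathbb R\setminus\{0\}$, $0<\tau_1<\tau_2$, and let $\lambda\in L^\infty(\tau_1,\tau_2)$ satisfy $\lambda>0$ a.e. and $$|\alpha|+|\beta|\int_{\tau_1}^{\tau_2}\lambda(s)\,ds<1 .$$ Let $0<L<\pi\sqrt{3b/a}$. Consider the Kawahara system $$\begin{cases} \partial_tu+a\,\partial_xu+b\,\partial_x^3u-\partial_x^5u+u^p\,\partial_xu=0, & x\in(0,L),\ t>0,\\ u(t,0)=u(t,L)=\partial_xu(t,0)=\partial_xu(t,L)=0, & t>0,\\ \partial_x^2u(t,L)=\alpha\,\partial_x^2u(t,0)+\beta\displaystyle\int_{t-\tau_2}^{t-\tau_1}\lambda(t-s)\,\partial_x^2u(s,0)\,ds, & t>0,\\ \partial_x^2u(t,0)=z_0(t),\ t\in(-\tau_2,0),\qquad u(0,x)=u_0(x),\ x\in(0,L). \end{cases}$$ Here, for $u<0$, the power $u^p$ is read as $c|u|^p$ with a fixed constant $c\in[-1,1]$ ($c=(-1)^p$ gives the usual $u^p$ for $p=1,2$). The initial data are $u_0\in L^2(0,L)$ and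 $z_0$ with $(\rho,s)\mapsto z_0(-\rho s)$ in $L^2((0,1)\times(\tau_1,\tau_2))$, and $$\|(u_0,z_0)\|_H^2=\int_0^Lu_0^2\,dx+|\beta|\int_{\tau_1}^{\tau_2}\!\int_0^1 s\lambda(s)\,z_0(-\rho s)^2\,d\rho\,ds .$$ A solution is a function $u\in C([0,\infty);L^2(0,L))\cap L^2_{loc}([0,\infty);H^2_0(0,L))$ with $u(0)=u_0$ together with a function $y$ on $(-\tau_2,\infty)$ (the trace $y(t)=\partial_x^2u(t,0)$), $y=z_0$ a.e. on $(-\tau_2,0)$, $y\in L^2_{loc}([0,\infty))$, such that for all $t\ge0$ and all smooth $\varphi$ with $\varphi=\varphi'=0$ at $x=0$ and $x=L$, $$\int_0^Lu(t)\varphi\,dx=\int_0^Lu_0\varphi\,dx+\int_0^t\Big[\int_0^Lu\,(a\varphi'+b\varphi'''-\varphi^{(5)})\,dx+\mathcal F(r)\,\varphi''(L)-y(r)\,\varphi''(0)-\int_0^Lu^p\,\partial_xu\,\varphi\,dx\Big]dr,$$ where $\mathcal F(r)=\alpha y(r)+\beta\int_{r-\tau_2}^{r-\tau_1}\lambda(r-s)y(s)\,ds$.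 Its energy is $$E(t)=\int_0^Lu^2(t,x)\,dx+|\beta|\int_{\tau_1}^{\tau_2}s\lambda(s)\int_0^1y(t-s\rho)^2\,d\rho\,ds,\qquad t\ge0 .$$ Then: (i) There exist $r>0$ and positive constants $\kappa,\mu$ such that for all initial data with $\|(u_0,z_0)\|_H<r$, every solution satisfies $$E(t)\le\kappa\,E(0)\,e^{-2\mu t},\qquad t>0 .$$ (ii) The rate is explicit: there is $\eta>0$ such that for all $\mu_1,\mu_2\in(0,\eta)$, all $\delta>0$, all $$0<r<\left(\frac{(p+2)(3\pi^2b-aL^2)}{2\pi^2L^{2-p/2}}\right)^{1/p}$$ and all $$0<\mu<\min\left\{\frac{\mu_2|\beta|e^{-\delta\tau_2}\delta}{2(1+\mu_1|\beta|)},\ \frac{\mu_1}{2L^2(1+L\mu_1)(p+2)}\Big[(p+2)(3\pi^2b-aL^2)-2\pi^2L^{2-p/2}r^p\Big]\right\}$$ there is $\kappa>0$ such that the estimate in (i) holds, with these $r,\kappa,\mu$, for all initial data with $\|(u_0,z_0)\|_H<r$ and every solution. -/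

import Mathlib

open MeasureTheory Set Filter Topology
open scoped ContDiff

noncomputable section

/-- The space `L²(0, L)`. -/
abbrev L2 (L : ℝ) : Type := Lp ℝ 2 (volume.restrict (Ioo (0 : ℝ) L))

/-- `f ∈ H²₀(0, L)` with first and second weak derivatives `f₁`, `f₂ ∈ L²(0, L)`: almost
everywhere `f` is the primitive of `f₁` and `f₁` the primitive of `f₂`, both vanishing at `0`,
and both primitives vanish at `L` as well. -/
def HasH02Derivs (L : ℝ) (f f₁ f₂ : L2 L) : Prop :=
  (∀ᵐ x ∂volume.restrict (Ioo (0 : ℝ) L), f₁ x = ∫ ξ in (0 : ℝ)..x, f₂ ξ) ∧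
  (∀ᵐ x ∂volume.restrict (Ioo (0 : ℝ) L), f x = ∫ ξ in (0 : ℝ)..x, f₁ ξ) ∧
  (∫ ξ in (0 : ℝ)..L, f₂ ξ) = 0 ∧
  (∫ ξ in (0 : ℝ)..L, f₁ ξ) = 0

/-- The power `v ^ p` of a real number `v` of any sign: `v ^ p` for `v ≥ 0` and `c |v| ^ p` for
`v < 0`. The constant `c` fixes the reading for negative `v`: `c = -1` gives `v` for `p = 1`,
`c = 1` gives `v²` for `p = 2`; for non-integer `p`, `c = 1` is `|v| ^ p`, `c = -1` is
`sign v |v| ^ p`, and `c = cos (p π)` is the real part of the principal complex power. -/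
def realPow (p c v : ℝ) : ℝ := if 0 ≤ v then v ^ p else c * |v| ^ p

theorem realPow_one (v : ℝ) : realPow 1 (-1) v = v := by
  unfold realPow
  split_ifs with h
  · simp
  · simp [abs_of_neg (not_le.mp h)]

theorem realPow_two (v : ℝ) : realPow 2 1 v = v ^ 2 := by
  unfold realPow
  split_ifs with h <;> simp

/-- The feedback `α y(t) + β ∫_{t-τ₂}^{t-τ₁} lam(t-s) y(s) ds`, where `y(t) = ∂ₓ²u(t,0)`. -/
def feedback (α β τ₁ τ₂ : ℝ) (lam y : ℝ → ℝ) (t : ℝ) : ℝ :=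
  α * y t + β * ∫ s in (t - τ₂)..(t - τ₁), lam (t - s) * y s

/-- The norm in `H = L²(0,L) × L²((0,1) × (τ₁,τ₂))` of `(u₀, (ρ, s) ↦ z₀(-ρ s))`. -/
def normH (L β τ₁ τ₂ : ℝ) (lam : ℝ → ℝ) (u₀ : L2 L) (z₀ : ℝ → ℝ) : ℝ :=
  Real.sqrt ((∫ x in (0 : ℝ)..L, (u₀ x) ^ 2) +
    |β| * ∫ s in τ₁..τ₂, ∫ ρ in (0 : ℝ)..1, s * lam s * (z₀ (-(ρ * s))) ^ 2)

/-- The energy `E(t)` of a solution `u` whose boundary trace `∂ₓ²u(·,0)` is `y`. -/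
def energy (L β τ₁ τ₂ : ℝ) (lam : ℝ → ℝ) (u : ℝ → L2 L) (y : ℝ → ℝ) (t : ℝ) : ℝ :=
  (∫ x in (0 : ℝ)..L, (u t x) ^ 2) +
    |β| * ∫ s in τ₁..τ₂, s * lam s * ∫ ρ in (0 : ℝ)..1, (y (t - s * ρ)) ^ 2

/-- `u` is a global (mild, equivalently weak) solution of
`u_t + a u_x + b u_xxx - u_xxxxx + u^p u_x = 0` on `(0, L)` with
`u(t,0) = u(t,L) = u_x(t,0) = u_x(t,L) = 0`, `u_xx(t,L) = α y(t) + β ∫ lam(t-s) y(s) ds`, where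
`y(t) = u_xx(t,0)` for `t > 0` and `y = z₀` on `(-τ₂, 0)`, and `u(0) = u₀`.

It belongs to `C([0,∞); L²(0,L)) ∩ L²_loc([0,∞); H²₀(0,L))`, and `y ∈ L²_loc([0,∞))`.
The functions `ux`, `uxx` are the first and second weak derivatives of `u` in space.
The equation and the two second-order boundary conditions are expressed by testing with all smooth
`φ` such that `φ = φ' = 0` at `0` and `L` (integrate by parts: the boundary terms
`u_xx(t,L) φ''(L) - u_xx(t,0) φ''(0)` remain) and integrating in time. -/
structure IsSolution (a b L α β τ₁ τ₂ p c : ℝ) (lam : ℝ → ℝ) (u₀ : L2 L) (z₀ : ℝ → ℝ)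
    (u : ℝ → L2 L) (y : ℝ → ℝ) : Prop where
  continuousOn : ContinuousOn u (Ici 0)
  initial : u 0 = u₀
  history : ∀ᵐ t ∂volume.restrict (Ioo (-τ₂) 0), y t = z₀ t
  trace_memLp : ∀ T : ℝ, MemLp y 2 (volume.restrict (Ioo 0 T))
  equation : ∃ ux uxx : ℝ → L2 L,
    (∀ T : ℝ, MemLp uxx 2 (volume.restrict (Ioo 0 T))) ∧
    (∀ᵐ t ∂volume.restrict (Ioi (0 : ℝ)), HasH02Derivs L (u t) (ux t) (uxx t)) ∧
    ∀ φ : ℝ → ℝ, ContDiff ℝ ∞ φ → φ 0 = 0 → φ L = 0 → deriv φ 0 = 0 → deriv φ L = 0 →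
      ∀ t : ℝ, 0 ≤ t →
        (∫ x in (0 : ℝ)..L, u t x * φ x) = (∫ x in (0 : ℝ)..L, u₀ x * φ x) +
          ∫ r in (0 : ℝ)..t,
            ((∫ x in (0 : ℝ)..L, u r x *
                (a * deriv φ x + b * iteratedDeriv 3 φ x - iteratedDeriv 5 φ x))
              + feedback α β τ₁ τ₂ lam y r * iteratedDeriv 2 φ L
              - y r * iteratedDeriv 2 φ 0
              - ∫ x in (0 : ℝ)..L, realPow p c (u r x) * ux r x * φ x)

/-- Exponential decay with constants `κ`, `μ` of the energy of every solution whose initial data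
`(u₀, z₀) ∈ H` have norm less than `r`. -/
def DecaysExponentially (a b L α β τ₁ τ₂ p c : ℝ) (lam : ℝ → ℝ) (r κ μ : ℝ) : Prop :=
  ∀ (u₀ : L2 L) (z₀ : ℝ → ℝ),
    MemLp (fun q : ℝ × ℝ => z₀ (-(q.1 * q.2))) 2
      (volume.restrict (Ioo (0 : ℝ) 1 ×ˢ Ioo τ₁ τ₂)) →
    normH L β τ₁ τ₂ lam u₀ z₀ < r →
    ∀ (u : ℝ → L2 L) (y : ℝ → ℝ), IsSolution a b L α β τ₁ τ₂ p c lam u₀ z₀ u y →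
      ∀ t : ℝ, 0 < t →
        energy L β τ₁ τ₂ lam u y t ≤
          κ * energy L β τ₁ τ₂ lam u y 0 * Real.exp (-2 * μ * t)

end

/-! The proof is a Lyapunov argument. Let `ν` be the measure `lam(s) ds` of delays, `Λ` its mass, `θ
= |α| + |β| Λ < 1` and `m = 1 - θ`. With `N(t) = ∫ ∫_{t-s}^t y² dσ dν(s)` the energy is `E = ‖u‖² +
|β| N`. Let `M` be `N` with the extra weight `exp(-δ(t-σ))` in the inner integral. The functional is
`V = ∫ (1 + μ₁ x) u² + |β| N + m |β| M`, and `E ≤ V ≤ (1 + L μ₁ + m) E`.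

Multiplying the equation by `(1 + μ₁ x) u` produces the boundary terms `(1 + μ₁ L) F² - y²`, where
`F` is the feedback, the interior terms `-5 μ₁ ‖u_xx‖² - 3 b μ₁ ‖u_x‖² + a μ₁ ‖u‖²`, and a nonlinear
term of size at most `2 μ₁ (p+2)⁻¹ ∫ |u|^(p+2)`. Boundary: Cauchy-Schwarz gives `F² ≤ θ (|α| y² +
|β| ∫ y(t-s)² dν)`, while `N' = Λ y² - ∫ y(t-s)² dν`; if `(1 + μ₁ L) θ ≤ 1`, all these terms are
absorbed, with `m y²` to spare. The spare part pays for `M`, whose derivative contains the damping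
`-δ M` that `N'` lacks (`boundary_rate_le`). Interior: the sharp Poincaré inequality and `a L² < 3
π² b` give decay. The nonlinear term is at most a multiple of `‖u‖^p ‖u_x‖²`
(`HasH02Derivs.inner_powPrimLp_le`), hence small: with `μ₁ = 0` and without `M` the same computation
shows that `E` does not increase, so `‖u(t)‖ ≤ r` (`interior_rate_le`). Thus `V' ≤ -2 μ V` almost
everywhere.

For weak solutions the multiplier must be justified (`weighted_energy_identity`). Steklov averages
in time solve, at each fixed time, a stationary fifth order problem whose datum is a difference
quotient of `u`. There the second derivative turns out to be twice more a primitive and to take the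
prescribed boundary values (`exists_primitive_of_weak`), so the multiplier is legitimate; the
averaged identities then pass to the limit because all their terms are quadratic and averages
converge in norm. -/

/-! ### Calculus of primitives of integrable functions -/

/-- `F` is on `[0, T]` the primitive of the integrable function `f`. -/
structure IsPrimitiveOn (T : ℝ) (F f : ℝ → ℝ) : Prop where
  intervalIntegrable : IntervalIntegrable f volume 0 T
  eq_add : ∀ x ∈ Icc 0 T, F x = F 0 + ∫ ξ in (0 : ℝ)..x, f ξ

namespace IsPrimitiveOn

variable {T : ℝ} {F G f g : ℝ → ℝ}

theorem of_integral (hf : IntervalIntegrable f volume 0 T) :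
    IsPrimitiveOn T (fun x => ∫ ξ in (0 : ℝ)..x, f ξ) f :=
  ⟨hf, fun x _ => by simp⟩

theorem integral_eq (hT : 0 ≤ T) (hF : IsPrimitiveOn T F f) :
    ∫ x in (0 : ℝ)..T, f x = F T - F 0 := by
  rw [hF.eq_add T (right_mem_Icc.2 hT)]; ring

theorem continuousOn (hT : 0 ≤ T) (hF : IsPrimitiveOn T F f) : ContinuousOn F (Icc 0 T) := by
  have h := intervalIntegral.continuousOn_primitive_interval' hF.intervalIntegrable left_mem_uIcc
  rw [uIcc_of_le hT] at h
  exact (continuousOn_const.add h).congr hF.eq_add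

theorem mono {S : ℝ} (hS : 0 ≤ S) (hST : S ≤ T) (hF : IsPrimitiveOn T F f) :
    IsPrimitiveOn S F f :=
  ⟨hF.intervalIntegrable.mono_set (by
    rw [uIcc_of_le hS, uIcc_of_le (hS.trans hST)]; exact Icc_subset_Icc_right hST),
    fun x hx => hF.eq_add x ⟨hx.1, hx.2.trans hST⟩⟩

theorem intervalIntegrable_fun (hT : 0 ≤ T) (hF : IsPrimitiveOn T F f) :
    IntervalIntegrable F volume 0 T := by
  apply ContinuousOn.intervalIntegrable
  rw [uIcc_of_le hT]; exact hF.continuousOn hT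

theorem of_hasDerivAt (h : ∀ x, HasDerivAt F (f x) x) (hf : Continuous f) :
    IsPrimitiveOn T F f := by
  refine ⟨hf.intervalIntegrable _ _, fun x _ => ?_⟩
  rw [intervalIntegral.integral_eq_sub_of_hasDerivAt (fun y _ => h y) (hf.intervalIntegrable _ _)]
  ring

theorem const (T k : ℝ) : IsPrimitiveOn T (fun _ => k) (fun _ => 0) :=
  of_hasDerivAt (fun x => hasDerivAt_const x k) continuous_const

theorem id (T : ℝ) : IsPrimitiveOn T (fun x => x) (fun _ => 1) :=
  of_hasDerivAt (fun x => hasDerivAt_id x) continuous_const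

theorem congr_fun (hF : IsPrimitiveOn T F f) (h : ∀ x ∈ Icc 0 T, G x = F x) (hT : 0 ≤ T) :
    IsPrimitiveOn T G f :=
  ⟨hF.intervalIntegrable, fun x hx => by
    rw [h x hx, h 0 ⟨le_rfl, hT⟩]; exact hF.eq_add x hx⟩

theorem congr_deriv (hF : IsPrimitiveOn T F f) (hT : 0 ≤ T)
    (h : ∀ᵐ x ∂volume.restrict (Ioo 0 T), g x = f x) : IsPrimitiveOn T F g := by
  have h' : ∀ᵐ x ∂volume.restrict (Ioc 0 T), f x = g x := by
    rw [← restrict_Ioo_eq_restrict_Ioc]; filter_upwards [h] with x hx using hx.symm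
  refine ⟨hF.intervalIntegrable.congr_ae (by rwa [uIoc_of_le hT]), fun x hx => ?_⟩
  rw [hF.eq_add x hx]
  congr 1
  apply intervalIntegral.integral_congr_ae_restrict
  rw [uIoc_of_le hx.1]
  exact ae_restrict_of_ae_restrict_of_subset (Ioc_subset_Ioc_right hx.2) h'

theorem sub_integrable {x : ℝ} (hF : IsPrimitiveOn T F f) (hx : x ∈ Icc 0 T) :
    IntervalIntegrable f volume 0 x :=
  (hF.mono hx.1 hx.2).intervalIntegrable

theorem add (hF : IsPrimitiveOn T F f) (hG : IsPrimitiveOn T G g) :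
    IsPrimitiveOn T (fun x => F x + G x) (fun x => f x + g x) := by
  refine ⟨hF.intervalIntegrable.add hG.intervalIntegrable, fun x hx => ?_⟩
  rw [intervalIntegral.integral_add (hF.sub_integrable hx) (hG.sub_integrable hx),
    hF.eq_add x hx, hG.eq_add x hx]
  ring

theorem const_mul (k : ℝ) (hF : IsPrimitiveOn T F f) :
    IsPrimitiveOn T (fun x => k * F x) (fun x => k * f x) := by
  refine ⟨hF.intervalIntegrable.const_mul k, fun x hx => ?_⟩
  rw [intervalIntegral.integral_const_mul, hF.eq_add x hx]
  ring

theorem neg (hF : IsPrimitiveOn T F f) : IsPrimitiveOn T (fun x => -F x) (fun x => -f x) := by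
  simpa using hF.const_mul (-1)

theorem sub (hF : IsPrimitiveOn T F f) (hG : IsPrimitiveOn T G g) :
    IsPrimitiveOn T (fun x => F x - G x) (fun x => f x - g x) := by
  simpa [sub_eq_add_neg] using hF.add hG.neg

/-- Primitives are absolutely continuous and differentiable almost everywhere, so the product rule
holds in integrated form. Later integrations by parts are done by evaluating one such total
derivative. -/
theorem mul (hT : 0 ≤ T) (hF : IsPrimitiveOn T F f) (hG : IsPrimitiveOn T G g) :
    IsPrimitiveOn T (fun x => F x * G x) (fun x => f x * G x + F x * g x) := by
  have hint : ∀ {S : ℝ}, 0 ≤ S → S ≤ T →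
      IntervalIntegrable (fun x => f x * G x + F x * g x) volume 0 S := by
    intro S hS hST
    have hcG := (hG.mono hS hST).continuousOn hS
    have hcF := (hF.mono hS hST).continuousOn hS
    rw [← uIcc_of_le hS] at hcG hcF
    exact ((hF.mono hS hST).intervalIntegrable.mul_continuousOn hcG).add
      ((hG.mono hS hST).intervalIntegrable.continuousOn_mul hcF)
  refine ⟨hint hT le_rfl, fun x hx => ?_⟩
  have key : ∀ {H h : ℝ → ℝ}, IsPrimitiveOn T H h →
      AbsolutelyContinuousOnInterval (fun z => H 0 + ∫ ξ in (0 : ℝ)..z, h ξ) 0 x := fun hH =>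
    ((LipschitzWith.const (_ : ℝ)).lipschitzOnWith.absolutelyContinuousOnInterval).add
      ((hH.sub_integrable hx).absolutelyContinuousOnInterval_intervalIntegral left_mem_uIcc)
  have h := (key hF).integral_deriv_mul_eq_sub (key hG)
  have e : ∫ ξ in (0 : ℝ)..x, f ξ * G ξ + F ξ * g ξ
      = F x * G x - F 0 * G 0 := by
    rw [hF.eq_add x hx, hG.eq_add x hx]
    convert h using 1
    · apply intervalIntegral.integral_congr_ae
      filter_upwards [(hF.sub_integrable hx).ae_hasDerivAt_integral,
        (hG.sub_integrable hx).ae_hasDerivAt_integral] with z hz₁ hz₂ hz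
      have hz' := uIoc_subset_uIcc hz
      have hzT : z ∈ Icc 0 T := by
        rw [uIcc_of_le hx.1] at hz'; exact ⟨hz'.1, hz'.2.trans hx.2⟩
      rw [((hz₁ hz' 0 left_mem_uIcc).const_add (F 0)).deriv,
        ((hz₂ hz' 0 left_mem_uIcc).const_add (G 0)).deriv, ← hF.eq_add z hzT, ← hG.eq_add z hzT]
    · simp
  rw [e]; ring

/-- Continuity of `f` makes `F` differentiable at every interior point, so the ordinary chain rule
and fundamental theorem of calculus suffice. -/
theorem comp_deriv {P P' : ℝ → ℝ} (hT : 0 ≤ T) (hF : IsPrimitiveOn T F f)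
    (hf : ContinuousOn f (Icc 0 T)) (hP : ∀ v, HasDerivAt P (P' v) v) (hP' : Continuous P') :
    IsPrimitiveOn T (fun x => P (F x)) (fun x => P' (F x) * f x) := by
  have hFc := hF.continuousOn hT
  have hc : ContinuousOn (fun x => P' (F x) * f x) (Icc 0 T) := (hP'.comp_continuousOn hFc).mul hf
  have hPc : Continuous P := continuous_iff_continuousAt.2 fun v => (hP v).continuousAt
  refine ⟨ContinuousOn.intervalIntegrable (by rwa [uIcc_of_le hT]), fun x hx => ?_⟩
  have hsub : Icc 0 x ⊆ Icc 0 T := Icc_subset_Icc_right hx.2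
  rw [intervalIntegral.integral_eq_sub_of_hasDerivAt_of_le hx.1
    ((hPc.comp_continuousOn hFc).mono hsub) (f' := fun x => P' (F x) * f x)]
  · simp
  · intro z hz
    have hzT : z ∈ Ioo 0 T := ⟨hz.1, hz.2.trans_le hx.2⟩
    have hd : HasDerivAt F (f z) z := by
      have h1 : HasDerivAt (fun z => F 0 + ∫ ξ in (0 : ℝ)..z, f ξ) (f z) z := by
        apply HasDerivAt.const_add
        apply intervalIntegral.integral_hasDerivAt_right
          (hF.sub_integrable ⟨hzT.1.le, hzT.2.le⟩)
        · exact (hf.mono Ioo_subset_Icc_self).stronglyMeasurableAtFilter isOpen_Ioo z hzT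
        · exact hf.continuousAt (Icc_mem_nhds hzT.1 hzT.2)
      apply h1.congr_of_eventuallyEq
      filter_upwards [Icc_mem_nhds hzT.1 hzT.2] with r hr using hF.eq_add r hr
    exact (hP (F z)).comp z hd
  · apply ContinuousOn.intervalIntegrable
    rw [uIcc_of_le hx.1]; exact hc.mono hsub

end IsPrimitiveOn

/-- The primitive vanishing at `0` of a smooth function is smooth. -/
theorem contDiff_primitive {ψ : ℝ → ℝ} (hψ : ContDiff ℝ ∞ ψ) (k : ℝ) :
    ContDiff ℝ ∞ (fun x => k + ∫ ξ in (0 : ℝ)..x, ψ ξ) := by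
  have hd : ∀ x, HasDerivAt (fun x => k + ∫ ξ in (0 : ℝ)..x, ψ ξ) (ψ x) x := fun x =>
    (intervalIntegral.integral_hasDerivAt_right (hψ.continuous.intervalIntegrable _ _)
      (hψ.continuous.stronglyMeasurableAtFilter _ _) hψ.continuous.continuousAt).const_add k
  rw [contDiff_infty_iff_deriv]
  refine ⟨fun x => (hd x).differentiableAt, ?_⟩
  rwa [show deriv (fun x => k + ∫ ξ in (0 : ℝ)..x, ψ ξ) = ψ from funext fun x => (hd x).deriv]

theorem deriv_primitive {ψ : ℝ → ℝ} (hψ : Continuous ψ) (k : ℝ) :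
    deriv (fun x => k + ∫ ξ in (0 : ℝ)..x, ψ ξ) = ψ :=
  funext fun _ => ((intervalIntegral.integral_hasDerivAt_right (hψ.intervalIntegrable _ _)
      (hψ.stronglyMeasurableAtFilter _ _) hψ.continuousAt).const_add k).deriv

theorem IsPrimitiveOn.of_contDiff {T : ℝ} {φ : ℝ → ℝ} (hφ : ContDiff ℝ ∞ φ) :
    IsPrimitiveOn T φ (deriv φ) :=
  .of_hasDerivAt (fun x => (hφ.differentiable (by simp) x).hasDerivAt)
    (hφ.continuous_deriv (by simp))

/-! ### Spatial analysis: Poincaré inequality and the stationary fifth order problem -/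

/-- **Sharp Poincaré inequality** on `(0, L)`. -/
theorem poincare {L : ℝ} {w w₁ : ℝ → ℝ} (hL : 0 < L) (hw : IsPrimitiveOn L w w₁)
    (hw₁ : ContinuousOn w₁ (Icc 0 L)) (h0 : w 0 = 0) (h1 : w L = 0) :
    Real.pi ^ 2 * ∫ x in (0 : ℝ)..L, w x ^ 2 ≤ L ^ 2 * ∫ x in (0 : ℝ)..L, w₁ x ^ 2 := by
  have hwc := hw.continuousOn hL.le
  -- For `k < π / L` the comparison function `cos (k (x - L/2))` is positive on the closed interval;
  -- at `k = π / L` it vanishes at the ends, so that value is reached only as a limit.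
  have main : ∀ k : ℝ, 0 < k → k < Real.pi / L →
      k ^ 2 * ∫ x in (0 : ℝ)..L, w x ^ 2 ≤ ∫ x in (0 : ℝ)..L, w₁ x ^ 2 := by
    intro k hk hkL
    have hcos : ∀ x ∈ Icc 0 L, 0 < Real.cos (k * (x - L / 2)) := by
      intro x hx
      rw [lt_div_iff₀ hL] at hkL
      apply Real.cos_pos_of_mem_Ioo
      constructor
      · have : 0 ≤ k * x := mul_nonneg hk.le hx.1
        nlinarith
      · have : k * x ≤ k * L := mul_le_mul_of_nonneg_left hx.2 hk.le
        nlinarith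
    -- The logarithmic derivative of the comparison function. It solves the Riccati equation `θ' =
    -- -k² - θ²`, whence `w₁² - k² w² - (θ w²)' = (w₁ - θ w)²`.
    set θ : ℝ → ℝ := fun x => -k * Real.tan (k * (x - L / 2)) with hθ
    have hd : ∀ x ∈ Icc 0 L, HasDerivAt θ (-k ^ 2 - θ x ^ 2) x := by
      intro x hx
      have h := (Real.hasDerivAt_tan (hcos x hx).ne').comp x
        (((hasDerivAt_id x).sub_const (L / 2)).const_mul k)
      refine (h.const_mul (-k)).congr_deriv ?_
      have hxθ : θ x = -k * (Real.sin (k * (x - L / 2)) / Real.cos (k * (x - L / 2))) := by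
        rw [← Real.tan_eq_sin_div_cos]
      rw [hxθ]
      have hsc := Real.sin_sq_add_cos_sq (k * (x - L / 2))
      have hc0 := (hcos x hx).ne'
      generalize Real.cos (k * (x - L / 2)) = c at hsc hc0 ⊢
      generalize Real.sin (k * (x - L / 2)) = s at hsc ⊢
      field_simp
      linear_combination hsc
    have hθc : ContinuousOn θ (Icc 0 L) := fun x hx => (hd x hx).continuousAt.continuousWithinAt
    have hθp : IsPrimitiveOn L θ (fun x => -k ^ 2 - θ x ^ 2) := by
      refine ⟨ContinuousOn.intervalIntegrable (by rw [uIcc_of_le hL.le]; fun_prop), fun x hx => ?_⟩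
      have hs : Icc 0 x ⊆ Icc 0 L := Icc_subset_Icc_right hx.2
      rw [intervalIntegral.integral_eq_sub_of_hasDerivAt
        (fun y hy => hd y (hs (by rwa [uIcc_of_le hx.1] at hy)))
        (ContinuousOn.intervalIntegrable (by
          rw [uIcc_of_le hx.1]
          exact (by fun_prop : ContinuousOn (fun x => -k ^ 2 - θ x ^ 2) (Icc 0 L)).mono hs))]
      ring
    have hI := (hθp.mul hL.le (hw.mul hL.le hw)).integral_eq hL.le
    simp only [h0, h1, mul_zero, sub_zero] at hI
    rw [← intervalIntegral.integral_const_mul, ← sub_nonneg]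
    refine le_of_le_of_eq ?_ (congrArg
      (fun z => (∫ x in (0 : ℝ)..L, w₁ x ^ 2) - (∫ x in (0 : ℝ)..L, k ^ 2 * w x ^ 2) - z) hI
      |>.trans (sub_zero _))
    rw [← intervalIntegral.integral_sub, ← intervalIntegral.integral_sub]
    · apply intervalIntegral.integral_nonneg hL.le
      intro x hx
      nlinarith [sq_nonneg (w₁ x - θ x * w x)]
    all_goals
      apply ContinuousOn.intervalIntegrable
      rw [uIcc_of_le hL.le]
      fun_prop
  have hlim : Tendsto (fun k : ℝ => k ^ 2 * ∫ x in (0 : ℝ)..L, w x ^ 2) (𝓝[<] (Real.pi / L))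
      (𝓝 ((Real.pi / L) ^ 2 * ∫ x in (0 : ℝ)..L, w x ^ 2)) :=
    (Continuous.tendsto (by fun_prop) _).mono_left nhdsWithin_le_nhds
  have hle := le_of_tendsto hlim (b := ∫ x in (0 : ℝ)..L, w₁ x ^ 2) (by
    filter_upwards [Ioo_mem_nhdsLT (div_pos Real.pi_pos hL)] with k hk using main k hk.1 hk.2)
  rw [div_pow, div_mul_eq_mul_div, div_le_iff₀ (by positivity)] at hle
  linarith

/-- The weak fifth order boundary value problem solved by `w` implies that `w₂` is a primitive,
with the prescribed boundary values. -/
theorem exists_primitive_of_weak {L a b F Y : ℝ} {g q w w₁ w₂ : ℝ → ℝ} (hL : 0 < L)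
    (hg : IntervalIntegrable g volume 0 L) (hq : IntervalIntegrable q volume 0 L)
    (hw₁ : IsPrimitiveOn L w₁ w₂) (hw : IsPrimitiveOn L w w₁)
    (hw0 : w 0 = 0) (hwL : w L = 0) (hw₁0 : w₁ 0 = 0) (hw₁L : w₁ L = 0)
    (h : ∀ φ : ℝ → ℝ, ContDiff ℝ ∞ φ → φ 0 = 0 → φ L = 0 → deriv φ 0 = 0 → deriv φ L = 0 →
      ∫ x in (0 : ℝ)..L, g x * φ x =
        (∫ x in (0 : ℝ)..L, w x *
          (a * deriv φ x + b * iteratedDeriv 3 φ x - iteratedDeriv 5 φ x))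
        + (∫ x in (0 : ℝ)..L, q x * deriv φ x)
        + F * iteratedDeriv 2 φ L - Y * iteratedDeriv 2 φ 0) :
    ∃ R K v : ℝ → ℝ, IsPrimitiveOn L R g ∧
      IsPrimitiveOn L K (fun x => R x + a * w x + q x + b * w₂ x) ∧
      IsPrimitiveOn L v K ∧ v 0 = Y ∧ v L = F ∧
      ∀ᵐ x ∂volume.restrict (Ioo 0 L), w₂ x = v x := by
  -- In the sense of distributions `w⁽⁵⁾ = g + (a w + q + b w₂)'`. Integrating this three times
  -- gives a candidate `v₀` for `w₂`, up to a quadratic polynomial.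
  have hG₁ := IsPrimitiveOn.of_integral hg
  set G₁ : ℝ → ℝ := fun x => ∫ ξ in (0 : ℝ)..x, g ξ with hG₁def
  have hK₀' : IntervalIntegrable (fun x => G₁ x + a * w x + q x + b * w₂ x) volume 0 L :=
    (((hG₁.intervalIntegrable_fun hL.le).add
      ((hw.intervalIntegrable_fun hL.le).const_mul a)).add hq).add
      (hw₁.intervalIntegrable.const_mul b)
  have hK₀ := IsPrimitiveOn.of_integral hK₀'
  set K₀ : ℝ → ℝ := fun x => ∫ ξ in (0 : ℝ)..x, (G₁ ξ + a * w ξ + q ξ + b * w₂ ξ) with hK₀def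
  have hv₀ := ((IsPrimitiveOn.of_integral (hK₀.intervalIntegrable_fun hL.le)).add
    (IsPrimitiveOn.const L Y))
  simp only [add_zero] at hv₀
  set v₀ : ℝ → ℝ := fun x => (∫ ξ in (0 : ℝ)..x, K₀ ξ) + Y with hv₀def
  have hv₀0 : v₀ 0 = Y := by simp [hv₀def]
  -- The correction `e x` keeps the value `Y` at `0` and produces the value `F` at `L`; a multiple
  -- of `x (L - x)` remains undetermined.
  set e : ℝ := (F - v₀ L) / L with he
  have hint : IntervalIntegrable (fun x => w₂ x - v₀ x - e * x) volume 0 L :=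
    (hw₁.intervalIntegrable.sub (hv₀.intervalIntegrable_fun hL.le)).sub
      ((continuous_const.mul continuous_id).intervalIntegrable _ _)
  -- testing with `φ` such that `φ''' = ψ`
  have test : ∀ ψ : ℝ → ℝ, ContDiff ℝ ∞ ψ → ∫ x in (0 : ℝ)..L, ψ x * (x * (L - x)) = 0 →
      ∫ x in (0 : ℝ)..L, (w₂ x - v₀ x - e * x) * ψ x = 0 := by
    intro ψ hψ hψq
    -- The value of `φ''(0)` forced by `φ'(L) = k L + ∫ (L - x) ψ = 0`. Orthogonality of `ψ` to `x
    -- (L - x)` is then exactly what gives `φ(L) = 0`.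
    set k : ℝ := -(∫ x in (0 : ℝ)..L, (L - x) * ψ x) / L with hk
    set χ : ℝ → ℝ := fun x => k + ∫ ξ in (0 : ℝ)..x, ψ ξ with hχ
    have hχs : ContDiff ℝ ∞ χ := contDiff_primitive hψ k
    have hχd : deriv χ = ψ := deriv_primitive hψ.continuous k
    set φ₁ : ℝ → ℝ := fun x => 0 + ∫ ξ in (0 : ℝ)..x, χ ξ with hφ₁
    have hφ₁s : ContDiff ℝ ∞ φ₁ := contDiff_primitive hχs 0
    have hφ₁d : deriv φ₁ = χ := deriv_primitive hχs.continuous 0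
    set φ : ℝ → ℝ := fun x => 0 + ∫ ξ in (0 : ℝ)..x, φ₁ ξ with hφ
    have hφs : ContDiff ℝ ∞ φ := contDiff_primitive hφ₁s 0
    have hφd : deriv φ = φ₁ := deriv_primitive hφ₁s.continuous 0
    have hψ's : ContDiff ℝ ∞ (deriv ψ) := (contDiff_infty_iff_deriv.1 hψ).2
    have pψ : IsPrimitiveOn L ψ (deriv ψ) := .of_contDiff hψ
    have pψ' : IsPrimitiveOn L (deriv ψ) (deriv (deriv ψ)) := .of_contDiff hψ's
    have pχ : IsPrimitiveOn L χ ψ := hχd ▸ .of_contDiff hχs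
    have pφ₁ : IsPrimitiveOn L φ₁ χ := hφ₁d ▸ .of_contDiff hφ₁s
    have pφ : IsPrimitiveOn L φ φ₁ := hφd ▸ .of_contDiff hφs
    have hid := IsPrimitiveOn.id L
    have hφ0 : φ 0 = 0 := by simp [hφ]
    have hφ₁0 : φ₁ 0 = 0 := by simp [hφ₁]
    have hχ0 : χ 0 = k := by simp [hχ]
    have hχc := hχs.continuous
    have hψc := hψ.continuous
    have hφ₁c := hφ₁s.continuous
    -- `φ₁ L = 0`
    have hφ₁L : φ₁ L = 0 := by
      have h1 := (((IsPrimitiveOn.const L L).sub hid).mul hL.le pχ).integral_eq hL.le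
      rw [intervalIntegral.integral_add (Continuous.intervalIntegrable (by fun_prop) _ _)
        (Continuous.intervalIntegrable (by fun_prop) _ _)] at h1
      have h2 : ∫ x in (0 : ℝ)..L, (0 - 1) * χ x = -(φ₁ L) := by
        rw [intervalIntegral.integral_const_mul, pφ₁.integral_eq hL.le, hφ₁0]; ring
      have h3 : ∫ x in (0 : ℝ)..L, (L - x) * ψ x = -(k * L) := by rw [hk]; field_simp
      rw [h2, h3, hχ0] at h1
      linarith
    have hχL : χ L * L = ∫ x in (0 : ℝ)..L, x * ψ x := by
      have h1 := (hid.mul hL.le pχ).integral_eq hL.le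
      rw [intervalIntegral.integral_add (Continuous.intervalIntegrable (by fun_prop) _ _)
        (Continuous.intervalIntegrable (by fun_prop) _ _)] at h1
      have h2 : ∫ x in (0 : ℝ)..L, 1 * χ x = 0 := by
        rw [intervalIntegral.integral_const_mul, pφ₁.integral_eq hL.le, hφ₁0, hφ₁L]; ring
      rw [h2] at h1
      linarith
    -- `φ L = 0`
    have hφL : φ L = 0 := by
      have pm := (hid.mul hL.le ((IsPrimitiveOn.const L L).sub hid))
      have h1 := (pm.mul hL.le pχ).integral_eq hL.le
      rw [intervalIntegral.integral_add (Continuous.intervalIntegrable (by fun_prop) _ _)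
        (Continuous.intervalIntegrable (by fun_prop) _ _)] at h1
      have h2 : ∫ x in (0 : ℝ)..L, x * (L - x) * ψ x = 0 := by
        rw [← hψq]; congr 1; ext x; ring
      have h3 := ((((IsPrimitiveOn.const L L).sub hid).sub hid).mul hL.le pφ₁).integral_eq hL.le
      rw [intervalIntegral.integral_add (Continuous.intervalIntegrable (by fun_prop) _ _)
        (Continuous.intervalIntegrable (by fun_prop) _ _), hφ₁0, hφ₁L,
        intervalIntegral.integral_const_mul, pφ.integral_eq hL.le, hφ0] at h3
      have h4 : ∫ x in (0 : ℝ)..L, (1 * (L - x) + x * (0 - 1)) * χ x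
          = ∫ x in (0 : ℝ)..L, (L - x - x) * χ x := by
        congr 1; ext x; ring
      rw [h2, h4] at h1
      linarith
    have it2 : iteratedDeriv 2 φ = χ := by simp [iteratedDeriv_succ, hφd, hφ₁d]
    have it3 : iteratedDeriv 3 φ = ψ := by simp [iteratedDeriv_succ, hφd, hφ₁d, hχd]
    have it5 : iteratedDeriv 5 φ = deriv (deriv ψ) := by
      simp [iteratedDeriv_succ, hφd, hφ₁d, hχd]
    have H := h φ hφs hφ0 hφL (by rw [hφd, hφ₁0]) (by rw [hφd, hφ₁L])
    rw [it2, it3, it5, hφd] at H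
    -- the total derivative that collects all terms
    have P := ((((hG₁.mul hL.le pφ).sub (hK₀.mul hL.le pφ₁)).add (hv₀.mul hL.le pχ)).add
      ((hw.mul hL.le pψ').sub (hw₁.mul hL.le pψ))).sub
        (((hw.mul hL.le pχ).sub (hw₁.mul hL.le pφ₁)).const_mul b)
    have PI := P.integral_eq hL.le
    simp only [hφ0, hφL, hφ₁0, hφ₁L, hw0, hwL, hw₁0, hw₁L, hv₀0, hχ0, mul_zero, zero_mul,
      sub_zero, add_zero, zero_add, sub_self] at PI
    have i1 : IntervalIntegrable (fun x => g x * φ x) volume 0 L :=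
      hg.mul_continuousOn hφs.continuous.continuousOn
    have hwI := hw.intervalIntegrable_fun hL.le
    have hψ''c : Continuous (deriv (deriv ψ)) := hψ's.continuous_deriv (by simp)
    have i2 : IntervalIntegrable
        (fun x => w x * (a * φ₁ x + b * ψ x - deriv (deriv ψ) x)) volume 0 L :=
      hwI.mul_continuousOn (Continuous.continuousOn (by fun_prop))
    have i3 : IntervalIntegrable (fun x => q x * φ₁ x) volume 0 L :=
      hq.mul_continuousOn hφ₁c.continuousOn
    have i4 : IntervalIntegrable (fun x => (w₂ x - v₀ x - e * x) * ψ x) volume 0 L :=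
      hint.mul_continuousOn hψc.continuousOn
    have i5 : IntervalIntegrable (fun x => e * (x * ψ x)) volume 0 L :=
      Continuous.intervalIntegrable (by fun_prop) _ _
    have eI : (∫ x in (0 : ℝ)..L, (w₂ x - v₀ x - e * x) * ψ x) =
        (∫ x in (0 : ℝ)..L, g x * φ x)
        - (∫ x in (0 : ℝ)..L, w x * (a * φ₁ x + b * ψ x - deriv (deriv ψ) x))
        - (∫ x in (0 : ℝ)..L, q x * φ₁ x) - (v₀ L * χ L - Y * k)
        - ∫ x in (0 : ℝ)..L, e * (x * ψ x) := by
      rw [← PI, ← intervalIntegral.integral_sub i1 i2, ← intervalIntegral.integral_sub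
        (i1.sub i2) i3, ← intervalIntegral.integral_sub ((i1.sub i2).sub i3) P.intervalIntegrable,
        ← intervalIntegral.integral_sub (((i1.sub i2).sub i3).sub P.intervalIntegrable) i5]
      congr 1; ext x; ring
    rw [eI, H, intervalIntegral.integral_const_mul, ← hχL, hχ0, he]
    field_simp
    ring
  -- hence `w₂ - v₀` is a quadratic polynomial
  set Q : ℝ := ∫ x in (0 : ℝ)..L, (x * (L - x)) * (x * (L - x)) with hQ
  have hQpos : 0 < Q := by
    apply intervalIntegral.intervalIntegral_pos_of_pos_on
      (Continuous.intervalIntegrable (by fun_prop) _ _) _ hL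
    intro x hx
    have := mul_pos hx.1 (sub_pos.2 hx.2)
    positivity
  set k : ℝ := (∫ x in (0 : ℝ)..L, (w₂ x - v₀ x - e * x) * (x * (L - x))) / Q with hk
  have hint' : IntervalIntegrable (fun x => w₂ x - v₀ x - e * x - k * (x * (L - x))) volume 0 L :=
    hint.sub (Continuous.intervalIntegrable (by fun_prop) _ _)
  -- An arbitrary `ψ` becomes admissible after subtracting its projection `m x (L - x)`. Removing
  -- the projection `k x (L - x)` from the residual makes it orthogonal to every compactly supported
  -- smooth function.
  have hzero : ∀ᵐ x, x ∈ Ioo 0 L → w₂ x - v₀ x - e * x - k * (x * (L - x)) = 0 := by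
    apply isOpen_Ioo.ae_eq_zero_of_integral_contDiff_smul_eq_zero
    · apply IntegrableOn.locallyIntegrableOn
      exact ((intervalIntegrable_iff_integrableOn_Ioc_of_le hL.le).1 hint').mono_set
        Ioo_subset_Ioc_self
    · intro ψ hψ _ hsupp
      have hψc := hψ.continuous
      set m : ℝ := (∫ x in (0 : ℝ)..L, ψ x * (x * (L - x))) / Q with hm
      have i1 : IntervalIntegrable (fun x => ψ x * (x * (L - x))) volume 0 L :=
        Continuous.intervalIntegrable (by fun_prop) _ _
      have i2 : IntervalIntegrable (fun x => m * (x * (L - x) * (x * (L - x)))) volume 0 L :=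
        Continuous.intervalIntegrable (by fun_prop) _ _
      have ht := test (fun x => ψ x - m * (x * (L - x))) (by fun_prop) (by
        calc _ = ∫ x in (0 : ℝ)..L,
              (ψ x * (x * (L - x)) - m * (x * (L - x) * (x * (L - x)))) := by
              congr 1; ext x; ring
          _ = 0 := by
              rw [intervalIntegral.integral_sub i1 i2, intervalIntegral.integral_const_mul, ← hQ,
                hm]
              field_simp
              ring)
      have i3 : IntervalIntegrable (fun x => (w₂ x - v₀ x - e * x) * ψ x) volume 0 L :=
        hint.mul_continuousOn hψc.continuousOn
      have i4 : IntervalIntegrable (fun x => m * ((w₂ x - v₀ x - e * x) * (x * (L - x))))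
          volume 0 L :=
        (hint.mul_continuousOn (Continuous.continuousOn (by fun_prop))).const_mul m
      have i5 : IntervalIntegrable (fun x => k * (ψ x * (x * (L - x)))) volume 0 L :=
        Continuous.intervalIntegrable (by fun_prop) _ _
      have e1 : (∫ x in (0 : ℝ)..L, (w₂ x - v₀ x - e * x) * ψ x)
          = m * (k * Q) := by
        have : (∫ x in (0 : ℝ)..L, (w₂ x - v₀ x - e * x) * ψ x)
          - ∫ x in (0 : ℝ)..L, m * ((w₂ x - v₀ x - e * x) * (x * (L - x))) = 0 := by
          refine Eq.trans ?_ ht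
          rw [← intervalIntegral.integral_sub i3 i4]
          congr 1; ext x; ring
        rw [intervalIntegral.integral_const_mul] at this
        rw [show k * Q = ∫ x in (0 : ℝ)..L, (w₂ x - v₀ x - e * x) * (x * (L - x)) by
          rw [hk]; field_simp]
        linarith
      have e2 : ∫ x in (0 : ℝ)..L, (w₂ x - v₀ x - e * x - k * (x * (L - x))) * ψ x = 0 := by
        calc _ = ∫ x in (0 : ℝ)..L,
              ((w₂ x - v₀ x - e * x) * ψ x - k * (ψ x * (x * (L - x)))) := by
              congr 1; ext x; ring
          _ = 0 := by
              rw [intervalIntegral.integral_sub i3 i5, e1, intervalIntegral.integral_const_mul,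
                hm]
              field_simp
              ring
      rw [intervalIntegral.integral_of_le hL.le, integral_Ioc_eq_integral_Ioo] at e2
      rw [← e2, setIntegral_eq_integral_of_forall_compl_eq_zero]
      · congr 1; ext x; rw [smul_eq_mul]; ring
      · intro x hx
        rw [image_eq_zero_of_notMem_tsupport (fun hx' => hx (hsupp hx')), mul_zero]
  -- absorb the quadratic into the constants of integration
  have hid := IsPrimitiveOn.id L
  refine ⟨fun x => G₁ x + -2 * k, fun x => K₀ x + (e + k * (L - x - x)),
    fun x => v₀ x + (e * x + k * (x * (L - x))), ?_, ?_, ?_, ?_, ?_, ?_⟩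
  · simpa using hG₁.add (IsPrimitiveOn.const L (-2 * k))
  · convert hK₀.add ((IsPrimitiveOn.const L e).add
      ((((IsPrimitiveOn.const L L).sub hid).sub hid).const_mul k)) using 2
    ring
  · convert hv₀.add ((hid.const_mul e).add
      ((hid.mul hL.le ((IsPrimitiveOn.const L L).sub hid)).const_mul k)) using 2
    ring
  · simp [hv₀0]
  · simp only [he]; field_simp; ring
  · rw [ae_restrict_iff' measurableSet_Ioo]
    filter_upwards [hzero] with x hx hxL
    linarith [hx hxL]

/-- The identity obtained by testing the weak fifth order problem for `w` with `(A + B x) w`. -/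
theorem weighted_identity_of_weak {L a b F Y : ℝ} {g q w w₁ w₂ : ℝ → ℝ} (hL : 0 < L)
    (hg : IntervalIntegrable g volume 0 L) (hq : IntervalIntegrable q volume 0 L)
    (hw₁ : IsPrimitiveOn L w₁ w₂) (hw : IsPrimitiveOn L w w₁)
    (hw0 : w 0 = 0) (hwL : w L = 0) (hw₁0 : w₁ 0 = 0) (hw₁L : w₁ L = 0)
    (h : ∀ φ : ℝ → ℝ, ContDiff ℝ ∞ φ → φ 0 = 0 → φ L = 0 → deriv φ 0 = 0 → deriv φ L = 0 →
      ∫ x in (0 : ℝ)..L, g x * φ x =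
        (∫ x in (0 : ℝ)..L, w x *
          (a * deriv φ x + b * iteratedDeriv 3 φ x - iteratedDeriv 5 φ x))
        + (∫ x in (0 : ℝ)..L, q x * deriv φ x)
        + F * iteratedDeriv 2 φ L - Y * iteratedDeriv 2 φ 0) (A B : ℝ) :
    2 * ∫ x in (0 : ℝ)..L, (A + B * x) * w x * g x =
      (A + B * L) * F ^ 2 - A * Y ^ 2 - 5 * B * (∫ x in (0 : ℝ)..L, w₂ x ^ 2)
        - 3 * b * B * (∫ x in (0 : ℝ)..L, w₁ x ^ 2) + a * B * (∫ x in (0 : ℝ)..L, w x ^ 2)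
        + 2 * ∫ x in (0 : ℝ)..L, q x * (B * w x + (A + B * x) * w₁ x) := by
  obtain ⟨R, K, v, hR, hK, hv, hv0, hvL, hae⟩ :=
    exists_primitive_of_weak hL hg hq hw₁ hw hw0 hwL hw₁0 hw₁L h
  have hae' : ∀ᵐ x ∂volume.restrict (Ioo 0 L), v x = w₂ x := by
    filter_upwards [hae] with x hx using hx.symm
  -- Replacing `w₂` by its representative `v` makes it possible to differentiate once and twice
  -- more.
  have hw₁v : IsPrimitiveOn L w₁ v := hw₁.congr_deriv hL.le hae'
  have hKv : IsPrimitiveOn L K (fun x => R x + a * w x + q x + b * v x) := by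
    apply hK.congr_deriv hL.le
    filter_upwards [hae'] with x hx
    rw [hx]
  have e₂ : ∫ x in (0 : ℝ)..L, w₂ x ^ 2 = ∫ x in (0 : ℝ)..L, v x ^ 2 := by
    apply intervalIntegral.integral_congr_ae_restrict
    rw [uIoc_of_le hL.le, ← restrict_Ioo_eq_restrict_Ioc]
    filter_upwards [hae] with x hx
    rw [hx]
  have hm : IsPrimitiveOn L (fun x => A + B * x) (fun _ => B) := by
    simpa using (IsPrimitiveOn.const L A).add ((IsPrimitiveOn.id L).const_mul B)
  have l := hL.le
  have hmw := hm.mul l hw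
  have hmww := hmw.mul l hw
  have hs : IsPrimitiveOn L (fun x => B * w x + (A + B * x) * w₁ x) _ :=
    (hw.const_mul B).add (hm.mul l hw₁v)
  -- One total derivative contains the whole computation: the terms in `R` and `K` cancel, and the
  -- quadratic terms collect with coefficients `5B/2`, `3bB/2` and `-aB/2`. At the ends `w` and `w₁`
  -- vanish, so only `(A + B x) v² / 2` survives.
  have P := (((((((hmw.mul l hR).sub (hs.mul l hKv)).add
    ((hw₁v.mul l hv).const_mul (2 * B))).add ((hm.mul l (hv.mul l hv)).const_mul (1 / 2))).add
    (hmww.const_mul (a / 2))).add ((hw.mul l hw₁v).const_mul (b * B))).add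
    ((hm.mul l (hw₁v.mul l hw₁v)).const_mul (b / 2)))
  have PI := P.integral_eq l
  simp only [hw0, hwL, hw₁0, hw₁L, hv0, hvL, mul_zero, zero_mul,
      add_zero, zero_add, sub_self] at PI
  have wc := hw.continuousOn l
  have w₁c := hw₁.continuousOn l
  have vc := hv.continuousOn l
  have i1 : IntervalIntegrable (fun x => (A + B * x) * w x * g x) volume 0 L :=
    hg.continuousOn_mul (by rw [uIcc_of_le l]; fun_prop)
  have i2 : IntervalIntegrable (fun x => 5 * B / 2 * v x ^ 2) volume 0 L :=
    ContinuousOn.intervalIntegrable (by rw [uIcc_of_le l]; fun_prop)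
  have i3 : IntervalIntegrable (fun x => 3 * b * B / 2 * w₁ x ^ 2) volume 0 L :=
    ContinuousOn.intervalIntegrable (by rw [uIcc_of_le l]; fun_prop)
  have i4 : IntervalIntegrable (fun x => a * B / 2 * w x ^ 2) volume 0 L :=
    ContinuousOn.intervalIntegrable (by rw [uIcc_of_le l]; fun_prop)
  have i5 : IntervalIntegrable (fun x => q x * (B * w x + (A + B * x) * w₁ x)) volume 0 L :=
    hq.mul_continuousOn (by rw [uIcc_of_le l]; fun_prop)
  have key : (∫ x in (0 : ℝ)..L, (A + B * x) * w x * g x)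
      + (∫ x in (0 : ℝ)..L, 5 * B / 2 * v x ^ 2)
      + (∫ x in (0 : ℝ)..L, 3 * b * B / 2 * w₁ x ^ 2)
      - (∫ x in (0 : ℝ)..L, a * B / 2 * w x ^ 2)
      - (∫ x in (0 : ℝ)..L, q x * (B * w x + (A + B * x) * w₁ x))
      = 1 / 2 * ((A + B * L) * (F * F)) - 1 / 2 * (A * (Y * Y)) := by
    rw [← PI, ← intervalIntegral.integral_add i1 i2, ← intervalIntegral.integral_add (i1.add i2) i3,
      ← intervalIntegral.integral_sub ((i1.add i2).add i3) i4,
      ← intervalIntegral.integral_sub (((i1.add i2).add i3).sub i4) i5]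
    congr 1; ext x; ring
  simp only [intervalIntegral.integral_const_mul] at key
  rw [e₂]
  linarith

/-! ### Steklov averages and their convergence -/

section Steklov

set_option linter.unusedSectionVars false

variable {X : Type*} [NormedAddCommGroup X] [InnerProductSpace ℝ X] [CompleteSpace X]

/-- The Steklov average `h⁻¹ ∫_t^{t+h} f`. -/
noncomputable def steklov (h : ℝ) (f : ℝ → X) (t : ℝ) : X := h⁻¹ • ∫ r in t..(t + h), f r

theorem LocallyIntegrable.intervalIntegrable' {f : ℝ → X} (hf : LocallyIntegrable f) (a b : ℝ) :
    IntervalIntegrable f volume a b :=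
  intervalIntegrable_iff.mpr <|
      (hf.integrableOn_isCompact isCompact_uIcc).mono_set uIoc_subset_uIcc

theorem continuous_steklov {f : ℝ → X} (hf : LocallyIntegrable f) (h : ℝ) :
    Continuous (steklov h f) := by
  have hI := LocallyIntegrable.intervalIntegrable' hf
  have hc := intervalIntegral.continuous_primitive hI 0
  have e : steklov h f = fun t =>
      h⁻¹ • ((∫ r in (0 : ℝ)..(t + h), f r) - ∫ r in (0 : ℝ)..t, f r) := by
    ext t
    rw [steklov, intervalIntegral.integral_interval_sub_left (hI _ _) (hI _ _)]
  rw [e]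
  fun_prop

theorem steklov_add {f g : ℝ → X} (hf : LocallyIntegrable f) (hg : LocallyIntegrable g)
    (h t : ℝ) : steklov h (fun r => f r + g r) t = steklov h f t + steklov h g t := by
  rw [steklov, intervalIntegral.integral_add (LocallyIntegrable.intervalIntegrable' hf _ _)
    (LocallyIntegrable.intervalIntegrable' hg _ _), smul_add, steklov, steklov]

theorem steklov_sub {f g : ℝ → X} (hf : LocallyIntegrable f) (hg : LocallyIntegrable g)
    (h t : ℝ) : steklov h (fun r => f r - g r) t = steklov h f t - steklov h g t := by
  rw [steklov, intervalIntegral.integral_sub (LocallyIntegrable.intervalIntegrable' hf _ _)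
    (LocallyIntegrable.intervalIntegrable' hg _ _), smul_sub, steklov, steklov]

theorem MeasureTheory.MemLp.locallyIntegrable_two {f : ℝ → X} (hf : MemLp f 2) :
    LocallyIntegrable f :=
  hf.locallyIntegrable (by norm_num)

/-- Jensen's inequality, from `∫ (‖f‖ - c)² ≥ 0` with `c` the mean of `‖f‖`. -/
theorem norm_sq_steklov_le {f : ℝ → X} (hf : MemLp f 2) {h : ℝ} (hh : 0 < h) (t : ℝ) :
    ‖steklov h f t‖ ^ 2 ≤ steklov h (fun r => ‖f r‖ ^ 2) t := by
  have hle : t ≤ t + h := by linarith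
  have i1 : IntervalIntegrable (fun r => ‖f r‖) volume t (t + h) :=
    (LocallyIntegrable.intervalIntegrable' hf.locallyIntegrable_two _ _).norm
  have i2 : IntervalIntegrable (fun r => ‖f r‖ ^ 2) volume t (t + h) :=
    (hf.integrable_norm_pow (by norm_num)).intervalIntegrable
  set c : ℝ := h⁻¹ * ∫ r in t..(t + h), ‖f r‖ with hc
  have h1 : ‖steklov h f t‖ ≤ c := by
    rw [steklov, norm_smul, hc, Real.norm_of_nonneg (by positivity)]
    gcongr
    exact intervalIntegral.norm_integral_le_integral_norm hle
  have h2 : 0 ≤ ∫ r in t..(t + h), (‖f r‖ ^ 2 - 2 * c * ‖f r‖ + c ^ 2) :=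
    intervalIntegral.integral_nonneg hle fun r _ => by nlinarith [sq_nonneg (‖f r‖ - c)]
  rw [intervalIntegral.integral_add (i2.sub (i1.const_mul _)) intervalIntegrable_const,
    intervalIntegral.integral_sub i2 (i1.const_mul _), intervalIntegral.integral_const_mul,
    intervalIntegral.integral_const] at h2
  have h3 : ∫ r in t..(t + h), ‖f r‖ = h * c := by rw [hc]; field_simp
  rw [h3, add_sub_cancel_left, smul_eq_mul] at h2
  calc ‖steklov h f t‖ ^ 2 ≤ c ^ 2 := by gcongr
    _ = h⁻¹ * (h * c ^ 2) := by field_simp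
    _ ≤ _ := by
      rw [steklov, smul_eq_mul]
      gcongr
      linarith

/-- With `G` a primitive of `g`, the integral of the average is the mean of `G` over `[T, T+h]`
minus its mean over `[0, h]`, and `G` is continuous. -/
theorem tendsto_integral_steklov {g : ℝ → ℝ} (hg : LocallyIntegrable g) (T : ℝ) :
    Tendsto (fun h => ∫ t in (0 : ℝ)..T, steklov h g t) (𝓝[>] 0)
      (𝓝 (∫ t in (0 : ℝ)..T, g t)) := by
  have hI := LocallyIntegrable.intervalIntegrable' hg
  set G : ℝ → ℝ := fun x => ∫ r in (0 : ℝ)..x, g r with hG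
  have hGc : Continuous G := intervalIntegral.continuous_primitive hI 0
  have hGi : ∀ a b, IntervalIntegrable G volume a b := fun a b => hGc.intervalIntegrable a b
  have e : ∀ h : ℝ, ∫ t in (0 : ℝ)..T, steklov h g t =
      h⁻¹ • (∫ t in T..(T + h), G t) - h⁻¹ • ∫ t in (0 : ℝ)..(0 + h), G t := by
    intro h
    have e1 : ∀ t, steklov h g t = h⁻¹ • (G (t + h) - G t) := fun t => by
      rw [steklov, hG, intervalIntegral.integral_interval_sub_left (hI _ _) (hI _ _)]
    simp only [e1]
    rw [intervalIntegral.integral_smul, intervalIntegral.integral_sub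
      (Continuous.intervalIntegrable (by fun_prop) _ _) (hGi _ _),
      intervalIntegral.integral_comp_add_right (fun t => G t), ← smul_sub]
    congr 1
    rw [← intervalIntegral.integral_add_adjacent_intervals (hGi (0 + h) T) (hGi T (T + h)),
      ← intervalIntegral.integral_add_adjacent_intervals (hGi 0 (0 + h)) (hGi (0 + h) T)]
    ring
  have lim : ∀ x : ℝ, Tendsto (fun h => h⁻¹ • ∫ t in x..(x + h), G t) (𝓝[>] 0) (𝓝 (G x)) := by
    intro x
    have hd : HasDerivAt (fun z => ∫ t in x..z, G t) (G x) x :=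
      intervalIntegral.integral_hasDerivAt_right (hGi _ _)
        (hGc.stronglyMeasurableAtFilter _ _) hGc.continuousAt
    have := hd.tendsto_slope_zero_right
    simpa using this
  simp only [e]
  simpa [hG] using (lim T).sub (lim 0)

theorem ae_tendsto_steklov {f : ℝ → X} (hf : LocallyIntegrable f) :
    ∀ᵐ t, Tendsto (fun h => steklov h f t) (𝓝[>] 0) (𝓝 (f t)) := by
  filter_upwards [_root_.LocallyIntegrable.ae_hasDerivAt_integral hf] with t ht
  have := (ht t).tendsto_slope_zero_right
  simpa [steklov] using this

/-- Lebesgue differentiation and Fatou bound the lower limit; Jensen and the convergence of the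
integrated averages of `‖f‖²` bound the upper limit. No dominating function is needed. -/
theorem tendsto_integral_norm_sq_steklov {f : ℝ → X} (hf : MemLp f 2) {T : ℝ} (hT : 0 ≤ T)
    {h : ℕ → ℝ} (hpos : ∀ n, 0 < h n) (hh : Tendsto h atTop (𝓝 0)) :
    Tendsto (fun n => ∫ t in (0 : ℝ)..T, ‖steklov (h n) f t‖ ^ 2) atTop
      (𝓝 (∫ t in (0 : ℝ)..T, ‖f t‖ ^ 2)) := by
  have hl := hf.locallyIntegrable_two
  have hg : Integrable (fun r => ‖f r‖ ^ 2) := hf.integrable_norm_pow (by norm_num)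
  have hh' : Tendsto h atTop (𝓝[>] 0) :=
    tendsto_nhdsWithin_iff.2 ⟨hh, Eventually.of_forall hpos⟩
  have hcs : ∀ n, Continuous (fun t => ‖steklov (h n) f t‖ ^ 2) := fun n =>
    (continuous_steklov hl (h n)).norm.pow 2
  have key : ∀ {φ : ℝ → ℝ}, IntervalIntegrable φ volume 0 T → (∀ t, 0 ≤ φ t) →
      ENNReal.ofReal (∫ t in (0 : ℝ)..T, φ t) =
        ∫⁻ t in Ioc 0 T, ENNReal.ofReal (φ t) := by
    intro φ hφ hφ0
    rw [intervalIntegral.integral_of_le hT]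
    exact ofReal_integral_eq_lintegral_ofReal
      ((intervalIntegrable_iff_integrableOn_Ioc_of_le hT).1 hφ) (Eventually.of_forall hφ0)
  have lower : ENNReal.ofReal (∫ t in (0 : ℝ)..T, ‖f t‖ ^ 2) ≤
      liminf (fun n => ENNReal.ofReal (∫ t in (0 : ℝ)..T, ‖steklov (h n) f t‖ ^ 2)) atTop := by
    rw [key hg.intervalIntegrable (fun t => by positivity)]
    simp only [fun n => key ((hcs n).intervalIntegrable 0 T) (fun t => by positivity)]
    refine le_trans (le_of_eq (lintegral_congr_ae ?_)) (lintegral_liminf_le fun n =>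
      (hcs n).measurable.ennreal_ofReal)
    apply ae_restrict_of_ae
    filter_upwards [ae_tendsto_steklov hl] with t ht
    have : Tendsto (fun n => ENNReal.ofReal (‖steklov (h n) f t‖ ^ 2)) atTop
        (𝓝 (ENNReal.ofReal (‖f t‖ ^ 2))) :=
      ENNReal.tendsto_ofReal (((ht.comp hh').norm).pow 2)
    exact this.liminf_eq.symm
  have up := (tendsto_integral_steklov hg.locallyIntegrable T).comp hh'
  have upper : limsup (fun n => ENNReal.ofReal (∫ t in (0 : ℝ)..T, ‖steklov (h n) f t‖ ^ 2)) atTop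
      ≤ ENNReal.ofReal (∫ t in (0 : ℝ)..T, ‖f t‖ ^ 2) := by
    rw [← (ENNReal.tendsto_ofReal up).limsup_eq]
    apply limsup_le_limsup (Eventually.of_forall fun n => ?_)
    apply ENNReal.ofReal_le_ofReal
    apply intervalIntegral.integral_mono_on hT ((hcs n).intervalIntegrable _ _)
      ((continuous_steklov hg.locallyIntegrable _).intervalIntegrable _ _)
    exact fun t _ => norm_sq_steklov_le hf (hpos n) t
  have lim := tendsto_of_le_liminf_of_limsup_le lower upper
  have := (ENNReal.tendsto_toReal ENNReal.ofReal_ne_top).comp lim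
  refine (this.congr fun n => ?_).trans (by
    rw [ENNReal.toReal_ofReal]
    exact intervalIntegral.integral_nonneg hT fun t _ => by positivity)
  exact ENNReal.toReal_ofReal (intervalIntegral.integral_nonneg hT fun t _ => by positivity)

/-- Polarization reduces this to squared norms. -/
theorem tendsto_integral_inner_steklov {f g : ℝ → X} (hf : MemLp f 2) (hg : MemLp g 2)
    {T : ℝ} (hT : 0 ≤ T) {h : ℕ → ℝ} (hpos : ∀ n, 0 < h n) (hh : Tendsto h atTop (𝓝 0)) :
    Tendsto (fun n => ∫ t in (0 : ℝ)..T, inner ℝ (steklov (h n) f t) (steklov (h n) g t)) atTop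
      (𝓝 (∫ t in (0 : ℝ)..T, inner ℝ (f t) (g t))) := by
  have h1 := tendsto_integral_norm_sq_steklov (hf.add hg) hT hpos hh
  have h2 := tendsto_integral_norm_sq_steklov (hf.sub hg) hT hpos hh
  have hfl := hf.locallyIntegrable_two
  have hgl := hg.locallyIntegrable_two
  have pol : ∀ a b : X, inner ℝ a b = 4⁻¹ * (‖a + b‖ ^ 2 - ‖a - b‖ ^ 2) := fun a b => by
    rw [norm_add_sq_real, norm_sub_sq_real]; ring
  have h3 := (h1.sub h2).const_mul 4⁻¹
  convert h3 using 2
  · rw [← intervalIntegral.integral_sub, ← intervalIntegral.integral_const_mul]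
    · congr 1; ext t
      rw [pol, ← steklov_add hfl hgl, ← steklov_sub hfl hgl]
      rfl
    · exact ((continuous_steklov (hf.add hg).locallyIntegrable_two _).norm.pow 2).intervalIntegrable
        _ _
    · exact ((continuous_steklov (hf.sub hg).locallyIntegrable_two _).norm.pow 2).intervalIntegrable
        _ _
  · rw [← intervalIntegral.integral_sub, ← intervalIntegral.integral_const_mul]
    · congr 1; ext t
      rw [pol]
      rfl
    · exact ((hf.add hg).integrable_norm_pow (by norm_num)).intervalIntegrable
    · exact ((hf.sub hg).integrable_norm_pow (by norm_num)).intervalIntegrable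

end Steklov

/-! ### Operators on `L²(0, L)` -/

section Space

variable {L : ℝ}

theorem L2.intervalIntegrable (hL : 0 ≤ L) (f : L2 L) : IntervalIntegrable f volume 0 L := by
  rw [intervalIntegrable_iff_integrableOn_Ioo_of_le hL]
  exact (Lp.memLp f).integrable (by norm_num)

theorem L2.inner_eq (hL : 0 ≤ L) (f g : L2 L) :
    inner ℝ f g = ∫ x in (0 : ℝ)..L, f x * g x := by
  rw [L2.inner_def, intervalIntegral.integral_of_le hL, integral_Ioc_eq_integral_Ioo]
  congr 1; ext x
  simp [mul_comm]

theorem L2.norm_sq_eq (hL : 0 ≤ L) (f : L2 L) :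
    ‖f‖ ^ 2 = ∫ x in (0 : ℝ)..L, f x ^ 2 := by
  rw [← real_inner_self_eq_norm_sq, L2.inner_eq hL]
  congr 1; ext x; ring

theorem L2.sq_intervalIntegrable (hL : 0 ≤ L) (f : L2 L) :
    IntervalIntegrable (fun x => f x ^ 2) volume 0 L := by
  rw [intervalIntegrable_iff_integrableOn_Ioo_of_le hL]
  exact (Lp.memLp f).integrable_sq

theorem L2.integral_congr (hL : 0 ≤ L) {f g : ℝ → ℝ}
    (h : ∀ᵐ x ∂volume.restrict (Ioo (0 : ℝ) L), f x = g x) :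
    ∫ x in (0 : ℝ)..L, f x = ∫ x in (0 : ℝ)..L, g x := by
  apply intervalIntegral.integral_congr_ae_restrict
  rwa [uIoc_of_le hL, ← restrict_Ioo_eq_restrict_Ioc]

/-- Cauchy-Schwarz against the indicator of `(0, x)`. -/
theorem L2.abs_primitive_le (f : L2 L) {x : ℝ} (hx : x ∈ Icc 0 L) :
    |∫ ξ in (0 : ℝ)..x, f ξ| ≤ Real.sqrt L * ‖f‖ := by
  have hm : (volume.restrict (Ioo (0 : ℝ) L)) (Ioo 0 x) ≠ ⊤ := measure_ne_top _ _
  have h := L2.inner_indicatorConstLp_one (𝕜 := ℝ) measurableSet_Ioo hm f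
  have h2 : ∫ ξ in (0 : ℝ)..x, f ξ =
      inner ℝ (indicatorConstLp 2 measurableSet_Ioo hm (1 : ℝ)) f := by
    rw [h, Measure.restrict_restrict measurableSet_Ioo,
      inter_eq_self_of_subset_left (Ioo_subset_Ioo_right hx.2),
      intervalIntegral.integral_of_le hx.1, integral_Ioc_eq_integral_Ioo]
  rw [h2]
  refine (abs_real_inner_le_norm _ _).trans ?_
  gcongr
  rw [norm_indicatorConstLp (by norm_num) (by norm_num)]
  rw [measureReal_def, Measure.restrict_apply measurableSet_Ioo,
    inter_eq_self_of_subset_left (Ioo_subset_Ioo_right hx.2), Real.volume_Ioo,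
    ENNReal.toReal_ofReal (by linarith [hx.1]), Real.sqrt_eq_rpow]
  simp only [norm_one, one_mul, sub_zero, ENNReal.toReal_ofNat]
  exact Real.rpow_le_rpow hx.1 hx.2 (by norm_num)

theorem L2.primitive_continuousOn (f : L2 L) :
    ContinuousOn (fun x => ∫ ξ in (0 : ℝ)..x, f ξ) (Ioo 0 L) := by
  rcases le_or_gt L 0 with hL | hL
  · exact fun x hx => absurd (hx.1.trans hx.2) (not_lt.2 hL)
  · exact ((IsPrimitiveOn.of_integral (L2.intervalIntegrable hL.le f)).continuousOn hL.le).mono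
      Ioo_subset_Icc_self

theorem L2.primitive_memLp (f : L2 L) :
    MemLp (fun x => ∫ ξ in (0 : ℝ)..x, f ξ) 2 (volume.restrict (Ioo (0 : ℝ) L)) := by
  apply MemLp.of_bound ((L2.primitive_continuousOn f).aestronglyMeasurable measurableSet_Ioo)
    (Real.sqrt L * ‖f‖)
  filter_upwards [ae_restrict_mem measurableSet_Ioo] with x hx
  exact L2.abs_primitive_le f (Ioo_subset_Icc_self hx)

/-- The Volterra operator `f ↦ ∫_0^x f` on `L²(0, L)`. -/
noncomputable def volterra (L : ℝ) : L2 L →L[ℝ] L2 L :=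
  LinearMap.mkContinuous
    { toFun := fun f => (L2.primitive_memLp f).toLp
      map_add' := fun f g => by
        rw [← MemLp.toLp_add]
        apply MemLp.toLp_congr
        filter_upwards [ae_restrict_mem measurableSet_Ioo] with x hx
        have hL : 0 ≤ L := (hx.1.trans hx.2).le
        simp only [Pi.add_apply]
        have hI : ∀ f : L2 L, IntervalIntegrable f volume 0 x := fun f =>
          (L2.intervalIntegrable hL f).mono_set (by
            rw [uIcc_of_le hx.1.le, uIcc_of_le hL]; exact Icc_subset_Icc_right hx.2.le)
        rw [← intervalIntegral.integral_add (hI f) (hI g)]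
        apply intervalIntegral.integral_congr_ae_restrict
        rw [uIoc_of_le hx.1.le, ← restrict_Ioo_eq_restrict_Ioc]
        exact ae_restrict_of_ae_restrict_of_subset (Ioo_subset_Ioo_right hx.2.le) (Lp.coeFn_add f g)
      map_smul' := fun k f => by
        rw [RingHom.id_apply, ← MemLp.toLp_const_smul]
        apply MemLp.toLp_congr
        filter_upwards [ae_restrict_mem measurableSet_Ioo] with x hx
        simp only [Pi.smul_apply]
        rw [← intervalIntegral.integral_smul]
        apply intervalIntegral.integral_congr_ae_restrict
        rw [uIoc_of_le hx.1.le, ← restrict_Ioo_eq_restrict_Ioc]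
        exact ae_restrict_of_ae_restrict_of_subset (Ioo_subset_Ioo_right hx.2.le)
          (Lp.coeFn_smul k f) }
    ((measureUnivNNReal (volume.restrict (Ioo (0 : ℝ) L)) : ℝ) ^ ((2 : ENNReal).toReal)⁻¹ *
      Real.sqrt L)
    (fun f => by
      rw [mul_assoc]
      apply Lp.norm_le_of_ae_bound (by positivity)
      filter_upwards [(L2.primitive_memLp f).coeFn_toLp, ae_restrict_mem measurableSet_Ioo]
        with x hx hxL
      rw [LinearMap.coe_mk, AddHom.coe_mk, hx]
      exact L2.abs_primitive_le f (Ioo_subset_Icc_self hxL))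

theorem coeFn_volterra (f : L2 L) :
    ∀ᵐ x ∂volume.restrict (Ioo (0 : ℝ) L), volterra L f x = ∫ ξ in (0 : ℝ)..x, f ξ :=
  (L2.primitive_memLp f).coeFn_toLp

theorem memLp_of_continuous {ψ : ℝ → ℝ} (hψ : Continuous ψ) :
    MemLp ψ 2 (volume.restrict (Ioo (0 : ℝ) L)) := by
  obtain ⟨C, hC⟩ := isCompact_Icc.exists_bound_of_continuousOn (hψ.continuousOn (s := Icc 0 L))
  apply MemLp.of_bound hψ.aestronglyMeasurable C
  filter_upwards [ae_restrict_mem measurableSet_Ioo] with x hx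
  exact hC x (Ioo_subset_Icc_self hx)

/-- The functional `f ↦ ∫_0^L f ψ`. -/
noncomputable def pairing (L : ℝ) {ψ : ℝ → ℝ} (hψ : Continuous ψ) : L2 L →L[ℝ] ℝ :=
  innerSL ℝ (memLp_of_continuous (L := L) hψ).toLp

theorem pairing_apply (hL : 0 ≤ L) {ψ : ℝ → ℝ} (hψ : Continuous ψ) (f : L2 L) :
    pairing L hψ f = ∫ x in (0 : ℝ)..L, f x * ψ x := by
  rw [pairing, innerSL_apply_apply, L2.inner_eq hL]
  apply L2.integral_congr hL
  filter_upwards [(memLp_of_continuous (L := L) hψ).coeFn_toLp] with x hx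
  rw [hx, mul_comm]

theorem affine_mul_memLp (A B : ℝ) (f : L2 L) :
    MemLp (fun x => (A + B * x) * f x) 2 (volume.restrict (Ioo (0 : ℝ) L)) := by
  refine MemLp.of_le_mul (c := |A| + |B| * L) (Lp.memLp f)
    ((by fun_prop : Continuous fun x : ℝ => A + B * x).aestronglyMeasurable.mul
      (Lp.aestronglyMeasurable f)) ?_
  filter_upwards [ae_restrict_mem measurableSet_Ioo] with x hx
  rw [norm_mul]
  gcongr
  refine (norm_add_le _ _).trans ?_
  rw [norm_mul, Real.norm_eq_abs, Real.norm_eq_abs, Real.norm_of_nonneg hx.1.le]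
  gcongr
  exact hx.2.le

/-- Multiplication by `A + B x` on `L²(0, L)`. -/
noncomputable def affineMul (L A B : ℝ) : L2 L →L[ℝ] L2 L :=
  LinearMap.mkContinuous
    { toFun := fun f => (affine_mul_memLp A B f).toLp
      map_add' := fun f g => by
        rw [← MemLp.toLp_add]
        apply MemLp.toLp_congr
        filter_upwards [Lp.coeFn_add f g] with x hx
        rw [hx, Pi.add_apply, Pi.add_apply, mul_add]
      map_smul' := fun k f => by
        rw [RingHom.id_apply, ← MemLp.toLp_const_smul]
        apply MemLp.toLp_congr
        filter_upwards [Lp.coeFn_smul k f] with x hx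
        rw [hx, Pi.smul_apply, Pi.smul_apply, smul_eq_mul, smul_eq_mul]
        ring }
    (|A| + |B| * L)
    (fun f => by
      apply Lp.norm_le_mul_norm_of_ae_le_mul
      filter_upwards [(affine_mul_memLp A B f).coeFn_toLp, ae_restrict_mem measurableSet_Ioo]
        with x hx hxL
      rw [LinearMap.coe_mk, AddHom.coe_mk, hx, norm_mul]
      gcongr
      refine (norm_add_le _ _).trans ?_
      rw [norm_mul, Real.norm_eq_abs, Real.norm_eq_abs, Real.norm_of_nonneg hxL.1.le]
      gcongr
      exact hxL.2.le)

theorem coeFn_affineMul (A B : ℝ) (f : L2 L) :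
    ∀ᵐ x ∂volume.restrict (Ioo (0 : ℝ) L), affineMul L A B f x = (A + B * x) * f x :=
  (affine_mul_memLp A B f).coeFn_toLp

theorem inner_affineMul (hL : 0 ≤ L) (A B : ℝ) (f g : L2 L) :
    inner ℝ (affineMul L A B f) g = ∫ x in (0 : ℝ)..L, (A + B * x) * f x * g x := by
  rw [L2.inner_eq hL]
  apply L2.integral_congr hL
  filter_upwards [coeFn_affineMul A B f] with x hx
  rw [hx]

theorem inner_affineMul_comm (hL : 0 ≤ L) (A B : ℝ) (f g : L2 L) :
    inner ℝ (affineMul L A B f) g = inner ℝ (affineMul L A B g) f := by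
  rw [inner_affineMul hL, inner_affineMul hL]
  congr 1; ext x; ring

/-- Membership in `H²₀` becomes a system of bounded linear equations, which commute with averaging
in time. -/
theorem hasH02Derivs_iff (hL : 0 ≤ L) (f f₁ f₂ : L2 L) :
    HasH02Derivs L f f₁ f₂ ↔ f₁ = volterra L f₂ ∧ f = volterra L f₁ ∧
      pairing L (continuous_const (y := (1 : ℝ))) f₂ = 0 ∧
      pairing L (continuous_const (y := (1 : ℝ))) f₁ = 0 := by
  have key : ∀ f g : L2 L, (∀ᵐ x ∂volume.restrict (Ioo (0 : ℝ) L), f x = ∫ ξ in (0 : ℝ)..x, g ξ) ↔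
      f = volterra L g := by
    intro f g
    constructor
    · intro h
      apply Lp.ext
      filter_upwards [h, coeFn_volterra g] with x hx hx'
      rw [hx, hx']
    · rintro rfl
      exact coeFn_volterra g
  rw [HasH02Derivs, key, key, pairing_apply hL, pairing_apply hL]
  simp

/-- Smooth representatives of a function in `H²₀(0, L)`. -/
theorem HasH02Derivs.exists_primitives (hL : 0 ≤ L) {f f₁ f₂ : L2 L} (h : HasH02Derivs L f f₁ f₂) :
    ∃ w w₁ : ℝ → ℝ, IsPrimitiveOn L w w₁ ∧ IsPrimitiveOn L w₁ f₂ ∧ w 0 = 0 ∧ w L = 0 ∧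
      w₁ 0 = 0 ∧ w₁ L = 0 ∧ (∀ᵐ x ∂volume.restrict (Ioo (0 : ℝ) L), f x = w x) ∧
      (∀ᵐ x ∂volume.restrict (Ioo (0 : ℝ) L), f₁ x = w₁ x) := by
  obtain ⟨h1, h2, h3, h4⟩ := h
  have p1 := IsPrimitiveOn.of_integral (L2.intervalIntegrable hL f₂)
  have p2 := IsPrimitiveOn.of_integral (L2.intervalIntegrable hL f₁)
  refine ⟨fun x => ∫ ξ in (0 : ℝ)..x, f₁ ξ, fun x => ∫ ξ in (0 : ℝ)..x, f₂ ξ, ?_, p1, by simp,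
    h4, by simp, h3, h2, h1⟩
  apply p2.congr_deriv hL
  filter_upwards [h1] with x hx using hx.symm

end Space

/-! ### The power nonlinearity and its primitives -/

section Nonlinearity

open scoped NNReal

theorem realPow_zero {q : ℝ} (hq : 0 < q) (k : ℝ) : realPow q k 0 = 0 := by
  simp [realPow, hq.ne']

theorem abs_realPow_le {q k : ℝ} (hk : |k| ≤ 1) (v : ℝ) : |realPow q k v| ≤ |v| ^ q := by
  unfold realPow
  split_ifs with h
  · rw [abs_of_nonneg h, abs_of_nonneg (Real.rpow_nonneg h q)]
  · rw [abs_mul, abs_of_nonneg (Real.rpow_nonneg (abs_nonneg v) q)]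
    exact mul_le_of_le_one_left (by positivity) hk

/-- On the negative axis differentiating `|v|` produces a sign, hence the change from `k` to `-k`:
the family is closed under differentiation and integration. At `0` the function is dominated by `|v|
^ q`, which has zero derivative there. -/
theorem hasDerivAt_realPow {q : ℝ} (hq : 1 < q) {k : ℝ} (hk : |k| ≤ 1) (v : ℝ) :
    HasDerivAt (realPow q k) (q * realPow (q - 1) (-k) v) v := by
  rcases lt_trichotomy v 0 with hv | rfl | hv
  · have h1 : HasDerivAt (fun v : ℝ => k * (-v) ^ q) (k * (-1 * q * (-v) ^ (q - 1))) v :=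
      ((hasDerivAt_neg v).rpow_const (Or.inl (by linarith))).const_mul k
    have h2 : HasDerivAt (realPow q k) (k * (-1 * q * (-v) ^ (q - 1))) v := by
      apply h1.congr_of_eventuallyEq
      filter_upwards [Iio_mem_nhds hv] with z hz
      have hz' : z < 0 := hz
      rw [realPow, if_neg (not_le.2 hz'), abs_of_neg hz']
    convert h2 using 1
    rw [realPow, if_neg (not_le.2 hv), abs_of_neg hv]
    ring
  · rw [realPow_zero (by linarith), mul_zero, hasDerivAt_iff_isLittleO]
    have h := hasDerivAt_abs_rpow 0 hq
    rw [hasDerivAt_iff_isLittleO] at h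
    simp only [sub_zero, smul_eq_mul, mul_zero, realPow_zero (by linarith : 0 < q), abs_zero,
      Real.zero_rpow (by linarith : q ≠ 0)] at h ⊢
    refine Asymptotics.IsBigO.trans_isLittleO (Asymptotics.IsBigO.of_bound 1 ?_) h
    filter_upwards with z
    rw [one_mul, Real.norm_eq_abs, Real.norm_of_nonneg (by positivity)]
    exact abs_realPow_le hk z
  · have h1 : HasDerivAt (fun v : ℝ => v ^ q) (1 * q * v ^ (q - 1)) v :=
      (hasDerivAt_id v).rpow_const (Or.inl hv.ne')
    have h2 : HasDerivAt (realPow q k) (1 * q * v ^ (q - 1)) v := by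
      apply h1.congr_of_eventuallyEq
      filter_upwards [Ioi_mem_nhds hv] with z hz
      rw [realPow, if_pos (le_of_lt hz)]
    convert h2 using 1
    rw [realPow, if_pos hv.le]
    ring

theorem continuous_realPow {q : ℝ} (hq : 0 < q) (k : ℝ) : Continuous (realPow q k) := by
  unfold realPow
  apply Continuous.if_le
  · exact Real.continuous_rpow_const hq.le
  · exact continuous_const.mul ((Real.continuous_rpow_const hq.le).comp continuous_abs)
  · exact continuous_const
  · exact continuous_id
  · rintro v rfl
    simp [ne_of_gt hq]

/-- The primitive of the nonlinearity `v ↦ v ^ p`. -/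
noncomputable def powPrim (p c v : ℝ) : ℝ := (p + 1)⁻¹ * realPow (p + 1) (-c) v

/-- The second primitive of the nonlinearity `v ↦ v ^ p`. -/
noncomputable def powPrim₂ (p c v : ℝ) : ℝ := (p + 1)⁻¹ * ((p + 2)⁻¹ * realPow (p + 2) c v)

variable {p c : ℝ}

theorem hasDerivAt_powPrim (hp : 1 ≤ p) (hc : |c| ≤ 1) (v : ℝ) :
    HasDerivAt (powPrim p c) (realPow p c v) v := by
  have h := (hasDerivAt_realPow (by linarith : 1 < p + 1) (k := -c) (by rwa [abs_neg]) v).const_mul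
    (p + 1)⁻¹
  rw [add_sub_cancel_right, neg_neg, inv_mul_cancel_left₀ (by linarith)] at h
  exact h

theorem hasDerivAt_powPrim₂ (hp : 1 ≤ p) (hc : |c| ≤ 1) (v : ℝ) :
    HasDerivAt (powPrim₂ p c) (powPrim p c v) v := by
  have h := ((hasDerivAt_realPow (by linarith : 1 < p + 2) hc v).const_mul (p + 2)⁻¹).const_mul
    (p + 1)⁻¹
  rw [show p + 2 - 1 = p + 1 by ring, inv_mul_cancel_left₀ (by linarith)] at h
  exact h

theorem powPrim_zero (hp : 1 ≤ p) : powPrim p c 0 = 0 := by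
  rw [powPrim, realPow_zero (by linarith), mul_zero]

theorem powPrim₂_zero (hp : 1 ≤ p) : powPrim₂ p c 0 = 0 := by
  rw [powPrim₂, realPow_zero (by linarith), mul_zero, mul_zero]

theorem continuous_powPrim (hp : 1 ≤ p) : Continuous (powPrim p c) :=
  continuous_const.mul (continuous_realPow (by linarith) _)

theorem continuous_powPrim₂ (hp : 1 ≤ p) : Continuous (powPrim₂ p c) :=
  continuous_const.mul (continuous_const.mul (continuous_realPow (by linarith) _))

theorem abs_powPrim_le (hp : 1 ≤ p) (hp₂ : p ≤ 2) (hc : |c| ≤ 1) (v : ℝ) :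
    |powPrim p c v| ≤ (1 + v ^ 2) * |v| := by
  have h1 : |v| ^ p ≤ 1 + v ^ 2 := by
    rcases le_total |v| 1 with h | h
    · exact (Real.rpow_le_one (abs_nonneg v) h (by linarith)).trans (by nlinarith [sq_nonneg v])
    · have := Real.rpow_le_rpow_of_exponent_le h hp₂
      rw [Real.rpow_two, sq_abs] at this
      linarith
  rw [powPrim, abs_mul, abs_of_nonneg (by positivity)]
  calc (p + 1)⁻¹ * |realPow (p + 1) (-c) v| ≤ 1 * |v| ^ (p + 1) := by
        gcongr
        · exact inv_le_one_of_one_le₀ (by linarith)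
        · exact abs_realPow_le (by rwa [abs_neg]) v
    _ = |v| ^ p * |v| := by
        rw [one_mul, Real.rpow_add' (abs_nonneg v) (by linarith), Real.rpow_one]
    _ ≤ _ := by gcongr

/-- With `P` and `P₂` the two primitives, `P(v) v - P₂(v)` is exactly `(p+2)⁻¹` times the power of
order `p + 2`, since `1/(p+1) - 1/((p+1)(p+2)) = 1/(p+2)`. -/
theorem powPrim_mul_sub_le (hp : 1 ≤ p) (hc : |c| ≤ 1) (v : ℝ) :
    powPrim p c v * v - powPrim₂ p c v ≤ (p + 2)⁻¹ * |v| ^ (p + 2) := by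
  have e : powPrim p c v * v - powPrim₂ p c v = (p + 2)⁻¹ * realPow (p + 2) c v := by
    have h : realPow (p + 1) (-c) v * v = realPow (p + 2) c v := by
      unfold realPow
      split_ifs with hv
      · nth_rw 2 [← Real.rpow_one v]
        rw [← Real.rpow_add' hv (by linarith)]
        congr 1; ring
      · have hv' : 0 ≤ -v := by linarith
        have : (-v) ^ (p + 2) = (-v) ^ (p + 1) * (-v) := by
          rw [show p + 2 = (p + 1) + 1 by ring, Real.rpow_add' hv' (by linarith), Real.rpow_one]
        rw [abs_of_neg (not_le.1 hv), this]
        ring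
    have h1 : p + 1 ≠ 0 := by linarith
    have h2 : p + 2 ≠ 0 := by linarith
    rw [powPrim, powPrim₂, mul_assoc, h]
    field_simp
    ring
  rw [e]
  gcongr
  exact (le_abs_self _).trans (abs_realPow_le hc v)

/-- `v ↦ powPrim p c v`, truncated to `[-n, n]`. -/
noncomputable def powPrimTrunc (p c : ℝ) (n : ℕ) (v : ℝ) : ℝ :=
  powPrim p c (projIcc (-(n : ℝ)) n (by linarith [Nat.cast_nonneg (α := ℝ) n]) v)

/-- Lipschitz functions vanishing at `0` act continuously on `L²`; the full nonlinearity need not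
even map `L²` to itself. -/
theorem exists_lipschitzWith_powPrimTrunc (hp : 1 ≤ p) (hc : |c| ≤ 1) (n : ℕ) :
    ∃ K : ℝ≥0, LipschitzWith K (powPrimTrunc p c n) := by
  obtain ⟨C, hC⟩ := (isCompact_Icc (a := -(n : ℝ)) (b := n)).exists_bound_of_continuousOn
    (continuous_realPow (by linarith : 0 < p) c).continuousOn
  have hlip : LipschitzOnWith C.toNNReal (powPrim p c) (Icc (-(n : ℝ)) n) := by
    apply (convex_Icc _ _).lipschitzOnWith_of_nnnorm_hasDerivWithin_le
      (fun x _ => (hasDerivAt_powPrim hp hc x).hasDerivWithinAt)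
    intro x hx
    rw [← NNReal.coe_le_coe, coe_nnnorm]
    exact (hC x hx).trans (Real.le_coe_toNNReal C)
  refine ⟨C.toNNReal * 1, ?_⟩
  rw [lipschitzOnWith_iff_restrict] at hlip
  exact hlip.comp (LipschitzWith.projIcc _)

theorem powPrimTrunc_zero (hp : 1 ≤ p) (n : ℕ) : powPrimTrunc p c n 0 = 0 := by
  have h : (0 : ℝ) ∈ Icc (-(n : ℝ)) n := by simp
  rw [powPrimTrunc, projIcc_of_mem _ h, powPrim_zero hp]

theorem powPrimTrunc_of_abs_le {n : ℕ} {v : ℝ} (h : |v| ≤ n) :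
    powPrimTrunc p c n v = powPrim p c v := by
  rw [powPrimTrunc, projIcc_of_mem _ (abs_le.1 h)]

open Classical in
/-- The element `powPrim p c ∘ f` of `L²(0, L)`, `0` if this is not square integrable. -/
noncomputable def powPrimLp (p c : ℝ) {L : ℝ} (f : L2 L) : L2 L :=
  if h : MemLp (fun x => powPrim p c (f x)) 2 (volume.restrict (Ioo (0 : ℝ) L)) then h.toLp else 0

variable {L : ℝ}

theorem memLp_powPrim (hp : 1 ≤ p) (hp₂ : p ≤ 2) (hc : |c| ≤ 1) {f : L2 L} {M : ℝ}
    (hM : ∀ᵐ x ∂volume.restrict (Ioo (0 : ℝ) L), f x ^ 2 ≤ M) :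
    MemLp (fun x => powPrim p c (f x)) 2 (volume.restrict (Ioo (0 : ℝ) L)) := by
  refine MemLp.of_le_mul (c := 1 + M) (Lp.memLp f)
    ((continuous_powPrim hp).comp_aestronglyMeasurable (Lp.aestronglyMeasurable f)) ?_
  filter_upwards [hM] with x hx
  refine (abs_powPrim_le hp hp₂ hc _).trans ?_
  rw [Real.norm_eq_abs]
  gcongr

theorem coeFn_powPrimLp (hp : 1 ≤ p) (hp₂ : p ≤ 2) (hc : |c| ≤ 1) {f : L2 L} {M : ℝ}
    (hM : ∀ᵐ x ∂volume.restrict (Ioo (0 : ℝ) L), f x ^ 2 ≤ M) :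
    ∀ᵐ x ∂volume.restrict (Ioo (0 : ℝ) L), powPrimLp p c f x = powPrim p c (f x) := by
  rw [powPrimLp, dif_pos (memLp_powPrim hp hp₂ hc hM)]
  exact (memLp_powPrim hp hp₂ hc hM).coeFn_toLp

theorem norm_powPrimLp_le (hp : 1 ≤ p) (hp₂ : p ≤ 2) (hc : |c| ≤ 1) {f : L2 L} {M : ℝ}
    (hM : ∀ᵐ x ∂volume.restrict (Ioo (0 : ℝ) L), f x ^ 2 ≤ M) :
    ‖powPrimLp p c f‖ ≤ (1 + M) * ‖f‖ := by
  apply Lp.norm_le_mul_norm_of_ae_le_mul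
  filter_upwards [hM, coeFn_powPrimLp hp hp₂ hc hM] with x hx hx'
  rw [hx']
  refine (abs_powPrim_le hp hp₂ hc _).trans ?_
  rw [Real.norm_eq_abs]
  gcongr

/-- The truncated nonlinearities composed with `u` are continuous in time. At almost every time `u`
is bounded in space, so the truncations are eventually equal to the full nonlinearity. -/
theorem aestronglyMeasurable_powPrimLp (hp : 1 ≤ p) (hp₂ : p ≤ 2) (hc : |c| ≤ 1) {u : ℝ → L2 L}
    (hu : ContinuousOn u (Ici 0))
    (hM : ∀ᵐ r ∂volume.restrict (Ioi (0 : ℝ)),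
      ∃ M : ℝ, ∀ᵐ x ∂volume.restrict (Ioo (0 : ℝ) L), u r x ^ 2 ≤ M) :
    AEStronglyMeasurable (fun r => powPrimLp p c (u r)) (volume.restrict (Ioi (0 : ℝ))) := by
  choose K hK using exists_lipschitzWith_powPrimTrunc hp hc
  refine aestronglyMeasurable_of_tendsto_ae atTop
    (f := fun n r => (hK n).compLp (powPrimTrunc_zero hp n) (u r)) (fun n => ?_) ?_
  · exact ((LipschitzWith.continuous_compLp (hK n) (powPrimTrunc_zero hp n)).comp_continuousOn
      (hu.mono Ioi_subset_Ici_self)).aestronglyMeasurable measurableSet_Ioi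
  · filter_upwards [hM] with r ⟨M, hr⟩
    apply tendsto_const_nhds.congr'
    obtain ⟨N, hN⟩ := exists_nat_ge (Real.sqrt M)
    filter_upwards [eventually_ge_atTop N] with n hn
    apply Lp.ext
    filter_upwards [hr, coeFn_powPrimLp hp hp₂ hc hr,
      (hK n).coeFn_compLp (powPrimTrunc_zero hp n) (u r)] with x h1 h2 h3
    rw [h2, h3, Function.comp_apply, powPrimTrunc_of_abs_le]
    exact (Real.abs_le_sqrt h1).trans (hN.trans (by exact_mod_cast hn))

end Nonlinearity

/-! ### Estimates for functions in `H²₀(0, L)` -/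

section Estimates

variable {L p c : ℝ} {f f₁ f₂ : L2 L}

theorem HasH02Derivs.sq_le_length_mul (h : HasH02Derivs L f f₁ f₂) :
    ∀ᵐ x ∂volume.restrict (Ioo (0 : ℝ) L), f x ^ 2 ≤ L * ‖f₁‖ ^ 2 := by
  filter_upwards [h.2.1, ae_restrict_mem measurableSet_Ioo] with x hx hxL
  rw [hx, ← sq_abs]
  calc _ ≤ (Real.sqrt L * ‖f₁‖) ^ 2 := by
        gcongr; exact L2.abs_primitive_le f₁ (Ioo_subset_Icc_self hxL)
    _ = _ := by rw [mul_pow, Real.sq_sqrt (hxL.1.trans hxL.2).le]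

/-- From `f² = 2 ∫ f f₁`. Unlike the previous bound it is only linear in `‖f₁‖`, so that in time the
nonlinear potential is square integrable as soon as `u_x` is. -/
theorem HasH02Derivs.sq_le_norm_mul (h : HasH02Derivs L f f₁ f₂) :
    ∀ᵐ x ∂volume.restrict (Ioo (0 : ℝ) L), f x ^ 2 ≤ 2 * (‖f‖ * ‖f₁‖) := by
  rcases le_or_gt L 0 with hL | hL
  · filter_upwards [ae_restrict_mem measurableSet_Ioo] with x hx
    exact absurd (hx.1.trans hx.2) (not_lt.2 hL)
  obtain ⟨w, w₁, pw, pw₁, w0, wL, w₁0, w₁L, hf, hf₁⟩ := h.exists_primitives hL.le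
  have wc := pw.continuousOn hL.le
  have w₁c := pw₁.continuousOn hL.le
  have hcs : ∫ x in (0 : ℝ)..L, |w x * w₁ x| ≤ ‖f‖ * ‖f₁‖ := by
    have e : ∫ x in (0 : ℝ)..L, |w x * w₁ x| = inner ℝ |f| |f₁| := by
      rw [L2.inner_eq hL.le]
      apply L2.integral_congr hL.le
      filter_upwards [hf, hf₁, Lp.coeFn_abs f, Lp.coeFn_abs f₁] with x h1 h2 h3 h4
      rw [h3, h4, h1, h2, abs_mul]
    rw [e]
    refine (real_inner_le_norm _ _).trans ?_
    rw [norm_abs_eq_norm, norm_abs_eq_norm]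
  filter_upwards [hf, ae_restrict_mem measurableSet_Ioo] with x hx hxL
  have hsub : Icc 0 x ⊆ Icc 0 L := Icc_subset_Icc_right hxL.2.le
  have hI := ((pw.mul hL.le pw).mono hxL.1.le hxL.2.le).integral_eq hxL.1.le
  rw [w0, mul_zero, sub_zero] at hI
  have ci : IntervalIntegrable (fun x => |w x * w₁ x|) volume 0 L :=
    ContinuousOn.intervalIntegrable (by rw [uIcc_of_le hL.le]; fun_prop)
  have ci' : IntervalIntegrable (fun x => |w x * w₁ x|) volume 0 x :=
    ci.mono_set (by rwa [uIcc_of_le hxL.1.le, uIcc_of_le hL.le])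
  rw [hx, pow_two, ← hI]
  calc ∫ z in (0 : ℝ)..x, (w₁ z * w z + w z * w₁ z)
      ≤ ∫ z in (0 : ℝ)..x, 2 * |w z * w₁ z| := by
        apply intervalIntegral.integral_mono_on hxL.1.le _ (ci'.const_mul 2)
        · intro z _
          nlinarith [le_abs_self (w z * w₁ z)]
        · exact ((pw.mul hL.le pw).mono hxL.1.le hxL.2.le).intervalIntegrable
    _ = 2 * ∫ z in (0 : ℝ)..x, |w z * w₁ z| := intervalIntegral.integral_const_mul _ _
    _ ≤ 2 * ∫ z in (0 : ℝ)..L, |w z * w₁ z| := by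
        gcongr
        exact intervalIntegral.integral_mono_interval le_rfl hxL.1.le hxL.2.le
          (Eventually.of_forall fun _ => abs_nonneg _) ci
    _ ≤ _ := by gcongr

theorem HasH02Derivs.poincare (hL : 0 < L) (h : HasH02Derivs L f f₁ f₂) :
    Real.pi ^ 2 * ‖f‖ ^ 2 ≤ L ^ 2 * ‖f₁‖ ^ 2 := by
  obtain ⟨w, w₁, pw, pw₁, w0, wL, w₁0, w₁L, hf, hf₁⟩ := h.exists_primitives hL.le
  have h := _root_.poincare hL pw (pw₁.continuousOn hL.le) w0 wL
  rw [L2.norm_sq_eq hL.le, L2.norm_sq_eq hL.le]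
  convert h using 2
  · apply L2.integral_congr hL.le
    filter_upwards [hf] with x hx
    rw [hx]
  · apply L2.integral_congr hL.le
    filter_upwards [hf₁] with x hx
    rw [hx]

/-- Integration by parts in the nonlinear term. -/
theorem HasH02Derivs.integral_realPow_mul (hL : 0 < L) (hp : 1 ≤ p) (hp₂ : p ≤ 2) (hc : |c| ≤ 1)
    (h : HasH02Derivs L f f₁ f₂) {φ : ℝ → ℝ} (hφ : ContDiff ℝ ∞ φ) (hφ0 : φ 0 = 0)
    (hφL : φ L = 0) :
    ∫ x in (0 : ℝ)..L, realPow p c (f x) * f₁ x * φ x =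
      -∫ x in (0 : ℝ)..L, powPrimLp p c f x * deriv φ x := by
  obtain ⟨w, w₁, pw, pw₁, w0, wL, w₁0, w₁L, hf, hf₁⟩ := h.exists_primitives hL.le
  have wc := pw.continuousOn hL.le
  have w₁c := pw₁.continuousOn hL.le
  have hrc := continuous_realPow (by linarith : 0 < p) c
  have pP := pw.comp_deriv hL.le w₁c (hasDerivAt_powPrim hp hc) hrc
  have PI := (pP.mul hL.le (IsPrimitiveOn.of_contDiff hφ)).integral_eq hL.le
  rw [hφ0, hφL, mul_zero, mul_zero, sub_zero, intervalIntegral.integral_add] at PI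
  · rw [L2.integral_congr hL.le (g := fun x => realPow p c (w x) * w₁ x * φ x),
      L2.integral_congr hL.le (f := fun x => powPrimLp p c f x * deriv φ x)
        (g := fun x => powPrim p c (w x) * deriv φ x)]
    · linarith
    · filter_upwards [hf, coeFn_powPrimLp hp hp₂ hc h.sq_le_length_mul] with x h1 h2
      rw [h2, h1]
    · filter_upwards [hf, hf₁] with x h1 h2
      rw [h2, h1]
  · apply ContinuousOn.intervalIntegrable
    rw [uIcc_of_le hL.le]
    have := hrc.comp_continuousOn wc
    exact (this.mul w₁c).mul hφ.continuous.continuousOn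
  · apply ContinuousOn.intervalIntegrable
    rw [uIcc_of_le hL.le]
    exact ((continuous_powPrim hp).comp_continuousOn wc).mul
      (hφ.continuous_deriv (by simp)).continuousOn

/-- Two of the `p + 2` powers are bounded by the supremum `f² ≤ L ‖f₁‖²`, the other `p` by Hölder.
-/
theorem HasH02Derivs.integral_rpow_le (hL : 0 < L) (hp : 1 ≤ p) (hp₂ : p ≤ 2)
    (h : HasH02Derivs L f f₁ f₂) :
    ∫ x in (0 : ℝ)..L, |f x| ^ (p + 2) ≤ L ^ (2 - p / 2) * ‖f‖ ^ p * ‖f₁‖ ^ 2 := by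
  have hint : IntervalIntegrable (fun x => |f x| ^ p) volume 0 L := by
    rw [intervalIntegrable_iff_integrableOn_Ioo_of_le hL.le]
    refine Integrable.mono' ((integrable_const (1 : ℝ)).add (Lp.memLp f).integrable_sq)
      (((Real.continuous_rpow_const (by linarith)).comp continuous_abs).comp_aestronglyMeasurable
        (Lp.aestronglyMeasurable f)) (Eventually.of_forall fun x => ?_)
    change ‖|f x| ^ p‖ ≤ 1 + f x ^ 2
    rw [Real.norm_of_nonneg (by positivity)]
    rcases le_total |f x| 1 with h | h
    · exact (Real.rpow_le_one (abs_nonneg _) h (by linarith)).trans (by nlinarith [sq_nonneg (f x)])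
    · have := Real.rpow_le_rpow_of_exponent_le h hp₂
      rw [Real.rpow_two, sq_abs] at this
      linarith
  have hsq := L2.sq_intervalIntegrable hL.le f
  -- Hölder's inequality for `|f| ^ p`
  have holder : ∫ x in (0 : ℝ)..L, |f x| ^ p ≤ L ^ (1 - p / 2) * ‖f‖ ^ p := by
    rcases eq_or_lt_of_le (norm_nonneg f) with h0 | hpos
    · have hf0 : f = 0 := norm_eq_zero.1 h0.symm
      rw [L2.integral_congr hL.le (g := fun _ => 0)]
      · simp only [intervalIntegral.integral_zero]
        positivity
      · rw [hf0]
        filter_upwards [Lp.coeFn_zero ℝ 2 (volume.restrict (Ioo (0 : ℝ) L))] with x hx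
        rw [hx]
        simp [(by linarith : p ≠ 0)]
    · set N : ℝ := ‖f‖ / Real.sqrt L with hN
      have hNpos : 0 < N := by positivity
      have hN2 : N ^ 2 * L = ‖f‖ ^ 2 := by
        rw [hN, div_pow, Real.sq_sqrt hL.le]; field_simp
      -- Weighted arithmetic-geometric mean inequality, normalized by the root mean square `N` of
      -- `f`: after integration the weights `p/2` and `1 - p/2` add up to `1`, which gives Hölder
      -- without loss.
      have young : ∀ v : ℝ, |v| ^ p ≤ N ^ p * (p / 2 * (v ^ 2 / N ^ 2) + (1 - p / 2)) := by
        intro v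
        have hg := Real.geom_mean_le_arith_mean2_weighted (w₁ := p / 2) (w₂ := 1 - p / 2)
          (p₁ := v ^ 2 / N ^ 2) (p₂ := 1) (by linarith) (by linarith) (by positivity) (by norm_num)
          (by ring)
        rw [Real.one_rpow, mul_one, mul_one] at hg
        have e : (v ^ 2 / N ^ 2) ^ (p / 2) = |v| ^ p / N ^ p := by
          rw [← sq_abs, ← div_pow, ← Real.rpow_natCast, ← Real.rpow_mul (by positivity),
            ← Real.div_rpow (abs_nonneg v) hNpos.le]
          congr 1
          push_cast; ring
        rw [e, div_le_iff₀ (by positivity)] at hg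
        linarith
      calc ∫ x in (0 : ℝ)..L, |f x| ^ p
          ≤ ∫ x in (0 : ℝ)..L, N ^ p * (p / 2 * (f x ^ 2 / N ^ 2) + (1 - p / 2)) := by
            apply intervalIntegral.integral_mono_on hL.le hint
            · exact (((hsq.div_const _).const_mul _).add intervalIntegrable_const).const_mul _
            · exact fun x _ => young _
        _ = N ^ p * (p / 2 * (‖f‖ ^ 2 / N ^ 2) + (1 - p / 2) * L) := by
            rw [intervalIntegral.integral_const_mul, intervalIntegral.integral_add
              ((hsq.div_const _).const_mul _) intervalIntegrable_const,
              intervalIntegral.integral_const_mul, intervalIntegral.integral_div,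
              ← L2.norm_sq_eq hL.le, intervalIntegral.integral_const, smul_eq_mul]
            ring
        _ = N ^ p * L := by
            rw [← hN2]; field_simp; ring
        _ = L ^ (1 - p / 2) * ‖f‖ ^ p := by
            rw [hN, Real.div_rpow (norm_nonneg f) (Real.sqrt_nonneg L), Real.sqrt_eq_rpow,
              ← Real.rpow_mul hL.le, Real.rpow_sub hL, Real.rpow_one,
              show 1 / 2 * p = p / 2 by ring]
            ring
  have hbd := h.sq_le_length_mul
  have hle : ∀ᵐ x ∂volume.restrict (Ioo (0 : ℝ) L), |f x| ^ (p + 2) ≤ L * ‖f₁‖ ^ 2 * |f x| ^ p := by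
    filter_upwards [hbd] with x hx
    rw [Real.rpow_add' (abs_nonneg _) (by linarith), Real.rpow_two, sq_abs, mul_comm]
    gcongr
  have hmeas : AEStronglyMeasurable (fun x => |f x| ^ (p + 2)) (volume.restrict (Ioo (0 : ℝ) L)) :=
    ((Real.continuous_rpow_const (by linarith : 0 ≤ p + 2)).comp
      continuous_abs).comp_aestronglyMeasurable (Lp.aestronglyMeasurable f)
  have hint' : IntegrableOn (fun x => L * ‖f₁‖ ^ 2 * |f x| ^ p) (Ioo 0 L) :=
    (intervalIntegrable_iff_integrableOn_Ioo_of_le hL.le).1 (hint.const_mul _)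
  calc ∫ x in (0 : ℝ)..L, |f x| ^ (p + 2) ≤ ∫ x in (0 : ℝ)..L, L * ‖f₁‖ ^ 2 * |f x| ^ p := by
        rw [intervalIntegral.integral_of_le hL.le, intervalIntegral.integral_of_le hL.le,
          integral_Ioc_eq_integral_Ioo, integral_Ioc_eq_integral_Ioo]
        apply integral_mono_ae _ hint' hle
        apply hint'.mono' hmeas
        filter_upwards [hle] with x hx
        rwa [Real.norm_of_nonneg (by positivity)]
    _ = L * ‖f₁‖ ^ 2 * ∫ x in (0 : ℝ)..L, |f x| ^ p := intervalIntegral.integral_const_mul _ _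
    _ ≤ L * ‖f₁‖ ^ 2 * (L ^ (1 - p / 2) * ‖f‖ ^ p) := by gcongr
    _ = _ := by
        rw [show 2 - p / 2 = 1 + (1 - p / 2) by ring, Real.rpow_add hL, Real.rpow_one]
        ring

/-- The contribution of the nonlinearity to the weighted energy identity. -/
theorem HasH02Derivs.inner_powPrimLp_le (hL : 0 < L) (hp : 1 ≤ p) (hp₂ : p ≤ 2) (hc : |c| ≤ 1)
    (h : HasH02Derivs L f f₁ f₂) (A : ℝ) {B : ℝ} (hB : 0 ≤ B) :
    inner ℝ (powPrimLp p c f) (B • f + affineMul L A B f₁) ≤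
      B * ((p + 2)⁻¹ * (L ^ (2 - p / 2) * ‖f‖ ^ p * ‖f₁‖ ^ 2)) := by
  obtain ⟨w, w₁, pw, pw₁, w0, wL, w₁0, w₁L, hf, hf₁⟩ := h.exists_primitives hL.le
  have wc := pw.continuousOn hL.le
  have w₁c := pw₁.continuousOn hL.le
  have hPc := continuous_powPrim (c := c) hp
  have hRc := continuous_powPrim₂ (c := c) hp
  -- The function `(A + B x) P₂(w)`, with `P₂` the second primitive, vanishes at both ends.
  -- Subtracting its derivative removes the term containing `w₁`, and with it all dependence on `A`.
  have pR := pw.comp_deriv hL.le w₁c (hasDerivAt_powPrim₂ hp hc) hPc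
  have hm : IsPrimitiveOn L (fun x => A + B * x) (fun _ => B) := by
    simpa using (IsPrimitiveOn.const L A).add ((IsPrimitiveOn.id L).const_mul B)
  have PI := (hm.mul hL.le pR).integral_eq hL.le
  rw [w0, wL, powPrim₂_zero hp, mul_zero, mul_zero, sub_zero] at PI
  have Pwc := hPc.comp_continuousOn wc
  have Rwc := hRc.comp_continuousOn wc
  simp only [Function.comp_def] at Pwc Rwc
  have i1 : IntervalIntegrable (fun x => powPrim p c (w x) * (B * w x + (A + B * x) * w₁ x))
      volume 0 L := ContinuousOn.intervalIntegrable (by rw [uIcc_of_le hL.le]; fun_prop)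
  have i2 : IntervalIntegrable (fun x => B * (powPrim p c (w x) * w x - powPrim₂ p c (w x)))
      volume 0 L := ContinuousOn.intervalIntegrable (by rw [uIcc_of_le hL.le]; fun_prop)
  have i3 : IntervalIntegrable (fun x => B * ((p + 2)⁻¹ * |w x| ^ (p + 2))) volume 0 L := by
    apply ContinuousOn.intervalIntegrable
    rw [uIcc_of_le hL.le]
    exact continuousOn_const.mul (continuousOn_const.mul
      (wc.abs.rpow_const fun x _ => Or.inr (by linarith)))
  calc inner ℝ (powPrimLp p c f) (B • f + affineMul L A B f₁)
      = ∫ x in (0 : ℝ)..L, powPrim p c (w x) * (B * w x + (A + B * x) * w₁ x) := by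
        rw [L2.inner_eq hL.le]
        apply L2.integral_congr hL.le
        filter_upwards [hf, hf₁, coeFn_powPrimLp hp hp₂ hc h.sq_le_length_mul,
          Lp.coeFn_add (B • f) (affineMul L A B f₁), Lp.coeFn_smul B f,
          coeFn_affineMul A B f₁] with x h1 h2 h3 h4 h5 h6
        rw [h3, h4, Pi.add_apply, h5, h6, Pi.smul_apply, h1, h2, smul_eq_mul]
    _ = ∫ x in (0 : ℝ)..L, B * (powPrim p c (w x) * w x - powPrim₂ p c (w x)) := by
        rw [← sub_eq_zero, ← intervalIntegral.integral_sub i1 i2]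
        refine Eq.trans ?_ PI
        congr 1; ext x; ring
    _ ≤ ∫ x in (0 : ℝ)..L, B * ((p + 2)⁻¹ * |w x| ^ (p + 2)) := by
        apply intervalIntegral.integral_mono_on hL.le i2 i3
        intro x _
        gcongr
        exact powPrim_mul_sub_le hp hc _
    _ = B * ((p + 2)⁻¹ * ∫ x in (0 : ℝ)..L, |f x| ^ (p + 2)) := by
        rw [intervalIntegral.integral_const_mul, intervalIntegral.integral_const_mul]
        congr 2
        apply L2.integral_congr hL.le
        filter_upwards [hf] with x h1
        rw [h1]
    _ ≤ _ := by
        gcongr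
        exact h.integral_rpow_le hL hp hp₂

end Estimates

/-! ### Averages, bounded operators and time derivatives -/

section SteklovOperators

set_option linter.unusedSectionVars false

variable {X : Type*} [NormedAddCommGroup X] [InnerProductSpace ℝ X] [CompleteSpace X]
  {Y : Type*} [NormedAddCommGroup Y] [InnerProductSpace ℝ Y] [CompleteSpace Y]

theorem ContinuousLinearMap.map_steklov (A : X →L[ℝ] Y) {f : ℝ → X} (hf : LocallyIntegrable f)
    (h t : ℝ) : A (steklov h f t) = steklov h (fun r => A (f r)) t := by
  rw [steklov, map_smul, steklov,
    A.intervalIntegral_comp_comm (LocallyIntegrable.intervalIntegrable' hf _ _)]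

theorem steklov_congr_ae {f g : ℝ → X} (hfg : ∀ᵐ r, f r = g r) (h t : ℝ) :
    steklov h f t = steklov h g t := by
  rw [steklov, steklov, intervalIntegral.integral_congr_ae]
  filter_upwards [hfg] with r hr _ using hr

/-- The average at `t ≤ T` looks ahead by `h ≤ 1`, so a cutoff at `T + 1` does not change it. -/
theorem steklov_indicator {f : ℝ → X} {T h t : ℝ} (hh : 0 < h) (hh1 : h ≤ 1) (ht : t ∈ Icc 0 T) :
    steklov h ((Ioo 0 (T + 1)).indicator f) t = steklov h f t := by
  rw [steklov, steklov]
  congr 1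
  apply intervalIntegral.integral_congr_ae_restrict
  rw [uIoc_of_le (by linarith), ← restrict_Ioo_eq_restrict_Ioc]
  filter_upwards [ae_restrict_mem measurableSet_Ioo] with r hr
  rw [indicator_of_mem]
  exact ⟨ht.1.trans_lt hr.1, by linarith [hr.2, ht.2]⟩

theorem integrable_inner_of_memLp_two {f g : ℝ → X} (hf : MemLp f 2) (hg : MemLp g 2) :
    Integrable (fun r => inner ℝ (f r) (g r)) := by
  have h : (fun r => inner ℝ (f r) (g r)) =
      fun r => 4⁻¹ * (‖(f + g) r‖ ^ 2 - ‖(f - g) r‖ ^ 2) := by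
    ext r
    rw [Pi.add_apply, Pi.sub_apply, norm_add_sq_real, norm_sub_sq_real]; ring
  rw [h]
  exact (((hf.add hg).integrable_norm_pow (by norm_num)).sub
    ((hf.sub hg).integrable_norm_pow (by norm_num))).const_mul _

theorem hasDerivAt_steklov {f : ℝ → X} (hf : Continuous f) (h t : ℝ) :
    HasDerivAt (steklov h f) (h⁻¹ • (f (t + h) - f t)) t := by
  have hI : ∀ a b, IntervalIntegrable f volume a b := fun a b => hf.intervalIntegrable a b
  have hd : ∀ z, HasDerivAt (fun z => ∫ r in (0 : ℝ)..z, f r) (f z) z := fun z =>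
    intervalIntegral.integral_hasDerivAt_right (hI _ _) (hf.stronglyMeasurableAtFilter _ _)
      hf.continuousAt
  have e : steklov h f = fun t =>
      h⁻¹ • ((∫ r in (0 : ℝ)..(t + h), f r) - ∫ r in (0 : ℝ)..t, f r) := by
    ext t
    rw [steklov, intervalIntegral.integral_interval_sub_left (hI _ _) (hI _ _)]
  rw [e]
  exact (((hd (t + h)).comp_add_const t h).sub (hd t)).const_smul _

theorem tendsto_steklov {f : ℝ → X} (hf : Continuous f) (t : ℝ) :
    Tendsto (fun h => steklov h f t) (𝓝[>] 0) (𝓝 (f t)) := by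
  have hd : HasDerivAt (fun z => ∫ r in t..z, f r) (f t) t :=
    intervalIntegral.integral_hasDerivAt_right (hf.intervalIntegrable _ _)
      (hf.stronglyMeasurableAtFilter _ _) hf.continuousAt
  have := hd.tendsto_slope_zero_right
  simpa [steklov] using this

end SteklovOperators

/-! ### The weighted energy identity for weak solutions -/

section EnergyIdentity

variable {L : ℝ}

theorem HasH02Derivs.steklov (hL : 0 ≤ L) {u ux uxx : ℝ → L2 L} (hux : LocallyIntegrable ux)
    (huxx : LocallyIntegrable uxx) (h : ∀ᵐ r, HasH02Derivs L (u r) (ux r) (uxx r)) (k t : ℝ) :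
    HasH02Derivs L (steklov k u t) (steklov k ux t) (steklov k uxx t) := by
  simp only [hasH02Derivs_iff hL] at h ⊢
  refine ⟨?_, ?_, ?_, ?_⟩
  · rw [ContinuousLinearMap.map_steklov _ huxx]
    exact steklov_congr_ae (h.mono fun r hr => hr.1) k t
  · rw [ContinuousLinearMap.map_steklov _ hux]
    exact steklov_congr_ae (h.mono fun r hr => hr.2.1) k t
  · rw [ContinuousLinearMap.map_steklov _ huxx, steklov_congr_ae (h.mono fun r hr => hr.2.2.1) k t]
    simp [_root_.steklov]
  · rw [ContinuousLinearMap.map_steklov _ hux, steklov_congr_ae (h.mono fun r hr => hr.2.2.2) k t]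
    simp [_root_.steklov]

/-- The rate of change of `∫ (A + B x) u²` for a solution with boundary values `F` and `Y` of
`u_xx` at `L` and `0`; here `q` is the potential of the nonlinearity. -/
noncomputable def energyRate (a b L A B F Y : ℝ) (u ux uxx q : L2 L) : ℝ :=
  (A + B * L) * inner ℝ F F - A * inner ℝ Y Y - 5 * B * inner ℝ uxx uxx
    - 3 * b * B * inner ℝ ux ux + a * B * inner ℝ u u
    + 2 * inner ℝ q (B • u + affineMul L A B ux)

theorem weighted_identity_of_weak_L2 {a b F Y : ℝ} {g q w w₁ w₂ : L2 L} (hL : 0 < L)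
    (hw : HasH02Derivs L w w₁ w₂)
    (h : ∀ φ : ℝ → ℝ, ContDiff ℝ ∞ φ → φ 0 = 0 → φ L = 0 → deriv φ 0 = 0 → deriv φ L = 0 →
      ∫ x in (0 : ℝ)..L, g x * φ x =
        (∫ x in (0 : ℝ)..L, w x *
          (a * deriv φ x + b * iteratedDeriv 3 φ x - iteratedDeriv 5 φ x))
        + (∫ x in (0 : ℝ)..L, q x * deriv φ x)
        + F * iteratedDeriv 2 φ L - Y * iteratedDeriv 2 φ 0) (A B : ℝ) :
    2 * inner ℝ (affineMul L A B w) g = energyRate a b L A B F Y w w₁ w₂ q := by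
  obtain ⟨v, v₁, pv, pv₁, v0, vL, v₁0, v₁L, hv, hv₁⟩ := hw.exists_primitives hL.le
  have key := weighted_identity_of_weak (a := a) (b := b) (F := F) (Y := Y) hL
    (L2.intervalIntegrable hL.le g) (L2.intervalIntegrable hL.le q) pv₁ pv v0 vL v₁0 v₁L
    (fun φ h1 h2 h3 h4 h5 => by
      rw [h φ h1 h2 h3 h4 h5]
      congr 3
      apply L2.integral_congr hL.le
      filter_upwards [hv] with x hx
      rw [hx]) A B
  have e0 : inner ℝ (affineMul L A B w) g = ∫ x in (0 : ℝ)..L, (A + B * x) * v x * g x := by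
    rw [inner_affineMul hL.le]
    apply L2.integral_congr hL.le
    filter_upwards [hv] with x hx
    rw [hx]
  have e1 : inner ℝ w₂ w₂ = ∫ x in (0 : ℝ)..L, w₂ x ^ 2 := by
    rw [real_inner_self_eq_norm_sq, L2.norm_sq_eq hL.le]
  have e2 : inner ℝ w₁ w₁ = ∫ x in (0 : ℝ)..L, v₁ x ^ 2 := by
    rw [real_inner_self_eq_norm_sq, L2.norm_sq_eq hL.le]
    apply L2.integral_congr hL.le
    filter_upwards [hv₁] with x hx
    rw [hx]
  have e3 : inner ℝ w w = ∫ x in (0 : ℝ)..L, v x ^ 2 := by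
    rw [real_inner_self_eq_norm_sq, L2.norm_sq_eq hL.le]
    apply L2.integral_congr hL.le
    filter_upwards [hv] with x hx
    rw [hx]
  have e4 : inner ℝ q (B • w + affineMul L A B w₁) =
      ∫ x in (0 : ℝ)..L, q x * (B * v x + (A + B * x) * v₁ x) := by
    rw [L2.inner_eq hL.le]
    apply L2.integral_congr hL.le
    filter_upwards [hv, hv₁, Lp.coeFn_add (B • w) (affineMul L A B w₁), Lp.coeFn_smul B w,
      coeFn_affineMul A B w₁] with x h1 h2 h4 h5 h6
    rw [h4, Pi.add_apply, h5, h6, Pi.smul_apply, h1, h2, smul_eq_mul]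
  rw [energyRate, e0, e1, e2, e3, e4, key]
  simp only [real_inner_self_eq_norm_sq, Real.norm_eq_abs, sq_abs]

/-- **Weighted energy identity** for weak solutions. -/
theorem weighted_energy_identity {a b p c : ℝ} (hL : 0 < L) (hp : 1 ≤ p) (hp₂ : p ≤ 2)
    (hc : |c| ≤ 1) {u ux uxx : ℝ → L2 L} {F y : ℝ → ℝ} (hu : ContinuousOn u (Ici 0))
    (hF : ∀ T : ℝ, MemLp F 2 (volume.restrict (Ioo 0 T)))
    (hy : ∀ T : ℝ, MemLp y 2 (volume.restrict (Ioo 0 T)))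
    (huxx : ∀ T : ℝ, MemLp uxx 2 (volume.restrict (Ioo 0 T)))
    (hder : ∀ᵐ t ∂volume.restrict (Ioi (0 : ℝ)), HasH02Derivs L (u t) (ux t) (uxx t))
    (heq : ∀ φ : ℝ → ℝ, ContDiff ℝ ∞ φ → φ 0 = 0 → φ L = 0 → deriv φ 0 = 0 → deriv φ L = 0 →
      ∀ t : ℝ, 0 ≤ t →
        (∫ x in (0 : ℝ)..L, u t x * φ x) = (∫ x in (0 : ℝ)..L, u 0 x * φ x) +
          ∫ r in (0 : ℝ)..t,
            ((∫ x in (0 : ℝ)..L, u r x *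
                (a * deriv φ x + b * iteratedDeriv 3 φ x - iteratedDeriv 5 φ x))
              + F r * iteratedDeriv 2 φ L
              - y r * iteratedDeriv 2 φ 0
              - ∫ x in (0 : ℝ)..L, realPow p c (u r x) * ux r x * φ x))
    (A B T : ℝ) (hT : 0 ≤ T) :
    IsPrimitiveOn T (fun t => inner ℝ (affineMul L A B (u t)) (u t))
      (fun r => energyRate a b L A B (F r) (y r) (u r) (ux r) (uxx r) (powPrimLp p c (u r))) := by
  suffices H : ∀ T : ℝ, 0 ≤ T →
      IntervalIntegrable (fun r => energyRate a b L A B (F r) (y r) (u r) (ux r) (uxx r)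
        (powPrimLp p c (u r))) volume 0 T ∧
      ∫ r in (0 : ℝ)..T, energyRate a b L A B (F r) (y r) (u r) (ux r) (uxx r)
        (powPrimLp p c (u r)) =
      inner ℝ (affineMul L A B (u T)) (u T) - inner ℝ (affineMul L A B (u 0)) (u 0) from
    ⟨(H T hT).1, fun t ht => by rw [(H t ht.1).2]; ring⟩
  clear hT T
  intro T hT
  set S : Set ℝ := Ioo 0 (T + 1) with hS
  have hSm : MeasurableSet S := measurableSet_Ioo
  have hSpos : S ⊆ Ioi 0 := fun r hr => hr.1
  have hderS : ∀ᵐ t ∂volume.restrict S, HasH02Derivs L (u t) (ux t) (uxx t) :=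
    ae_restrict_of_ae_restrict_of_subset hSpos hder
  -- square integrability in time
  have mux : MemLp ux 2 (volume.restrict S) := by
    -- No measurability in time is assumed of `ux`; it is inherited from `uxx` through the Volterra
    -- operator.
    refine ((volterra L).comp_memLp' (huxx (T + 1))).ae_eq ?_
    filter_upwards [hderS] with t ht
    exact ((hasH02Derivs_iff hL.le _ _ _).1 ht).1.symm
  obtain ⟨C, hC⟩ := isCompact_Icc.exists_bound_of_continuousOn
    (hu.mono (Icc_subset_Ici_self : Icc 0 (T + 1) ⊆ Ici 0))
  have mu : MemLp u 2 (volume.restrict S) := by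
    apply MemLp.of_bound ((hu.mono (hSpos.trans Ioi_subset_Ici_self)).aestronglyMeasurable hSm) C
    filter_upwards [ae_restrict_mem hSm] with r hr using hC r (Ioo_subset_Icc_self hr)
  have mq : MemLp (fun r => powPrimLp p c (u r)) 2 (volume.restrict S) := by
    have hm : AEStronglyMeasurable (fun r => powPrimLp p c (u r)) (volume.restrict S) :=
      (aestronglyMeasurable_powPrimLp hp hp₂ hc hu
        (hder.mono fun r hr => ⟨_, hr.sq_le_norm_mul⟩)).mono_measure
          (Measure.restrict_mono_set _ hSpos)
    refine MemLp.of_le_mul (c := C) (((memLp_const (1 : ℝ)).add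
      ((mux.norm.const_mul C).const_mul 2))) hm ?_
    filter_upwards [hderS, ae_restrict_mem hSm] with r hr hrS
    refine (norm_powPrimLp_le hp hp₂ hc hr.sq_le_norm_mul).trans ?_
    have hCr := hC r (Ioo_subset_Icc_self hrS)
    have h1 : 1 + 2 * (‖u r‖ * ‖ux r‖) ≤ 1 + 2 * (C * ‖ux r‖) := by gcongr
    have h2 : 1 + 2 * (C * ‖ux r‖) ≤
        ‖((fun _ : ℝ => (1 : ℝ)) + fun r => 2 * (C * ‖ux r‖)) r‖ := le_abs_self _
    rw [mul_comm]
    exact mul_le_mul hCr (h1.trans h2) (by positivity) ((norm_nonneg _).trans hCr)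
  -- cut off in time
  have gF : MemLp (S.indicator F) 2 := (memLp_indicator_iff_restrict hSm).2 (hF (T + 1))
  have gy : MemLp (S.indicator y) 2 := (memLp_indicator_iff_restrict hSm).2 (hy (T + 1))
  have guxx : MemLp (S.indicator uxx) 2 := (memLp_indicator_iff_restrict hSm).2 (huxx (T + 1))
  have gux : MemLp (S.indicator ux) 2 := (memLp_indicator_iff_restrict hSm).2 mux
  have gu : MemLp (S.indicator u) 2 := (memLp_indicator_iff_restrict hSm).2 mu
  have gq : MemLp (S.indicator fun r => powPrimLp p c (u r)) 2 :=
    (memLp_indicator_iff_restrict hSm).2 mq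
  set Fh := S.indicator F with hFh
  set yh := S.indicator y with hyh
  set uxxh := S.indicator uxx with huxxh
  set uxh := S.indicator ux with huxh
  set uh := S.indicator u with huh
  set qh := S.indicator (fun r => powPrimLp p c (u r)) with hqh
  have gm : MemLp (fun r => B • uh r + affineMul L A B (uxh r)) 2 :=
    (gu.const_smul B).add ((affineMul L A B).comp_memLp' gux)
  have hderh : ∀ᵐ r, HasH02Derivs L (uh r) (uxh r) (uxxh r) := by
    rw [ae_restrict_iff' hSm] at hderS
    filter_upwards [hderS] with r hr
    by_cases hrS : r ∈ S
    · simpa [huh, huxh, huxxh, hrS] using hr hrS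
    · simp only [huh, huxh, huxxh, hrS, not_false_eq_true, indicator_of_notMem]
      rw [hasH02Derivs_iff hL.le]
      simp
  -- a continuous extension of `u`
  set ub : ℝ → L2 L := fun r => u (max r 0) with hub
  have hubc : Continuous ub :=
    hu.comp_continuous (continuous_id.max continuous_const) fun r => mem_Ici.2 (le_max_right _ _)
  have hub_eq : ∀ r, 0 ≤ r → ub r = u r := fun r hr => by simp [hub, hr]
  have hst : ∀ {h t : ℝ}, 0 < h → h ≤ 1 → t ∈ Icc 0 T →
      steklov h uh t = steklov h ub t := by
    intro h t hh hh1 ht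
    rw [huh, steklov_indicator hh hh1 ht, steklov, steklov]
    congr 1
    apply intervalIntegral.integral_congr
    intro r hr
    rw [uIcc_of_le (by linarith)] at hr
    exact (hub_eq r (ht.1.trans hr.1)).symm
  -- the identity for the averages
  have avg : ∀ {h t : ℝ}, 0 < h → h ≤ 1 → t ∈ Icc 0 T →
      2 * inner ℝ (affineMul L A B (steklov h ub t)) (h⁻¹ • (ub (t + h) - ub t)) =
        energyRate a b L A B (steklov h Fh t) (steklov h yh t) (steklov h uh t)
          (steklov h uxh t) (steklov h uxxh t) (steklov h qh t) := by
    intro h t hh hh1 ht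
    rw [← hst hh hh1 ht, hub_eq t ht.1, hub_eq (t + h) (by linarith [ht.1])]
    -- At fixed `t` the averaged solution solves the stationary weak problem with datum `g = h⁻¹
    -- (u(t+h) - u(t))`; what has to be checked is the difference of the tested equation at `t + h`
    -- and `t`.
    apply weighted_identity_of_weak_L2 hL
      (HasH02Derivs.steklov hL.le gux.locallyIntegrable_two guxx.locallyIntegrable_two hderh h t)
    intro φ h1 h2 h3 h4 h5
    have hφ' : Continuous (deriv φ) := h1.continuous_deriv (by simp)
    have hi3 : Continuous (iteratedDeriv 3 φ) :=
      (contDiff_infty.1 h1 3).continuous_iteratedDeriv 3 le_rfl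
    have hi5 : Continuous (iteratedDeriv 5 φ) :=
      (contDiff_infty.1 h1 5).continuous_iteratedDeriv 5 le_rfl
    have hψ : Continuous
        (fun x => a * deriv φ x + b * iteratedDeriv 3 φ x - iteratedDeriv 5 φ x) := by fun_prop
    have hφ : Continuous φ := h1.continuous
    rw [← pairing_apply hL.le hφ, ← pairing_apply hL.le hψ, ← pairing_apply hL.le hφ', map_smul,
      map_sub, pairing_apply hL.le hφ, pairing_apply hL.le hφ]
    set br : ℝ → ℝ := fun r => pairing L hψ (uh r) + Fh r * iteratedDeriv 2 φ L
      - yh r * iteratedDeriv 2 φ 0 + pairing L hφ' (qh r) with hbr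
    have l1 : LocallyIntegrable fun r => pairing L hψ (uh r) :=
      ((pairing L hψ).comp_memLp' gu).locallyIntegrable_two
    have l2 : LocallyIntegrable fun r => Fh r * iteratedDeriv 2 φ L :=
      MemLp.locallyIntegrable_two (by
        simpa only [mul_comm] using gF.const_mul (iteratedDeriv 2 φ L))
    have l3 : LocallyIntegrable fun r => yh r * iteratedDeriv 2 φ 0 :=
      MemLp.locallyIntegrable_two (by
        simpa only [mul_comm] using gy.const_mul (iteratedDeriv 2 φ 0))
    have l4 : LocallyIntegrable fun r => pairing L hφ' (qh r) :=
      ((pairing L hφ').comp_memLp' gq).locallyIntegrable_two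
    have lbr : LocallyIntegrable br := ((l1.add l2).sub l3).add l4
    have key : ∀ s ∈ Icc 0 (T + 1), (∫ x in (0 : ℝ)..L, u s x * φ x) =
        (∫ x in (0 : ℝ)..L, u 0 x * φ x) + ∫ r in (0 : ℝ)..s, br r := by
      intro s hs
      rw [heq φ h1 h2 h3 h4 h5 s hs.1]
      congr 1
      apply intervalIntegral.integral_congr_ae_restrict
      rw [uIoc_of_le hs.1, ← restrict_Ioo_eq_restrict_Ioc]
      filter_upwards [ae_restrict_mem measurableSet_Ioo,
        ae_restrict_of_ae_restrict_of_subset (Ioo_subset_Ioo_right hs.2) hderS] with r hr hd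
      have hrS : r ∈ S := ⟨hr.1, hr.2.trans_le hs.2⟩
      simp only [hbr, huh, hFh, hyh, hqh, indicator_of_mem hrS]
      rw [pairing_apply hL.le, pairing_apply hL.le, hd.integral_realPow_mul hL hp hp₂ hc h1 h2 h3]
      ring
    have lI := LocallyIntegrable.intervalIntegrable' lbr
    rw [key (t + h) ⟨by linarith [ht.1], by linarith [ht.2]⟩, key t ⟨ht.1, by linarith [ht.2]⟩,
      add_sub_add_left_eq_sub, intervalIntegral.integral_interval_sub_left (lI _ _) (lI _ _)]
    change steklov h br t = _
    have s1 : steklov h br t = steklov h (fun r => pairing L hψ (uh r)) t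
        + steklov h (fun r => Fh r * iteratedDeriv 2 φ L) t
        - steklov h (fun r => yh r * iteratedDeriv 2 φ 0) t
        + steklov h (fun r => pairing L hφ' (qh r)) t := by
      have k2 := l1.add l2
      have k3 := k2.sub l3
      simp only [Pi.add_def, Pi.sub_def] at k2 k3
      rw [← steklov_add l1 l2, ← steklov_sub k2 l3, ← steklov_add k3 l4]
    rw [s1, ← ContinuousLinearMap.map_steklov _ gu.locallyIntegrable_two,
      ← ContinuousLinearMap.map_steklov _ gq.locallyIntegrable_two]
    have s2 : ∀ (f : ℝ → ℝ) (k : ℝ), steklov h (fun r => f r * k) t = steklov h f t * k := by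
      intro f k
      simp only [steklov, intervalIntegral.integral_mul_const, smul_eq_mul, mul_assoc]
    rw [s2, s2]
    ring
  -- pass to the limit
  set hn : ℕ → ℝ := fun n => 1 / ((n : ℝ) + 1) with hhn
  have hpos : ∀ n, 0 < hn n := fun n => by positivity
  have hle1 : ∀ n, hn n ≤ 1 := fun n => by
    rw [hhn]; exact div_le_one_of_le₀ (by linarith [Nat.cast_nonneg (α := ℝ) n]) (by positivity)
  have hlim : Tendsto hn atTop (𝓝 0) := tendsto_one_div_add_atTop_nhds_zero_nat
  have hlim' : Tendsto hn atTop (𝓝[>] 0) :=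
    tendsto_nhdsWithin_iff.2 ⟨hlim, Eventually.of_forall hpos⟩
  have cF : ∀ h, Continuous (steklov h Fh) := continuous_steklov gF.locallyIntegrable_two
  have cy : ∀ h, Continuous (steklov h yh) := continuous_steklov gy.locallyIntegrable_two
  have cu : ∀ h, Continuous (steklov h uh) := continuous_steklov gu.locallyIntegrable_two
  have cux : ∀ h, Continuous (steklov h uxh) := continuous_steklov gux.locallyIntegrable_two
  have cuxx : ∀ h, Continuous (steklov h uxxh) := continuous_steklov guxx.locallyIntegrable_two
  have cq : ∀ h, Continuous (steklov h qh) := continuous_steklov gq.locallyIntegrable_two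
  -- splitting the integral of the rate
  have split : ∀ {F y : ℝ → ℝ} {u ux uxx q : ℝ → L2 L},
      IntervalIntegrable (fun r => inner ℝ (F r) (F r)) volume 0 T →
      IntervalIntegrable (fun r => inner ℝ (y r) (y r)) volume 0 T →
      IntervalIntegrable (fun r => inner ℝ (uxx r) (uxx r)) volume 0 T →
      IntervalIntegrable (fun r => inner ℝ (ux r) (ux r)) volume 0 T →
      IntervalIntegrable (fun r => inner ℝ (u r) (u r)) volume 0 T →
      IntervalIntegrable (fun r => inner ℝ (q r) (B • u r + affineMul L A B (ux r))) volume 0 T →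
      IntervalIntegrable (fun r => energyRate a b L A B (F r) (y r) (u r) (ux r) (uxx r) (q r))
        volume 0 T ∧
      ∫ r in (0 : ℝ)..T, energyRate a b L A B (F r) (y r) (u r) (ux r) (uxx r) (q r) =
        (A + B * L) * (∫ r in (0 : ℝ)..T, inner ℝ (F r) (F r))
        - A * (∫ r in (0 : ℝ)..T, inner ℝ (y r) (y r))
        - 5 * B * (∫ r in (0 : ℝ)..T, inner ℝ (uxx r) (uxx r))
        - 3 * b * B * (∫ r in (0 : ℝ)..T, inner ℝ (ux r) (ux r))
        + a * B * (∫ r in (0 : ℝ)..T, inner ℝ (u r) (u r))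
        + 2 * ∫ r in (0 : ℝ)..T, inner ℝ (q r) (B • u r + affineMul L A B (ux r)) := by
    intro F y u ux uxx q i1 i2 i3 i4 i5 i6
    have j1 := i1.const_mul (A + B * L)
    have j2 := j1.sub (i2.const_mul A)
    have j3 := j2.sub (i3.const_mul (5 * B))
    have j4 := j3.sub (i4.const_mul (3 * b * B))
    have j5 := j4.add (i5.const_mul (a * B))
    refine ⟨j5.add (i6.const_mul 2), ?_⟩
    simp only [energyRate]
    rw [intervalIntegral.integral_add j5 (i6.const_mul 2),
      intervalIntegral.integral_add j4 (i5.const_mul _),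
      intervalIntegral.integral_sub j3 (i4.const_mul _),
      intervalIntegral.integral_sub j2 (i3.const_mul _),
      intervalIntegral.integral_sub j1 (i2.const_mul _)]
    simp only [intervalIntegral.integral_const_mul]
  have hstm : ∀ h t, steklov h (fun r => B • uh r + affineMul L A B (uxh r)) t =
      B • steklov h uh t + affineMul L A B (steklov h uxh t) := by
    intro h t
    rw [steklov_add (f := fun r => B • uh r) (g := fun r => affineMul L A B (uxh r))
      (gu.const_smul B).locallyIntegrable_two
      ((affineMul L A B).comp_memLp' gux).locallyIntegrable_two,
      ContinuousLinearMap.map_steklov _ gux.locallyIntegrable_two]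
    congr 1
    exact (ContinuousLinearMap.map_steklov (B • ContinuousLinearMap.id ℝ (L2 L))
      gu.locallyIntegrable_two h t).symm
  have hII : ∀ {X : Type} [NormedAddCommGroup X] [InnerProductSpace ℝ X] [CompleteSpace X]
      {f g : ℝ → X},
      MemLp f 2 → MemLp g 2 → IntervalIntegrable (fun r => inner ℝ (f r) (g r)) volume 0 T :=
    fun hf hg => (integrable_inner_of_memLp_two hf hg).intervalIntegrable
  have hcI : ∀ {f : ℝ → ℝ}, Continuous f → IntervalIntegrable f volume 0 T :=
    fun hf => hf.intervalIntegrable _ _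
  obtain ⟨ri, re⟩ := split (hII gF gF) (hII gy gy) (hII guxx guxx) (hII gux gux) (hII gu gu)
    (hII gq gm)
  have lim1 : Tendsto (fun n => ∫ r in (0 : ℝ)..T, energyRate a b L A B (steklov (hn n) Fh r)
      (steklov (hn n) yh r) (steklov (hn n) uh r) (steklov (hn n) uxh r) (steklov (hn n) uxxh r)
      (steklov (hn n) qh r)) atTop
      (𝓝 (∫ r in (0 : ℝ)..T, energyRate a b L A B (Fh r) (yh r) (uh r) (uxh r) (uxxh r)
        (qh r))) := by
    rw [re]
    have t6 := tendsto_integral_inner_steklov gq gm hT hpos hlim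
    simp only [hstm] at t6
    refine Tendsto.congr (fun n => ?_)
      ((((((tendsto_integral_inner_steklov gF gF hT hpos hlim).const_mul (A + B * L)).sub
      ((tendsto_integral_inner_steklov gy gy hT hpos hlim).const_mul A)).sub
      ((tendsto_integral_inner_steklov guxx guxx hT hpos hlim).const_mul (5 * B))).sub
      ((tendsto_integral_inner_steklov gux gux hT hpos hlim).const_mul (3 * b * B))).add
      ((tendsto_integral_inner_steklov gu gu hT hpos hlim).const_mul (a * B)) |>.add
      (t6.const_mul 2))
    refine (split (hcI ?_) (hcI ?_) (hcI ?_) (hcI ?_) (hcI ?_) (hcI ?_)).2.symm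
    · exact (cF _).inner (cF _)
    · exact (cy _).inner (cy _)
    · exact (cuxx _).inner (cuxx _)
    · exact (cux _).inner (cux _)
    · exact (cu _).inner (cu _)
    · exact (cq _).inner (((cu _).const_smul B).add ((affineMul L A B).continuous.comp (cux _)))
  have int_eq : ∀ n, ∫ r in (0 : ℝ)..T, energyRate a b L A B (steklov (hn n) Fh r)
      (steklov (hn n) yh r) (steklov (hn n) uh r) (steklov (hn n) uxh r) (steklov (hn n) uxxh r)
      (steklov (hn n) qh r) =
      inner ℝ (affineMul L A B (steklov (hn n) ub T)) (steklov (hn n) ub T)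
      - inner ℝ (affineMul L A B (steklov (hn n) ub 0)) (steklov (hn n) ub 0) := by
    intro n
    set h := hn n
    have hd : ∀ t, HasDerivAt (fun t => inner ℝ (affineMul L A B (steklov h ub t)) (steklov h ub t))
        (2 * inner ℝ (affineMul L A B (steklov h ub t)) (h⁻¹ • (ub (t + h) - ub t))) t := by
      intro t
      have h1 := hasDerivAt_steklov hubc h t
      have h2 := (affineMul L A B).hasFDerivAt.comp_hasDerivAt t h1
      refine (h2.inner ℝ h1).congr_deriv ?_
      -- Symmetry of multiplication by `A + B x` makes the two halves of the derivative equal.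
      rw [inner_affineMul_comm hL.le A B (h⁻¹ • (ub (t + h) - ub t))]
      simp only [Function.comp_apply]
      ring
    have hsc : Continuous (steklov h ub) := continuous_steklov hubc.locallyIntegrable h
    rw [← intervalIntegral.integral_eq_sub_of_hasDerivAt (fun t _ => hd t)]
    · apply intervalIntegral.integral_congr
      intro t ht
      rw [uIcc_of_le hT] at ht
      exact (avg (hpos n) (hle1 n) ht).symm
    · apply Continuous.intervalIntegrable
      exact continuous_const.mul (((affineMul L A B).continuous.comp hsc).inner
        ((by fun_prop : Continuous fun t => h⁻¹ • (ub (t + h) - ub t))))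
  have lim2 : ∀ t, Tendsto (fun n => inner ℝ (affineMul L A B (steklov (hn n) ub t))
      (steklov (hn n) ub t)) atTop (𝓝 (inner ℝ (affineMul L A B (ub t)) (ub t))) := by
    intro t
    have h1 := (tendsto_steklov hubc t).comp hlim'
    exact (((affineMul L A B).continuous.tendsto _).comp h1).inner h1
  -- The same integrals converge both to the integrated rate and, by continuity of `u` in time, to
  -- the difference of the weighted energies.
  simp only [int_eq] at lim1
  have fin := tendsto_nhds_unique lim1 ((lim2 T).sub (lim2 0))
  rw [hub_eq T hT, hub_eq 0 le_rfl] at fin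
  have hcongr : ∀ r ∈ S, energyRate a b L A B (Fh r) (yh r) (uh r) (uxh r) (uxxh r) (qh r) =
      energyRate a b L A B (F r) (y r) (u r) (ux r) (uxx r) (powPrimLp p c (u r)) := by
    intro r hr
    simp only [hFh, hyh, huh, huxh, huxxh, hqh, indicator_of_mem hr]
  have hsub : Ioc 0 T ⊆ S := fun r hr => ⟨hr.1, by linarith [hr.2]⟩
  constructor
  · apply ri.congr
    intro r hr
    rw [uIoc_of_le hT] at hr
    exact hcongr r (hsub hr)
  · rw [← fin]
    apply intervalIntegral.integral_congr_ae
    refine Eventually.of_forall fun r hr => ?_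
    rw [uIoc_of_le hT] at hr
    exact (hcongr r (hsub hr)).symm

end EnergyIdentity

/-! ### The delay measure and the memory term -/

section Delay

set_option linter.unusedSectionVars false

/-- The measure `lam(s) ds` on `(τ₁, τ₂)`. -/
noncomputable def delayMeasure (τ₁ τ₂ : ℝ) (lam : ℝ → ℝ) : Measure ℝ :=
  (volume.restrict (Ioo τ₁ τ₂)).withDensity (fun s => ENNReal.ofReal (lam s))

variable {τ₁ τ₂ : ℝ} {lam : ℝ → ℝ}

theorem delayMeasure_absolutelyContinuous :
    delayMeasure τ₁ τ₂ lam ≪ volume.restrict (Ioo τ₁ τ₂) :=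
  withDensity_absolutelyContinuous _ _

theorem ae_delayMeasure {P : ℝ → Prop} (h : ∀ᵐ s ∂volume.restrict (Ioo τ₁ τ₂), P s) :
    ∀ᵐ s ∂delayMeasure τ₁ τ₂ lam, P s :=
  delayMeasure_absolutelyContinuous.ae_le h

theorem ae_mem_delayMeasure : ∀ᵐ s ∂delayMeasure τ₁ τ₂ lam, s ∈ Ioo τ₁ τ₂ :=
  ae_delayMeasure (ae_restrict_mem measurableSet_Ioo)

theorem isFiniteMeasure_delayMeasure (hlam : MemLp lam ⊤ (volume.restrict (Ioo τ₁ τ₂))) :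
    IsFiniteMeasure (delayMeasure τ₁ τ₂ lam) :=
  isFiniteMeasure_withDensity_ofReal (hlam.integrable le_top).hasFiniteIntegral

theorem integral_delayMeasure (hτ : τ₁ < τ₂) (hlam : MemLp lam ⊤ (volume.restrict (Ioo τ₁ τ₂)))
    (hpos : ∀ᵐ s ∂volume.restrict (Ioo τ₁ τ₂), 0 < lam s) (g : ℝ → ℝ) :
    ∫ s, g s ∂delayMeasure τ₁ τ₂ lam = ∫ s in τ₁..τ₂, lam s * g s := by
  rw [delayMeasure, integral_withDensity_eq_integral_toReal_smul₀
    hlam.aestronglyMeasurable.aemeasurable.ennreal_ofReal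
    (Eventually.of_forall fun s => ENNReal.ofReal_lt_top),
    intervalIntegral.integral_of_le hτ.le, integral_Ioc_eq_integral_Ioo]
  apply integral_congr_ae
  filter_upwards [hpos] with s hs
  rw [ENNReal.toReal_ofReal hs.le, smul_eq_mul]

theorem integrable_delayMeasure (hlam : MemLp lam ⊤ (volume.restrict (Ioo τ₁ τ₂)))
    {g : ℝ → ℝ} (hg : IntegrableOn g (Ioo τ₁ τ₂)) :
    Integrable g (delayMeasure τ₁ τ₂ lam) := by
  rw [delayMeasure, integrable_withDensity_iff_integrable_smul₀'
    hlam.aestronglyMeasurable.aemeasurable.ennreal_ofReal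
    (Eventually.of_forall fun s => ENNReal.ofReal_lt_top)]
  have h1 : MemLp (fun s => (ENNReal.ofReal (lam s)).toReal) ⊤ (volume.restrict (Ioo τ₁ τ₂)) := by
    refine hlam.mono
      hlam.aestronglyMeasurable.aemeasurable.ennreal_ofReal.ennreal_toReal.aestronglyMeasurable
      (Eventually.of_forall fun s => ?_)
    rw [Real.norm_of_nonneg ENNReal.toReal_nonneg, ENNReal.toReal_ofReal']
    exact max_le (le_abs_self _) (norm_nonneg _)
  have h2 := h1.eLpNorm_ne_top
  rw [eLpNorm_exponent_top] at h2
  exact Integrable.essSup_smul hg h1.aestronglyMeasurable h2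

/-- A nonnegative density on `(-τ₂, ∞)` whose memory integrals with respect to the measure `ν` of
delays in `(0, τ₂)` are finite. -/
structure IsDelayDensity (τ₂ : ℝ) (ν : Measure ℝ) (D : ℝ → ℝ) : Prop where
  measurable : Measurable D
  nonneg : ∀ σ, 0 ≤ D σ
  past : ∀ s, 0 < s → s < τ₂ → IntervalIntegrable D volume (-s) 0
  future : ∀ T, 0 ≤ T → IntervalIntegrable D volume 0 T
  memory : Integrable (fun s => ∫ σ in (-s)..0, D σ) ν

variable {ν : Measure ℝ} {D : ℝ → ℝ}

namespace IsDelayDensity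

theorem intervalIntegrable (hD : IsDelayDensity τ₂ ν D) {s T : ℝ} (hs : 0 < s) (hs₂ : s < τ₂)
    (hT : 0 ≤ T) {x z : ℝ} (hx : x ∈ Icc (-s) T) (hz : z ∈ Icc (-s) T) :
    IntervalIntegrable D volume x z := by
  refine ((hD.past s hs hs₂).trans (hD.future T hT)).mono_set ?_
  rw [uIcc_of_le (by linarith : -s ≤ T)]
  exact uIcc_subset_Icc hx hz

variable [IsFiniteMeasure ν]

/-- For fixed `s` the time integral is at most `∫_{-s}^0 D + ∫_0^T D`, which is integrable in `s` by
the memory condition. This is the basis of all uses of Fubini below. -/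
theorem integrable_prod (hD : IsDelayDensity τ₂ ν D) (hν : ∀ᵐ s ∂ν, 0 < s ∧ s < τ₂) {T : ℝ}
    (hT : 0 ≤ T) :
    Integrable (fun q : ℝ × ℝ => D (q.2 - q.1)) (ν.prod (volume.restrict (Ioc 0 T))) := by
  have hm : Measurable (fun q : ℝ × ℝ => D (q.2 - q.1)) :=
    hD.measurable.comp (measurable_snd.sub measurable_fst)
  have hslice : ∀ᵐ s ∂ν, IntervalIntegrable (fun r => D (r - s)) volume 0 T := by
    filter_upwards [hν] with s hs
    have h := (hD.intervalIntegrable hs.1 hs.2 hT (x := 0 - s) (z := T - s)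
      ⟨by linarith, by linarith⟩ ⟨by linarith, by linarith⟩).comp_sub_right s
    simpa using h
  rw [integrable_prod_iff hm.aestronglyMeasurable]
  constructor
  · filter_upwards [hslice] with s hs
    exact (intervalIntegrable_iff_integrableOn_Ioc_of_le hT).1 hs
  · refine Integrable.mono' (hD.memory.add (integrable_const (∫ σ in (0 : ℝ)..T, D σ)))
      hm.norm.aestronglyMeasurable.integral_prod_right' ?_
    filter_upwards [hν] with s hs
    rw [Real.norm_of_nonneg (integral_nonneg fun _ => norm_nonneg _)]
    simp only [Real.norm_of_nonneg (hD.nonneg _), Pi.add_apply]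
    rw [← intervalIntegral.integral_of_le hT, intervalIntegral.integral_comp_sub_right,
      intervalIntegral.integral_add_adjacent_intervals (hD.past s hs.1 hs.2) (hD.future T hT),
      zero_sub]
    exact intervalIntegral.integral_mono_interval le_rfl (by linarith) (by linarith)
      (Eventually.of_forall hD.nonneg) ((hD.past s hs.1 hs.2).trans (hD.future T hT))

theorem ae_integrable_shift (hD : IsDelayDensity τ₂ ν D) (hν : ∀ᵐ s ∂ν, 0 < s ∧ s < τ₂) {T : ℝ}
    (hT : 0 ≤ T) :
    ∀ᵐ r ∂volume.restrict (Ioc 0 T), Integrable (fun s => D (r - s)) ν :=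
  (hD.integrable_prod hν hT).prod_left_ae

/-- Splitting the window this way leaves `t` only as an upper limit of integrals over `(0, t)`, so
the memory is seen to be a primitive without differentiating under the integral sign. -/
theorem memory_eq (hD : IsDelayDensity τ₂ ν D) (hν : ∀ᵐ s ∂ν, 0 < s ∧ s < τ₂) {t : ℝ}
    (ht : 0 ≤ t) : ∀ᵐ s ∂ν, ∫ σ in (t - s)..t, D σ =
      (∫ σ in (-s)..0, D σ) + (∫ σ in (0 : ℝ)..t, D σ) - ∫ r in Ioc 0 t, D (r - s) := by
  filter_upwards [hν] with s hs
  rw [← intervalIntegral.integral_of_le ht, intervalIntegral.integral_comp_sub_right,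
    intervalIntegral.integral_add_adjacent_intervals (hD.past s hs.1 hs.2) (hD.future t ht),
    zero_sub, eq_sub_iff_add_eq, add_comm,
    intervalIntegral.integral_add_adjacent_intervals
      (hD.intervalIntegrable hs.1 hs.2 ht ⟨by linarith, by linarith⟩ ⟨by linarith, by linarith⟩)
      (hD.intervalIntegrable hs.1 hs.2 ht ⟨by linarith, by linarith⟩ ⟨by linarith, by linarith⟩)]

theorem integrable_memory (hD : IsDelayDensity τ₂ ν D) (hν : ∀ᵐ s ∂ν, 0 < s ∧ s < τ₂) {t : ℝ}
    (ht : 0 ≤ t) : Integrable (fun s => ∫ σ in (t - s)..t, D σ) ν := by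
  refine Integrable.congr ?_ ((hD.memory_eq hν ht).mono fun s hs => hs.symm)
  exact (hD.memory.add (integrable_const _)).sub (hD.integrable_prod hν ht).integral_prod_left

/-- The evolution of the memory term. -/
theorem isPrimitiveOn (hD : IsDelayDensity τ₂ ν D) (hν : ∀ᵐ s ∂ν, 0 < s ∧ s < τ₂) {T : ℝ}
    (hT : 0 ≤ T) :
    IsPrimitiveOn T (fun t => ∫ s, (∫ σ in (t - s)..t, D σ) ∂ν)
      (fun r => ν.real univ * D r - ∫ s, D (r - s) ∂ν) := by
  have hint : ∀ t, 0 ≤ t → IntervalIntegrable (fun r => ∫ s, D (r - s) ∂ν) volume 0 t := by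
    intro t ht
    rw [intervalIntegrable_iff_integrableOn_Ioc_of_le ht]
    exact (hD.integrable_prod hν ht).integral_prod_right
  refine ⟨((hD.future T hT).const_mul _).sub (hint T hT), fun t ht => ?_⟩
  simp only [zero_sub]
  have hP := hD.integrable_prod hν ht.1
  rw [intervalIntegral.integral_sub ((hD.future t ht.1).const_mul _) (hint t ht.1),
    intervalIntegral.integral_const_mul, integral_congr_ae (hD.memory_eq hν ht.1),
    integral_sub (f := fun s => (∫ σ in (-s)..0, D σ) + ∫ σ in (0 : ℝ)..t, D σ)
      (hD.memory.add (integrable_const _)) hP.integral_prod_left,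
    integral_add hD.memory (integrable_const _), integral_const, smul_eq_mul,
    intervalIntegral.integral_of_le ht.1 (f := fun r => ∫ s, D (r - s) ∂ν),
    integral_integral_swap (f := fun s r => D (r - s)) hP]
  ring

/-- On the past `exp (δ σ) ≤ 1`, so the weight costs nothing, and the evolution law of the memory
also applies to the weighted density. -/
theorem exp_mul (hD : IsDelayDensity τ₂ ν D) (hν : ∀ᵐ s ∂ν, 0 < s ∧ s < τ₂) {δ : ℝ} (hδ : 0 < δ) :
    IsDelayDensity τ₂ ν (fun σ => Real.exp (δ * σ) * D σ) := by
  have hm : Measurable (fun σ => Real.exp (δ * σ) * D σ) :=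
    (Continuous.measurable (by fun_prop)).mul hD.measurable
  have hpast : ∀ s, 0 < s → s < τ₂ →
      IntervalIntegrable (fun σ => Real.exp (δ * σ) * D σ) volume (-s) 0 := fun s h1 h2 =>
    (hD.past s h1 h2).continuousOn_mul (Continuous.continuousOn (by fun_prop))
  refine ⟨hm, fun σ => mul_nonneg (Real.exp_nonneg _) (hD.nonneg σ), hpast, fun T hT =>
    (hD.future T hT).continuousOn_mul (Continuous.continuousOn (by fun_prop)), ?_⟩
  have hmeas : AEStronglyMeasurable (fun s => ∫ σ in (-s)..0, Real.exp (δ * σ) * D σ) ν := by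
    -- Measurability in `s` of an integral with variable limit, as the partial integral of an
    -- indicator on the plane.
    have hset : MeasurableSet {q : ℝ × ℝ | -q.1 < q.2 ∧ q.2 ≤ 0} :=
      (measurableSet_lt measurable_fst.neg measurable_snd).inter
        (measurableSet_le measurable_snd measurable_const)
    have h1 : StronglyMeasurable (fun s => ∫ σ, {q : ℝ × ℝ | -q.1 < q.2 ∧ q.2 ≤ 0}.indicator
        (fun q => Real.exp (δ * q.2) * D q.2) (s, σ)) :=
      ((hm.comp measurable_snd).indicator hset).stronglyMeasurable.integral_prod_right'
    refine h1.aestronglyMeasurable.congr ?_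
    filter_upwards [hν] with s hs
    rw [intervalIntegral.integral_of_le (by linarith), ← integral_indicator measurableSet_Ioc]
    rfl
  refine hD.memory.mono' hmeas ?_
  filter_upwards [hν] with s hs
  rw [Real.norm_of_nonneg (intervalIntegral.integral_nonneg (by linarith) fun σ _ =>
    mul_nonneg (Real.exp_nonneg _) (hD.nonneg σ))]
  apply intervalIntegral.integral_mono_on (by linarith) (hpast s hs.1 hs.2) (hD.past s hs.1 hs.2)
  intro σ hσ
  exact mul_le_of_le_one_left (hD.nonneg σ) (Real.exp_le_one_iff.2
    (mul_nonpos_of_nonneg_of_nonpos hδ.le hσ.2))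

end IsDelayDensity

/-- This is `∫ (k - f)² ≥ 0`; as a quadratic polynomial in `k` its discriminant yields
Cauchy-Schwarz. -/
theorem sq_integral_le {ν : Measure ℝ} [IsFiniteMeasure ν] {f : ℝ → ℝ} (hf : MemLp f 2 ν) (k : ℝ) :
    0 ≤ k ^ 2 * ν.real univ - 2 * k * (∫ s, f s ∂ν) + ∫ s, f s ^ 2 ∂ν := by
  have h1 : Integrable f ν := hf.integrable (by norm_num)
  have h : 0 ≤ ∫ s, (k ^ 2 - 2 * k * f s + f s ^ 2) ∂ν :=
    integral_nonneg fun s => by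
      change 0 ≤ k ^ 2 - 2 * k * f s + f s ^ 2
      nlinarith [sq_nonneg (k - f s)]
  rw [integral_add (f := fun s => k ^ 2 - 2 * k * f s) ((integrable_const _).sub
      (h1.const_mul _)) hf.integrable_sq,
    integral_sub (integrable_const _) (h1.const_mul _), integral_const, integral_const_mul,
    smul_eq_mul] at h
  linarith

/-- The feedback is dominated by the trace and its memory. -/
theorem feedback_sq_le {ν : Measure ℝ} [IsFiniteMeasure ν] {f : ℝ → ℝ} (hf : MemLp f 2 ν)
    (α β v : ℝ) :
    (α * v + β * ∫ s, f s ∂ν) ^ 2 ≤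
      (|α| + |β| * ν.real univ) * (|α| * v ^ 2 + |β| * ∫ s, f s ^ 2 ∂ν) := by
  have hq := sq_integral_le hf
  set I := ∫ s, f s ∂ν
  set J := ∫ s, f s ^ 2 ∂ν
  set Λ := ν.real univ
  have h1 : I ^ 2 ≤ Λ * J := by
    have := discrim_le_zero (a := Λ) (b := -2 * I) (c := J) (fun k => by nlinarith [hq k])
    rw [discrim] at this
    nlinarith
  have h2 : 2 * (α * β) * (v * I) ≤ |α| * |β| * (Λ * v ^ 2 + J) := by
    -- The cross term uses the same polynomial at `k = v` and `k = -v`.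
    have h3 : |2 * (v * I)| ≤ Λ * v ^ 2 + J := by
      rw [abs_le]; constructor
      · nlinarith [hq (-v)]
      · nlinarith [hq v]
    calc 2 * (α * β) * (v * I) = (α * β) * (2 * (v * I)) := by ring
      _ ≤ |(α * β) * (2 * (v * I))| := le_abs_self _
      _ = |α| * |β| * |2 * (v * I)| := by rw [abs_mul, abs_mul]
      _ ≤ _ := by gcongr
  have h4 : β ^ 2 * I ^ 2 ≤ β ^ 2 * (Λ * J) := by gcongr
  have e1 := sq_abs α
  have e2 := sq_abs β
  calc (α * v + β * I) ^ 2 = |α| ^ 2 * v ^ 2 + 2 * (α * β) * (v * I) + β ^ 2 * I ^ 2 := by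
        rw [e1]; ring
    _ ≤ |α| ^ 2 * v ^ 2 + |α| * |β| * (Λ * v ^ 2 + J) + |β| ^ 2 * (Λ * J) := by
        rw [e2]; gcongr
    _ = _ := by ring

end Delay

/-! ### The boundary trace, its history and the feedback -/

section Trace

variable {τ₁ τ₂ : ℝ} {lam z₀ y : ℝ → ℝ}

theorem ae_comp_sub_left {P : ℝ → Prop} (h : ∀ᵐ σ, P σ) (t : ℝ) : ∀ᵐ s, P (t - s) :=
  (quasiMeasurePreserving_sub_left_of_right_invariant volume t).ae h

theorem mul_integral_comp_neg_mul (z : ℝ → ℝ) (s : ℝ) :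
    s * ∫ ρ in (0 : ℝ)..1, z (-(ρ * s)) ^ 2 = ∫ σ in (-s)..0, z σ ^ 2 := by
  have h := intervalIntegral.mul_integral_comp_sub_mul (a := 0) (b := 1)
    (f := fun σ => z σ ^ 2) s 0
  simp only [zero_sub, mul_one, mul_zero, neg_zero] at h
  rw [← h]
  simp only [mul_comm]

theorem intervalIntegrable_of_comp_neg_mul {f : ℝ → ℝ} {s : ℝ} (hs : 0 < s)
    (h : IntegrableOn (fun ρ => f (-(ρ * s))) (Ioo 0 1)) :
    IntervalIntegrable f volume (-s) 0 := by
  have h1 : IntervalIntegrable (fun ρ => f (-s * ρ)) volume (0 / -s) (-s / -s) := by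
    rw [zero_div, div_self (by linarith), intervalIntegrable_iff_integrableOn_Ioo_of_le (by simp)]
    refine h.congr_fun (fun ρ _ => ?_) measurableSet_Ioo
    simp only
    congr 1; ring
  exact ((IntervalIntegrable.comp_mul_left_iff (by linarith)).1 h1).symm

/-- A measurable version of the trace, whose square is a delay density. -/
theorem exists_measurable_trace (hτ₁ : 0 < τ₁) (hτ : τ₁ < τ₂)
    (hlam : MemLp lam ⊤ (volume.restrict (Ioo τ₁ τ₂)))
    (hz : MemLp (fun q : ℝ × ℝ => z₀ (-(q.1 * q.2))) 2
      (volume.restrict (Ioo (0 : ℝ) 1 ×ˢ Ioo τ₁ τ₂)))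
    (hist : ∀ᵐ t ∂volume.restrict (Ioo (-τ₂) 0), y t = z₀ t)
    (hy : ∀ T : ℝ, MemLp y 2 (volume.restrict (Ioo 0 T))) :
    ∃ y' : ℝ → ℝ, Measurable y' ∧ (∀ᵐ σ, -τ₂ < σ → y σ = y' σ) ∧
      IsDelayDensity τ₂ (delayMeasure τ₁ τ₂ lam) (fun σ => y' σ ^ 2) := by
  rw [Measure.volume_eq_prod, ← Measure.prod_restrict] at hz
  have hsq := hz.integrable_sq
  have h1 := hz.integrable (by norm_num : (1 : ENNReal) ≤ 2)
  have hslice : ∀ᵐ s ∂volume.restrict (Ioo τ₁ τ₂), IntervalIntegrable z₀ volume (-s) 0 ∧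
      IntervalIntegrable (fun σ => z₀ σ ^ 2) volume (-s) 0 := by
    filter_upwards [hsq.prod_left_ae, h1.prod_left_ae, ae_restrict_mem measurableSet_Ioo]
      with s h2 h3 hs
    exact ⟨intervalIntegrable_of_comp_neg_mul (hτ₁.trans hs.1) h3,
      intervalIntegrable_of_comp_neg_mul (f := fun σ => z₀ σ ^ 2) (hτ₁.trans hs.1) h2⟩
  -- Fubini gives integrability on `(-s, 0)` only for almost every `s` in `(τ₁, τ₂)`, but any `s <
  -- τ₂` lies below a good one.
  have hall : ∀ s, 0 < s → s < τ₂ → IntervalIntegrable z₀ volume (-s) 0 ∧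
      IntervalIntegrable (fun σ => z₀ σ ^ 2) volume (-s) 0 := by
    intro s hs hs₂
    have hlt : max s τ₁ < τ₂ := max_lt hs₂ hτ
    have hsub : Ioo (max s τ₁) τ₂ ⊆ Ioo τ₁ τ₂ := Ioo_subset_Ioo_left (le_max_right _ _)
    have : (ae (volume.restrict (Ioo (max s τ₁) τ₂))).NeBot := by
      rw [ae_restrict_neBot, Real.volume_Ioo]
      simpa using hlt
    obtain ⟨s', ⟨h2, h3⟩, hs'⟩ := ((ae_restrict_of_ae_restrict_of_subset hsub hslice).and
      (ae_restrict_mem measurableSet_Ioo)).exists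
    have hss : s ≤ s' := (le_max_left _ _).trans hs'.1.le
    have hset : uIcc (-s) 0 ⊆ uIcc (-s') 0 := by
      rw [uIcc_of_le (by linarith), uIcc_of_le (by linarith)]
      exact Icc_subset_Icc_left (by linarith)
    exact ⟨h2.mono_set hset, h3.mono_set hset⟩
  -- Integrability may fail up to `-τ₂`, so measurability is obtained on an exhaustion by `(-v n,
  -- 0]` with `v n` increasing to `τ₂`.
  have hzm : AEStronglyMeasurable z₀ (volume.restrict (Ioo (-τ₂) 0)) := by
    obtain ⟨v, -, hv, hvt⟩ := exists_seq_strictMono_tendsto τ₂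
    have hU : Ioo (-τ₂) 0 ⊆ ⋃ n, Ioc (-(v n)) 0 := by
      intro σ hσ
      obtain ⟨n, hn⟩ := (hvt.eventually (lt_mem_nhds (by linarith [hσ.1] : -σ < τ₂))).exists
      exact mem_iUnion.2 ⟨n, by linarith, hσ.2.le⟩
    refine AEStronglyMeasurable.mono_set hU (aestronglyMeasurable_iUnion_iff.2 fun n => ?_)
    rcases le_or_gt (v n) 0 with h | h
    · rw [Ioc_eq_empty (by linarith), Measure.restrict_empty]
      exact aestronglyMeasurable_zero_measure _
    · exact ((hall (v n) h (hv n)).1).1.aestronglyMeasurable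
  have hym : AEStronglyMeasurable y (volume.restrict (Ioi (-τ₂))) := by
    have hU : Ioi (-τ₂) ⊆ Ioo (-τ₂) 0 ∪ ({0} ∪ ⋃ n : ℕ, Ioo 0 (n : ℝ)) := by
      intro σ hσ
      rcases lt_trichotomy σ 0 with h | h | h
      · exact Or.inl ⟨hσ, h⟩
      · exact Or.inr (Or.inl h)
      · obtain ⟨n, hn⟩ := exists_nat_gt σ
        exact Or.inr (Or.inr (mem_iUnion.2 ⟨n, h, hn⟩))
    refine AEStronglyMeasurable.mono_set hU (aestronglyMeasurable_union_iff.2 ⟨?_,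
      aestronglyMeasurable_union_iff.2 ⟨?_, aestronglyMeasurable_iUnion_iff.2 fun n =>
        (hy n).aestronglyMeasurable⟩⟩)
    · exact hzm.congr (hist.mono fun _ h => h.symm)
    · rw [Measure.restrict_eq_zero.2 (measure_singleton 0)]
      exact aestronglyMeasurable_zero_measure _
  have hyy' : ∀ᵐ σ, -τ₂ < σ → y σ = hym.mk y σ :=
    (ae_restrict_iff' measurableSet_Ioi).1 hym.ae_eq_mk
  have hy'z : ∀ᵐ σ, σ ∈ Ioo (-τ₂) 0 → hym.mk y σ = z₀ σ := by
    filter_upwards [hyy', (ae_restrict_iff' measurableSet_Ioo).1 hist] with σ h2 h3 hσ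
    rw [← h2 hσ.1, h3 hσ]
  have hpast : ∀ s, 0 < s → s < τ₂ → ∀ᵐ σ ∂volume.restrict (uIoc (-s) 0),
      z₀ σ ^ 2 = hym.mk y σ ^ 2 := by
    intro s hs hs₂
    rw [uIoc_of_le (by linarith), ← restrict_Ioo_eq_restrict_Ioc,
      ae_restrict_iff' measurableSet_Ioo]
    filter_upwards [hy'z] with σ h2 hσ
    rw [h2 ⟨by linarith [hσ.1], hσ.2⟩]
  refine ⟨hym.mk y, hym.stronglyMeasurable_mk.measurable, hyy', ?_,
    fun _ => sq_nonneg _, ?_, ?_, ?_⟩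
  · exact hym.stronglyMeasurable_mk.measurable.pow_const 2
  · intro s hs hs₂
    exact (hall s hs hs₂).2.congr_ae (hpast s hs hs₂)
  · intro T hT
    have h2 : IntervalIntegrable (fun σ => y σ ^ 2) volume 0 T := by
      rw [intervalIntegrable_iff_integrableOn_Ioo_of_le hT]
      exact (hy T).integrable_sq
    refine h2.congr_ae ?_
    rw [uIoc_of_le hT, EventuallyEq, ae_restrict_iff' measurableSet_Ioc]
    filter_upwards [hyy'] with σ h3 hσ
    rw [h3 (by linarith [hσ.1])]
  · apply integrable_delayMeasure hlam
    have h2 := hsq.integral_prod_right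
    have h3 : IntegrableOn (fun s => s * ∫ ρ in Ioo (0 : ℝ) 1, z₀ (-(ρ * s)) ^ 2) (Ioo τ₁ τ₂) := by
      refine Integrable.mono' (h2.norm.const_mul τ₂)
        (continuous_id.aestronglyMeasurable.mul h2.aestronglyMeasurable) ?_
      filter_upwards [ae_restrict_mem measurableSet_Ioo] with s hs
      rw [norm_mul, Real.norm_of_nonneg (hτ₁.trans hs.1).le]
      gcongr
      exact hs.2.le
    refine h3.congr ?_
    filter_upwards [ae_restrict_mem measurableSet_Ioo] with s hs
    rw [← integral_Ioc_eq_integral_Ioo, ← intervalIntegral.integral_of_le zero_le_one,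
      mul_integral_comp_neg_mul]
    exact intervalIntegral.integral_congr_ae_restrict (hpast s (hτ₁.trans hs.1) hs.2)

variable {y' : ℝ → ℝ}

/-- Holds at every `t ≥ 0`, because reflection preserves null sets. The single delay `s = τ₂` is
discarded: at `t = 0` it would reach `-τ₂`, where nothing is known. -/
theorem feedback_eq (hτ : τ₁ < τ₂) (hlam : MemLp lam ⊤ (volume.restrict (Ioo τ₁ τ₂)))
    (hpos : ∀ᵐ s ∂volume.restrict (Ioo τ₁ τ₂), 0 < lam s)
    (hyy' : ∀ᵐ σ, -τ₂ < σ → y σ = y' σ) (α β : ℝ) {t : ℝ} (ht : 0 ≤ t) :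
    feedback α β τ₁ τ₂ lam y t = α * y t + β * ∫ s, y' (t - s) ∂delayMeasure τ₁ τ₂ lam := by
  have h := intervalIntegral.integral_comp_sub_left (a := τ₁) (b := τ₂)
    (fun s => lam (t - s) * y s) t
  simp only [sub_sub_cancel] at h
  rw [feedback, ← h, integral_delayMeasure hτ hlam hpos]
  congr 2
  apply intervalIntegral.integral_congr_ae
  filter_upwards [ae_comp_sub_left hyy' t, Measure.ae_ne volume τ₂] with s hs hne hsI
  rw [uIoc_of_le hτ.le] at hsI
  rw [hs (by linarith [lt_of_le_of_ne hsI.2 hne])]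

theorem integral_memory_eq (hτ₁ : 0 < τ₁) (hτ : τ₁ < τ₂)
    (hlam : MemLp lam ⊤ (volume.restrict (Ioo τ₁ τ₂)))
    (hpos : ∀ᵐ s ∂volume.restrict (Ioo τ₁ τ₂), 0 < lam s)
    (hyy' : ∀ᵐ σ, -τ₂ < σ → y σ = y' σ) {t : ℝ} (ht : 0 ≤ t) :
    ∫ s in τ₁..τ₂, s * lam s * ∫ ρ in (0 : ℝ)..1, (y (t - s * ρ)) ^ 2 =
      ∫ s, (∫ σ in (t - s)..t, y' σ ^ 2) ∂delayMeasure τ₁ τ₂ lam := by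
  rw [integral_delayMeasure hτ hlam hpos]
  apply intervalIntegral.integral_congr_ae
  filter_upwards [Measure.ae_ne volume τ₂] with s hne hsI
  rw [uIoc_of_le hτ.le] at hsI
  have h := intervalIntegral.mul_integral_comp_sub_mul (a := 0) (b := 1)
    (f := fun σ => y σ ^ 2) s t
  simp only [mul_one, mul_zero, sub_zero] at h
  rw [mul_comm s, mul_assoc, h]
  congr 1
  apply intervalIntegral.integral_congr_ae
  filter_upwards [hyy'] with σ h2 hσ
  rw [uIoc_of_le (by linarith [hsI.1])] at hσ
  rw [h2 (by linarith [hσ.1, lt_of_le_of_ne hsI.2 hne])]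

theorem normH_eq {L β : ℝ} (hτ₁ : 0 < τ₁) (hτ : τ₁ < τ₂)
    (hlam : MemLp lam ⊤ (volume.restrict (Ioo τ₁ τ₂)))
    (hpos : ∀ᵐ s ∂volume.restrict (Ioo τ₁ τ₂), 0 < lam s)
    (hist : ∀ᵐ t ∂volume.restrict (Ioo (-τ₂) 0), y t = z₀ t)
    (hyy' : ∀ᵐ σ, -τ₂ < σ → y σ = y' σ) (u₀ : L2 L) :
    normH L β τ₁ τ₂ lam u₀ z₀ = Real.sqrt ((∫ x in (0 : ℝ)..L, (u₀ x) ^ 2) +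
      |β| * ∫ s, (∫ σ in (-s)..0, y' σ ^ 2) ∂delayMeasure τ₁ τ₂ lam) := by
  rw [normH, integral_delayMeasure hτ hlam hpos]
  congr 3
  apply intervalIntegral.integral_congr_ae
  filter_upwards [Measure.ae_ne volume τ₂] with s hne hsI
  rw [uIoc_of_le hτ.le] at hsI
  rw [intervalIntegral.integral_const_mul, mul_comm s, mul_assoc, mul_integral_comp_neg_mul]
  congr 1
  apply intervalIntegral.integral_congr_ae
  filter_upwards [hyy', (ae_restrict_iff' measurableSet_Ioo).1 hist, Measure.ae_ne volume 0]
    with σ h2 h3 h4 hσ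
  rw [uIoc_of_le (by linarith [hsI.1])] at hσ
  have h5 : -τ₂ < σ := by linarith [hσ.1, lt_of_le_of_ne hsI.2 hne]
  rw [← h2 h5, h3 ⟨h5, lt_of_le_of_ne hσ.2 h4⟩]

theorem memLp_feedback (hτ₁ : 0 < τ₁) (hτ : τ₁ < τ₂)
    (hlam : MemLp lam ⊤ (volume.restrict (Ioo τ₁ τ₂)))
    (hpos : ∀ᵐ s ∂volume.restrict (Ioo τ₁ τ₂), 0 < lam s)
    (hy : ∀ T : ℝ, MemLp y 2 (volume.restrict (Ioo 0 T)))
    (hm : Measurable y') (hyy' : ∀ᵐ σ, -τ₂ < σ → y σ = y' σ)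
    (hD : IsDelayDensity τ₂ (delayMeasure τ₁ τ₂ lam) (fun σ => y' σ ^ 2)) (α β T : ℝ) :
    MemLp (feedback α β τ₁ τ₂ lam y) 2 (volume.restrict (Ioo 0 T)) := by
  have := isFiniteMeasure_delayMeasure hlam
  have hν : ∀ᵐ s ∂delayMeasure τ₁ τ₂ lam, 0 < s ∧ s < τ₂ :=
    ae_mem_delayMeasure.mono fun s hs => ⟨hτ₁.trans hs.1, hs.2⟩
  rcases lt_or_ge T 0 with hT | hT
  · rw [Ioo_eq_empty (by linarith), Measure.restrict_empty]
    exact ⟨aestronglyMeasurable_zero_measure _, by simp⟩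
  have hIm : StronglyMeasurable fun r => ∫ s, y' (r - s) ∂delayMeasure τ₁ τ₂ lam :=
    StronglyMeasurable.integral_prod_right (f := fun r s => y' (r - s))
      (hm.comp (measurable_fst.sub measurable_snd)).stronglyMeasurable
  have e : ∀ᵐ r ∂volume.restrict (Ioo 0 T), α * y r + β * ∫ s, y' (r - s) ∂delayMeasure τ₁ τ₂ lam
      = feedback α β τ₁ τ₂ lam y r := by
    filter_upwards [ae_restrict_mem measurableSet_Ioo] with r hr
    rw [feedback_eq hτ hlam hpos hyy' α β hr.1.le]
  refine MemLp.ae_eq e (((hy T).const_mul α).add (MemLp.const_mul ?_ β))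
  rw [memLp_two_iff_integrable_sq hIm.aestronglyMeasurable]
  have hP : Integrable (fun r => ∫ s, y' (r - s) ^ 2 ∂delayMeasure τ₁ τ₂ lam)
      (volume.restrict (Ioc 0 T)) := (hD.integrable_prod hν hT).integral_prod_right
  rw [restrict_Ioo_eq_restrict_Ioc]
  refine Integrable.mono' (hP.const_mul ((delayMeasure τ₁ τ₂ lam).real univ))
    (hIm.aestronglyMeasurable.pow 2) ?_
  filter_upwards [hD.ae_integrable_shift hν hT] with r hr
  have hf : MemLp (fun s => y' (r - s)) 2 (delayMeasure τ₁ τ₂ lam) :=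
    (memLp_two_iff_integrable_sq
      (hm.comp (measurable_const.sub measurable_id)).aestronglyMeasurable).2 hr
  -- With these parameters the estimate is plain Cauchy-Schwarz for the delayed trace.
  have h := feedback_sq_le hf 0 1 0
  rw [Real.norm_of_nonneg (sq_nonneg _)]
  simpa using h

end Trace

/-! ### The Lyapunov functional -/

section Lyapunov

set_option linter.unusedSectionVars false

theorem IsPrimitiveOn.le_of_deriv_nonpos {T : ℝ} {F f : ℝ → ℝ} (hT : 0 ≤ T)
    (hF : IsPrimitiveOn T F f) (h : ∀ᵐ x ∂volume.restrict (Ioo 0 T), f x ≤ 0) : F T ≤ F 0 := by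
  have h1 := hF.integral_eq hT
  have h2 : ∫ x in (0 : ℝ)..T, f x ≤ 0 := by
    rw [intervalIntegral.integral_of_le hT, integral_Ioc_eq_integral_Ioo]
    exact integral_nonpos_of_ae h
  linarith

namespace IsDelayDensity

variable {τ₂ δ : ℝ} {ν : Measure ℝ} {D : ℝ → ℝ} [IsFiniteMeasure ν]

theorem memory_nonneg (hD : IsDelayDensity τ₂ ν D) (hν : ∀ᵐ s ∂ν, 0 < s ∧ s < τ₂) (t : ℝ) :
    0 ≤ ∫ s, (∫ σ in (t - s)..t, D σ) ∂ν := by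
  apply integral_nonneg_of_ae
  filter_upwards [hν] with s hs
  exact intervalIntegral.integral_nonneg (by linarith) fun σ _ => hD.nonneg σ

/-- In the window `0 ≤ t - σ ≤ s < τ₂`, so the weight `exp (-δ (t - σ))` lies between `exp (-δ τ₂)`
and `1`. This and the next lemma make the weighted and plain memories comparable. -/
theorem exp_memory_le (hD : IsDelayDensity τ₂ ν D) (hν : ∀ᵐ s ∂ν, 0 < s ∧ s < τ₂) (hδ : 0 < δ)
    {t : ℝ} (ht : 0 ≤ t) :
    Real.exp (-δ * t) * ∫ s, (∫ σ in (t - s)..t, Real.exp (δ * σ) * D σ) ∂ν ≤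
      ∫ s, (∫ σ in (t - s)..t, D σ) ∂ν := by
  have hE := hD.exp_mul hν hδ
  rw [← integral_const_mul]
  apply integral_mono_ae ((hE.integrable_memory hν ht).const_mul _) (hD.integrable_memory hν ht)
  filter_upwards [hν] with s hs
  have hx : t - s ∈ Icc (-s) t := ⟨by linarith, by linarith⟩
  have hz : t ∈ Icc (-s) t := ⟨by linarith, le_rfl⟩
  rw [← intervalIntegral.integral_const_mul]
  apply intervalIntegral.integral_mono_on (by linarith)
    ((hE.intervalIntegrable hs.1 hs.2 ht hx hz).const_mul _)
    (hD.intervalIntegrable hs.1 hs.2 ht hx hz)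
  intro σ hσ
  rw [← mul_assoc, ← Real.exp_add]
  apply mul_le_of_le_one_left (hD.nonneg σ)
  rw [Real.exp_le_one_iff]
  nlinarith [hσ.2]

theorem le_exp_memory (hD : IsDelayDensity τ₂ ν D) (hν : ∀ᵐ s ∂ν, 0 < s ∧ s < τ₂) (hδ : 0 < δ)
    {t : ℝ} (ht : 0 ≤ t) :
    Real.exp (-δ * τ₂) * ∫ s, (∫ σ in (t - s)..t, D σ) ∂ν ≤
      Real.exp (-δ * t) * ∫ s, (∫ σ in (t - s)..t, Real.exp (δ * σ) * D σ) ∂ν := by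
  have hE := hD.exp_mul hν hδ
  rw [← integral_const_mul, ← integral_const_mul]
  apply integral_mono_ae ((hD.integrable_memory hν ht).const_mul _)
    ((hE.integrable_memory hν ht).const_mul _)
  filter_upwards [hν] with s hs
  have hx : t - s ∈ Icc (-s) t := ⟨by linarith, by linarith⟩
  have hz : t ∈ Icc (-s) t := ⟨by linarith, le_rfl⟩
  rw [← intervalIntegral.integral_const_mul, ← intervalIntegral.integral_const_mul]
  apply intervalIntegral.integral_mono_on (by linarith)
    ((hD.intervalIntegrable hs.1 hs.2 ht hx hz).const_mul _)
    ((hE.intervalIntegrable hs.1 hs.2 ht hx hz).const_mul _)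
  intro σ hσ
  rw [← mul_assoc (Real.exp (-δ * t)), ← Real.exp_add]
  apply mul_le_mul_of_nonneg_right _ (hD.nonneg σ)
  rw [Real.exp_le_exp]
  nlinarith [hσ.1, hs.2]

end IsDelayDensity

/-- Dissipation of the interior terms of the Lyapunov functional. -/
theorem interior_rate_le {a b L p μ μ₁ K G : ℝ} (ha : 0 < a) (hL : 0 < L) (hp : 1 ≤ p)
    (hμ₁ : 0 < μ₁) (hμ : 0 < μ)
    (hG : G = (p + 2) * (3 * Real.pi ^ 2 * b - a * L ^ 2) - 2 * Real.pi ^ 2 * K) (hGpos : 0 < G)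
    (hμG : 2 * μ * (1 + L * μ₁) * (L ^ 2 * (p + 2)) ≤ μ₁ * G) {e d X : ℝ} (he : 0 ≤ e)
    (hpoin : Real.pi ^ 2 * e ≤ L ^ 2 * d) (hX : X ≤ (1 + L * μ₁) * e) :
    μ₁ * (-3 * b * d + a * e + 2 * ((p + 2)⁻¹ * (K * d))) ≤ -2 * μ * X := by
  have hp2 : 0 < p + 2 := by linarith
  have hpi := Real.pi_pos
  have hLp : 0 < L ^ 2 * (p + 2) := by positivity
  have h3 : (-3 * b * d + a * e + 2 * ((p + 2)⁻¹ * (K * d))) * (L ^ 2 * (p + 2)) ≤ -G * e := by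
    have e1 : (-3 * b * d + a * e + 2 * ((p + 2)⁻¹ * (K * d))) * (L ^ 2 * (p + 2)) =
        L ^ 2 * (-3 * (p + 2) * b * d + (p + 2) * a * e + 2 * (K * d)) := by
      field_simp
    rw [e1]
    -- Poincaré is used twice: here to bound `a e` by a multiple of `d`, then, as `G > 0`, to turn
    -- the remaining `-G d` into decay of `e`.
    have e2 : Real.pi ^ 2 * (-3 * (p + 2) * b * d + (p + 2) * a * e + 2 * (K * d)) ≤ -G * d := by
      have : (p + 2) * a * (Real.pi ^ 2 * e) ≤ (p + 2) * a * (L ^ 2 * d) := by gcongr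
      rw [hG]; linarith
    have e3 : G * (Real.pi ^ 2 * e) ≤ G * (L ^ 2 * d) := by gcongr
    have e4 : Real.pi ^ 2 * (L ^ 2 * (-3 * (p + 2) * b * d + (p + 2) * a * e + 2 * (K * d))) ≤
        Real.pi ^ 2 * (-G * e) := by
      calc _ = L ^ 2 * (Real.pi ^ 2 *
            (-3 * (p + 2) * b * d + (p + 2) * a * e + 2 * (K * d))) := by ring
        _ ≤ L ^ 2 * (-G * d) := by gcongr
        _ ≤ _ := by linarith
    exact le_of_mul_le_mul_left e4 (by positivity)
  have k1 : 2 * μ * X ≤ 2 * μ * ((1 + L * μ₁) * e) := by gcongr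
  have k2 : 2 * μ * (1 + L * μ₁) * (L ^ 2 * (p + 2)) * e ≤ μ₁ * G * e := by gcongr
  have k3 := mul_le_mul_of_nonneg_left h3 hμ₁.le
  have k4 : (μ₁ * (-3 * b * d + a * e + 2 * ((p + 2)⁻¹ * (K * d)))) * (L ^ 2 * (p + 2)) ≤
      (-(2 * μ * ((1 + L * μ₁) * e))) * (L ^ 2 * (p + 2)) := by
    linarith
  have k5 := le_of_mul_le_mul_right k4 hLp
  linarith

/-- Dissipation of the boundary and memory terms of the Lyapunov functional. -/
theorem boundary_rate_le {α β Λ θ μ m δ ε k F Y H H' N M : ℝ} (hθ : θ = |α| + |β| * Λ)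
    (hm0 : 0 < m) (hm : m = 1 - θ) (hμ : 0 < μ) (hk : 0 ≤ k) (hkθ : k * θ ≤ 1) (hδ : 0 < δ)
    (hμm : 2 * μ * (1 + m) ≤ m * δ * ε) (hY : 0 ≤ Y) (hH : 0 ≤ H) (hH' : 0 ≤ H') (hN : 0 ≤ N)
    (hF : F ≤ θ * (|α| * Y + |β| * H)) (hMN : M ≤ N) (hNM : ε * N ≤ M) :
    k * F - Y + |β| * (Λ * Y - H) + m * |β| * (-δ * M + (Λ * Y - H')) ≤
      -2 * μ * (|β| * N + m * |β| * M) := by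
  have hβ := abs_nonneg β
  have hα := abs_nonneg α
  have h1 : k * F ≤ |α| * Y + |β| * H := by
    have hS : 0 ≤ |α| * Y + |β| * H := by positivity
    calc k * F ≤ k * (θ * (|α| * Y + |β| * H)) := by gcongr
      _ = (k * θ) * (|α| * Y + |β| * H) := by ring
      _ ≤ 1 * (|α| * Y + |β| * H) := by gcongr
      _ = _ := one_mul _
  -- The coefficient is `-m + m |β| Λ`, and `|β| Λ ≤ θ ≤ 1`.
  have h2 : (|α| - 1 + |β| * Λ + m * (|β| * Λ)) * Y ≤ 0 := by
    have h : m * (|β| * Λ) ≤ m * 1 := mul_le_mul_of_nonneg_left (by linarith) hm0.le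
    exact mul_nonpos_of_nonpos_of_nonneg (by linarith) hY
  -- Only `M` is damped; the damping reaches `N` through `ε N ≤ M`.
  have h3 : 2 * μ * (N + m * M) ≤ m * δ * M := by
    calc 2 * μ * (N + m * M) ≤ 2 * μ * (N + m * N) := by gcongr
      _ = 2 * μ * (1 + m) * N := by ring
      _ ≤ m * δ * ε * N := by gcongr
      _ = m * δ * (ε * N) := by ring
      _ ≤ m * δ * M := by gcongr
  have h4 := mul_le_mul_of_nonneg_left h3 hβ
  have h5 : 0 ≤ m * |β| * H' := by positivity
  linarith

/-- The functional `V` of the introduction, multiplied by `exp (2 μ t)`, is a primitive of an almost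
everywhere nonpositive function. The hypotheses are the absorption conditions for the boundary,
memory and interior terms, and the factor in front is the comparison constant between `V` and `E`.
-/
theorem decaysExponentially_of_rates {a b L α β τ₁ τ₂ p c : ℝ} {lam : ℝ → ℝ}
    (ha : 0 < a) (hτ₁ : 0 < τ₁) (hτ : τ₁ < τ₂) (hp₁ : 1 ≤ p) (hp₂ : p ≤ 2) (hc : |c| ≤ 1)
    (hlam : MemLp lam ⊤ (volume.restrict (Ioo τ₁ τ₂)))
    (hlam_pos : ∀ᵐ s ∂volume.restrict (Ioo τ₁ τ₂), 0 < lam s) (hL : 0 < L)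
    {θ m μ μ₁ δ r G : ℝ} (hθ : θ = |α| + |β| * ∫ s in τ₁..τ₂, lam s) (hm0 : 0 < m)
    (hm : m = 1 - θ) (hμ : 0 < μ) (hμ₁ : 0 < μ₁) (hkθ : (1 + μ₁ * L) * θ ≤ 1) (hδ : 0 < δ)
    (hr : 0 < r) (hμm : 2 * μ * (1 + m) ≤ m * δ * Real.exp (-δ * τ₂))
    (hG : G = (p + 2) * (3 * Real.pi ^ 2 * b - a * L ^ 2)
      - 2 * Real.pi ^ 2 * (L ^ (2 - p / 2) * r ^ p)) (hGpos : 0 < G)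
    (hμG : 2 * μ * (1 + L * μ₁) * (L ^ 2 * (p + 2)) ≤ μ₁ * G) :
    DecaysExponentially a b L α β τ₁ τ₂ p c lam r (1 + L * μ₁ + m) μ := by
  intro u₀ z₀ hz hnorm u y hsol t ht
  obtain ⟨ux, uxx, huxx, hder, heq⟩ := hsol.equation
  obtain ⟨y', hy'm, hyy', hD⟩ :=
    exists_measurable_trace hτ₁ hτ hlam hz hsol.history hsol.trace_memLp
  set ν := delayMeasure τ₁ τ₂ lam with hνdef
  have hfin : IsFiniteMeasure ν := isFiniteMeasure_delayMeasure hlam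
  have hν : ∀ᵐ s ∂ν, 0 < s ∧ s < τ₂ :=
    ae_mem_delayMeasure.mono fun s hs => ⟨hτ₁.trans hs.1, hs.2⟩
  have hΛ : ν.real univ = ∫ s in τ₁..τ₂, lam s := by
    have h := integral_delayMeasure hτ hlam hlam_pos (fun _ => 1)
    simpa using h
  rw [← hΛ] at hθ
  set Λ := ν.real univ with hΛdef
  set N : ℝ → ℝ := fun t => ∫ s, (∫ σ in (t - s)..t, y' σ ^ 2) ∂ν with hNdef
  have hN0 : ∀ t, 0 ≤ N t := hD.memory_nonneg hν
  have hE : ∀ t, 0 ≤ t → energy L β τ₁ τ₂ lam u y t = ‖u t‖ ^ 2 + |β| * N t := by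
    intro t ht
    rw [energy, L2.norm_sq_eq hL.le, integral_memory_eq hτ₁ hτ hlam hlam_pos hyy' ht]
  have hE0 : ‖u 0‖ ^ 2 + |β| * N 0 < r ^ 2 := by
    rw [normH_eq hτ₁ hτ hlam hlam_pos hsol.history hyy', Real.sqrt_lt' hr] at hnorm
    rw [L2.norm_sq_eq hL.le, hsol.initial]
    simpa only [hNdef, zero_sub] using hnorm
  have hFm := memLp_feedback hτ₁ hτ hlam hlam_pos hsol.trace_memLp hy'm hyy' hD α β
  have ident := weighted_energy_identity (a := a) (b := b) hL hp₁ hp₂ hc hsol.continuousOn hFm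
    hsol.trace_memLp huxx hder (by simpa only [hsol.initial] using heq)
  -- the feedback is bounded by the trace
  have hFle : ∀ T, 0 ≤ T → ∀ᵐ r ∂volume.restrict (Ioo 0 T), y r = y' r ∧
      feedback α β τ₁ τ₂ lam y r ^ 2 ≤
        θ * (|α| * y' r ^ 2 + |β| * ∫ s, y' (r - s) ^ 2 ∂ν) := by
    intro T hT
    rw [restrict_Ioo_eq_restrict_Ioc]
    filter_upwards [hD.ae_integrable_shift hν hT, ae_restrict_of_ae hyy',
      ae_restrict_mem measurableSet_Ioc] with r h1 h2 hr
    have hyr : y r = y' r := h2 (by linarith [hr.1])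
    refine ⟨hyr, ?_⟩
    rw [feedback_eq hτ hlam hlam_pos hyy' α β hr.1.le, hyr, hθ]
    exact feedback_sq_le ((memLp_two_iff_integrable_sq
      (hy'm.comp (measurable_const.sub measurable_id)).aestronglyMeasurable).2 h1) α β _
  have hderT : ∀ T, ∀ᵐ r ∂volume.restrict (Ioo 0 T), HasH02Derivs L (u r) (ux r) (uxx r) :=
    fun T => ae_restrict_of_ae_restrict_of_subset (fun r hr => hr.1) hder
  have hH0 : ∀ r, 0 ≤ ∫ s, y' (r - s) ^ 2 ∂ν := fun r => integral_nonneg fun s => sq_nonneg _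
  have hθ0 : 0 ≤ θ := by rw [hθ]; positivity
  -- the energy does not increase
  have hbound : ∀ T, 0 ≤ T → ‖u T‖ ≤ r := by
    intro T hT
    -- The constant weight `1`: all interior terms disappear and the nonlinearity contributes
    -- nothing positive.
    have hP := (ident 1 0 T hT).add ((hD.isPrimitiveOn hν hT).const_mul |β|)
    have hle := hP.le_of_deriv_nonpos hT (by
      filter_upwards [hFle T hT, hderT T] with r ⟨h1, h2⟩ h3
      have hq := h3.inner_powPrimLp_le hL hp₁ hp₂ hc 1 le_rfl
      rw [zero_mul] at hq
      rw [energyRate, h1]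
      simp only [real_inner_self_eq_norm_sq, Real.norm_eq_abs, sq_abs]
      -- Only the sign of the boundary terms is wanted: the memory values `N`, `M`, `H'` are set to
      -- zero, and `μ`, `δ`, `ε` are dummies chosen to meet the rate condition with equality.
      have hb := boundary_rate_le (α := α) (β := β) (Λ := Λ) (μ := 1) (m := m)
        (δ := 2 * (1 + m) / m)
        (ε := 1) (k := 1) (H' := 0) (N := 0) (M := 0) hθ hm0 hm one_pos zero_le_one (by linarith)
        (by positivity) (by field_simp; rfl) (sq_nonneg (y' r)) (hH0 r) le_rfl le_rfl h2 le_rfl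
        (by simp)
      have hpos : 0 ≤ m * |β| * (Λ * y' r ^ 2) := by positivity
      nlinarith)
    have e : ∀ v : L2 L, inner ℝ (affineMul L 1 0 v) v = ‖v‖ ^ 2 := fun v => by
      rw [inner_affineMul hL.le, L2.norm_sq_eq hL.le]
      congr 1; ext x; ring
    simp only [e] at hle
    have h2 : ‖u T‖ ^ 2 ≤ r ^ 2 := by
      have := mul_nonneg (abs_nonneg β) (hN0 T)
      simp only [hNdef] at hE0 this
      linarith
    exact le_of_sq_le_sq h2 hr.le
  -- the Lyapunov functional
  set X : ℝ → ℝ := fun t => inner ℝ (affineMul L 1 μ₁ (u t)) (u t) with hXdef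
  have hXe : ∀ t, X t = ∫ x in (0 : ℝ)..L, (1 + μ₁ * x) * u t x ^ 2 := by
    intro t
    simp only [hXdef]
    rw [inner_affineMul hL.le]
    congr 1; ext x; ring
  have hXi : ∀ t, IntervalIntegrable (fun x => (1 + μ₁ * x) * u t x ^ 2) volume 0 L := fun t =>
    (L2.sq_intervalIntegrable hL.le (u t)).continuousOn_mul (Continuous.continuousOn (by fun_prop))
  have hX1 : ∀ t, ‖u t‖ ^ 2 ≤ X t := by
    intro t
    rw [hXe, L2.norm_sq_eq hL.le]
    apply intervalIntegral.integral_mono_on hL.le (L2.sq_intervalIntegrable hL.le _) (hXi t)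
    intro x hx
    have := mul_nonneg (mul_nonneg hμ₁.le hx.1) (sq_nonneg (u t x))
    linarith
  have hX2 : ∀ t, X t ≤ (1 + L * μ₁) * ‖u t‖ ^ 2 := by
    intro t
    rw [hXe, L2.norm_sq_eq hL.le, ← intervalIntegral.integral_const_mul]
    apply intervalIntegral.integral_mono_on hL.le (hXi t)
      ((L2.sq_intervalIntegrable hL.le _).const_mul _)
    intro x hx
    apply mul_le_mul_of_nonneg_right _ (sq_nonneg _)
    nlinarith [hx.2]
  -- The weight `exp (-δ (t - σ))` is factored so that the inner density does not depend on `t`; the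
  -- prefactor in `M` then supplies the damping `-δ M`.
  set P : ℝ → ℝ := fun t => ∫ s, (∫ σ in (t - s)..t, Real.exp (δ * σ) * y' σ ^ 2) ∂ν with hPdef
  set M : ℝ → ℝ := fun t => Real.exp (-δ * t) * P t with hMdef
  have hMN : ∀ t, 0 ≤ t → M t ≤ N t := fun t ht => hD.exp_memory_le hν hδ ht
  have hNM : ∀ t, 0 ≤ t → Real.exp (-δ * τ₂) * N t ≤ M t := fun t ht => hD.le_exp_memory hν hδ ht
  have hDe := hD.exp_mul hν hδ
  have pexp : ∀ k T : ℝ, IsPrimitiveOn T (fun t => Real.exp (k * t))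
      (fun t => Real.exp (k * t) * k) := fun k T =>
    .of_hasDerivAt (fun x => by simpa using ((hasDerivAt_id x).const_mul k).exp) (by fun_prop)
  have pM := ((pexp (-δ) t).mul ht.le (hDe.isPrimitiveOn hν ht.le)).const_mul (m * |β|)
  have pV := ((ident 1 μ₁ t ht.le).add ((hD.isPrimitiveOn hν ht.le).const_mul |β|)).add pM
  have pW := (pexp (2 * μ) t).mul ht.le pV
  have hle := pW.le_of_deriv_nonpos ht.le (by
    filter_upwards [hFle t ht.le, hderT t, ae_restrict_mem measurableSet_Ioo]
      with r' ⟨h1, h2⟩ h3 hr'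
    have hq := h3.inner_powPrimLp_le hL hp₁ hp₂ hc 1 hμ₁.le
    -- Smallness of the data persists for all times, so the nonlinear term keeps its small constant.
    have hrp : ‖u r'‖ ^ p ≤ r ^ p :=
      Real.rpow_le_rpow (norm_nonneg _) (hbound r' hr'.1.le) (by linarith)
    have hq' : inner ℝ (powPrimLp p c (u r')) (μ₁ • u r' + affineMul L 1 μ₁ (ux r')) ≤
        μ₁ * ((p + 2)⁻¹ * (L ^ (2 - p / 2) * r ^ p * ‖ux r'‖ ^ 2)) := by
      refine hq.trans ?_
      gcongr
    have hin := interior_rate_le ha hL hp₁ hμ₁ hμ hG hGpos hμG (sq_nonneg ‖u r'‖)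
      (h3.poincare hL) (hX2 r')
    have hH'0 : 0 ≤ Real.exp (-δ * r') * ∫ s, Real.exp (δ * (r' - s)) * y' (r' - s) ^ 2 ∂ν :=
      mul_nonneg (Real.exp_nonneg _) (integral_nonneg fun s =>
        mul_nonneg (Real.exp_nonneg _) (sq_nonneg _))
    have hb := boundary_rate_le (α := α) (β := β) (Λ := Λ) hθ hm0 hm hμ (by positivity) hkθ hδ hμm
      (sq_nonneg (y' r')) (hH0 r') hH'0 (hN0 r') h2 (hMN r' hr'.1.le) (hNM r' hr'.1.le)
    have hexp : Real.exp (-δ * r') * (Real.exp (δ * r') * y' r' ^ 2) = y' r' ^ 2 := by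
      rw [← mul_assoc, ← Real.exp_add]; simp
    have hxx : 0 ≤ 5 * μ₁ * ‖uxx r'‖ ^ 2 := by positivity
    rw [energyRate, h1]
    simp only [real_inner_self_eq_norm_sq, Real.norm_eq_abs, sq_abs]
    rw [mul_assoc, ← mul_add]
    apply mul_nonpos_of_nonneg_of_nonpos (Real.exp_nonneg _)
    have hMr : M r' = Real.exp (-δ * r') * P r' := rfl
    have hNr : N r' = ∫ s, (∫ σ in (r' - s)..r', y' σ ^ 2) ∂ν := rfl
    have hPr : P r' = ∫ s, (∫ σ in (r' - s)..r', Real.exp (δ * σ) * y' σ ^ 2) ∂ν := rfl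
    have hXr : X r' = inner ℝ (affineMul L 1 μ₁ (u r')) (u r') := rfl
    rw [← hNr, ← hPr, ← hXr]
    have hexp' : Real.exp (-δ * r') * -δ * P r' = -δ * M r' := by rw [hMr]; ring
    rw [hexp', mul_sub (Real.exp (-δ * r')), mul_left_comm (Real.exp (-δ * r')) Λ, hexp, ← hMr]
    linarith)
  simp only [mul_zero, Real.exp_zero, one_mul] at hle
  rw [hE t ht.le, hE 0 le_rfl]
  have hVt : ‖u t‖ ^ 2 + |β| * N t ≤ X t + |β| * N t + m * |β| * M t := by
    have h1 := hX1 t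
    have h2 : 0 ≤ M t := (mul_nonneg (Real.exp_nonneg _) (hN0 t)).trans (hNM t ht.le)
    have h3 : 0 ≤ m * |β| * M t := by positivity
    linarith
  have hV0 : X 0 + |β| * N 0 + m * |β| * M 0 ≤ (1 + L * μ₁ + m) * (‖u 0‖ ^ 2 + |β| * N 0) := by
    have h1 := hX2 0
    have h2 : m * |β| * M 0 ≤ m * |β| * N 0 := by
      have := hMN 0 le_rfl
      gcongr
    have h3 : 0 ≤ m * ‖u 0‖ ^ 2 := by positivity
    have h4 : 0 ≤ L * μ₁ * (|β| * N 0) := by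
      have := hN0 0
      positivity
    linarith
  have hW : Real.exp (2 * μ * t) * (X t + |β| * N t + m * |β| * M t) ≤
      X 0 + |β| * N 0 + m * |β| * M 0 := by
    have hM0 : M 0 = P 0 := by simp [hMdef]
    rw [hM0]
    exact hle
  have hexp : Real.exp (-2 * μ * t) * Real.exp (2 * μ * t) = 1 := by
    rw [← Real.exp_add]; simp
  calc ‖u t‖ ^ 2 + |β| * N t ≤ X t + |β| * N t + m * |β| * M t := hVt
    _ = Real.exp (-2 * μ * t) * (Real.exp (2 * μ * t) * (X t + |β| * N t + m * |β| * M t)) := by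
        linear_combination -(X t + |β| * N t + m * |β| * M t) * hexp
    _ ≤ Real.exp (-2 * μ * t) * ((1 + L * μ₁ + m) * (‖u 0‖ ^ 2 + |β| * N 0)) := by
        exact mul_le_mul_of_nonneg_left (hW.trans hV0) (Real.exp_nonneg _)
    _ = _ := mul_comm _ _

end Lyapunov

/-! ### Choice of the constants -/

theorem theorem1p1 (a b L α β τ₁ τ₂ p c : ℝ) (lam : ℝ → ℝ)
    (ha : 0 < a) (hb : 0 < b) (hα : α ≠ 0) (hβ : β ≠ 0)
    (hτ₁ : 0 < τ₁) (hτ : τ₁ < τ₂) (hp₁ : 1 ≤ p) (hp₂ : p ≤ 2) (hc : |c| ≤ 1)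
    (hlam : MemLp lam ⊤ (volume.restrict (Ioo τ₁ τ₂)))
    (hlam_pos : ∀ᵐ s ∂volume.restrict (Ioo τ₁ τ₂), 0 < lam s)
    (hgain : |α| + |β| * (∫ s in τ₁..τ₂, lam s) < 1)
    (hL : 0 < L) (hL' : L < Real.sqrt (3 * b / a) * Real.pi) :
    (∃ r > 0, ∃ κ > 0, ∃ μ > 0, DecaysExponentially a b L α β τ₁ τ₂ p c lam r κ μ) ∧
    (∃ η > 0, ∀ μ₁ μ₂ δ r μ : ℝ, 0 < μ₁ → μ₁ < η → 0 < μ₂ → μ₂ < η → 0 < δ → 0 < r →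
      r < ((p + 2) * (3 * Real.pi ^ 2 * b - a * L ^ 2) /
            (2 * Real.pi ^ 2 * L ^ (2 - p / 2))) ^ (1 / p) →
      0 < μ →
      μ < min (μ₂ * |β| * Real.exp (-δ * τ₂) * δ / (2 * (1 + μ₁ * |β|)))
            (μ₁ / (2 * L ^ 2 * (1 + L * μ₁) * (p + 2)) *
              ((p + 2) * (3 * Real.pi ^ 2 * b - a * L ^ 2)
                - 2 * Real.pi ^ 2 * L ^ (2 - p / 2) * r ^ p)) →
      ∃ κ > 0, DecaysExponentially a b L α β τ₁ τ₂ p c lam r κ μ) := by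
  have hβ0 : 0 < |β| := abs_pos.2 hβ
  have hπ := Real.pi_pos
  have hp2 : 0 < p + 2 := by linarith
  have hLp : 0 < L ^ (2 - p / 2) := Real.rpow_pos_of_pos hL _
  set S : ℝ := 3 * Real.pi ^ 2 * b - a * L ^ 2 with hS
  have hSpos : 0 < S := by
    have h1 : L ^ 2 < (Real.sqrt (3 * b / a) * Real.pi) ^ 2 := by gcongr
    rw [mul_pow, Real.sq_sqrt (by positivity), div_mul_eq_mul_div, lt_div_iff₀ ha] at h1
    rw [hS]; linarith
  have hGpos : ∀ r : ℝ, 0 < r → r < ((p + 2) * S / (2 * Real.pi ^ 2 * L ^ (2 - p / 2))) ^ (1 / p) →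
      0 < (p + 2) * S - 2 * Real.pi ^ 2 * L ^ (2 - p / 2) * r ^ p := by
    intro r hr hlt
    have h1 := Real.rpow_lt_rpow hr.le hlt (by linarith : 0 < p)
    rw [← Real.rpow_mul (by positivity), one_div_mul_cancel (by linarith), Real.rpow_one,
      lt_div_iff₀ (by positivity)] at h1
    linarith
  set θ : ℝ := |α| + |β| * ∫ s in τ₁..τ₂, lam s with hθ
  have hm0 : 0 < 1 - θ := by linarith
  have hΛ0 : 0 ≤ ∫ s in τ₁..τ₂, lam s := by
    rw [intervalIntegral.integral_of_le hτ.le, integral_Ioc_eq_integral_Ioo]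
    exact integral_nonneg_of_ae (hlam_pos.mono fun s hs => hs.le)
  have hθ0 : 0 ≤ θ := by positivity
  have part2 : ∃ η > 0, ∀ μ₁ μ₂ δ r μ : ℝ, 0 < μ₁ → μ₁ < η → 0 < μ₂ → μ₂ < η → 0 < δ → 0 < r →
      r < ((p + 2) * S / (2 * Real.pi ^ 2 * L ^ (2 - p / 2))) ^ (1 / p) →
      0 < μ →
      μ < min (μ₂ * |β| * Real.exp (-δ * τ₂) * δ / (2 * (1 + μ₁ * |β|)))
            (μ₁ / (2 * L ^ 2 * (1 + L * μ₁) * (p + 2)) *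
              ((p + 2) * S - 2 * Real.pi ^ 2 * L ^ (2 - p / 2) * r ^ p)) →
      ∃ κ > 0, DecaysExponentially a b L α β τ₁ τ₂ p c lam r κ μ := by
    -- The first bound gives `μ₁ L < 1 - θ`, hence `(1 + μ₁ L) θ ≤ 1`. The second gives `μ₂ |β| (1 +
    -- m) < m` with `m = 1 - θ`: the functional weights its memory by `m`, and `μ₂` enters only
    -- through this comparison of rates.
    refine ⟨min ((1 - θ) / L) ((1 - θ) / ((1 + (1 - θ)) * |β|)), by positivity, ?_⟩
    intro μ₁ μ₂ δ r μ hμ₁ hμ₁η hμ₂ hμ₂η hδ hr hrlt hμ hμlt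
    have hGr := hGpos r hr hrlt
    have hκ : 0 < 1 + L * μ₁ + (1 - θ) := by positivity
    refine ⟨1 + L * μ₁ + (1 - θ), hκ, decaysExponentially_of_rates ha hτ₁ hτ hp₁ hp₂ hc hlam
      hlam_pos hL hθ hm0 rfl hμ hμ₁ ?_ hδ hr ?_ rfl ?_ ?_⟩
    · have h1 : μ₁ * L < 1 - θ := by
        rw [← lt_div_iff₀ hL]; exact hμ₁η.trans_le (min_le_left _ _)
      have h2 : μ₁ * L * θ ≤ μ₁ * L * 1 := by
        apply mul_le_mul_of_nonneg_left _ (by positivity)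
        linarith
      linarith
    · have h1 : μ₂ * ((1 + (1 - θ)) * |β|) < 1 - θ := by
        rw [← lt_div_iff₀ (by positivity)]; exact hμ₂η.trans_le (min_le_right _ _)
      have h2 : μ * (2 * (1 + μ₁ * |β|)) < μ₂ * |β| * Real.exp (-δ * τ₂) * δ := by
        rw [← lt_div_iff₀ (by positivity)]; exact hμlt.trans_le (min_le_left _ _)
      have h3 : 2 * μ ≤ μ₂ * |β| * Real.exp (-δ * τ₂) * δ := by
        have : 0 ≤ μ * (μ₁ * |β|) := by positivity
        linarith
      calc 2 * μ * (1 + (1 - θ)) ≤ μ₂ * |β| * Real.exp (-δ * τ₂) * δ * (1 + (1 - θ)) := by gcongr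
        _ = (μ₂ * ((1 + (1 - θ)) * |β|)) * (δ * Real.exp (-δ * τ₂)) := by ring
        _ ≤ (1 - θ) * (δ * Real.exp (-δ * τ₂)) := by gcongr
        _ = _ := by ring
    · rw [← mul_assoc]; exact hGr
    · have h1 := hμlt.trans_le (min_le_right _ _)
      rw [div_mul_eq_mul_div, lt_div_iff₀ (by positivity)] at h1
      rw [← mul_assoc (2 * Real.pi ^ 2)]
      linarith
  refine ⟨?_, part2⟩
  -- The qualitative statement is the explicit one at `μ₁ = μ₂ = η/2`, `δ = 1`, with `r` and `μ`
  -- half their upper bounds.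
  obtain ⟨η, hη, h⟩ := part2
  set R : ℝ := ((p + 2) * S / (2 * Real.pi ^ 2 * L ^ (2 - p / 2))) ^ (1 / p) with hR
  have hRpos : 0 < R := Real.rpow_pos_of_pos (by positivity) _
  have hGr := hGpos (R / 2) (by positivity) (by linarith)
  set B : ℝ := min (η / 2 * |β| * Real.exp (-1 * τ₂) * 1 / (2 * (1 + η / 2 * |β|)))
    (η / 2 / (2 * L ^ 2 * (1 + L * (η / 2)) * (p + 2)) *
      ((p + 2) * S - 2 * Real.pi ^ 2 * L ^ (2 - p / 2) * (R / 2) ^ p)) with hB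
  have hBpos : 0 < B := lt_min (by positivity) (mul_pos (by positivity) hGr)
  obtain ⟨κ, hκ, hdec⟩ := h (η / 2) (η / 2) 1 (R / 2) (B / 2) (by positivity) (by linarith)
    (by positivity) (by linarith) one_pos (by positivity) (by linarith) (by positivity)
    (by linarith)
  exact ⟨R / 2, by positivity, κ, hκ, B / 2, by positivity, hdec⟩
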